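/- All simplicial complexes are finite abstract simplicial complexes with vertices in a fixed infinite set $V$; a simplex is a finite subset of $V$, and every complex contains the empty simplex $\emptyset$, which is a face of every simplex. For complexes without common vertices, $K\star L=\{A\cup B: A\in K,\ B\in L\}$ is their join; $\partial A$ denotes the complex of proper faces of a simplex $A$, and $\Delta^n$ the complex of all faces of an $n$-simplex. For $A\in K$, $\operatorname{lk}(A,K)=\{B\in K: A\cap B=\emptyset,\ A\cup B\in K\}$ and $\operatorname{st}(A,K)=A\star\operatorname{lk}(A,K)$. For a nonempty simplex $A\in K$ and a vertex $a\in V$ not in $K$, the stellar subdivision $(A,a)$ changes $K$ to the complex $(A,a)K$ obtained by removing $\operatorname{st}(A,K)$ and replacing it by $a\star\partial A\star\operatorname{lk}(A,K)$; the inverse operation $(A,a)^{-1}$, changing $(A,a)K$ to $K$, is a stellar weld. Two complexes are stellar equivalent, written $K\sim L$, if they are related by a finite sequence of stellar subdivisions, stellar welds and simplicial isomorphisms. For $n\ge 0$, a stellar $n$-ball is a complex stellar equivalent to $\Delta^n$. The boundary $\partial K$ is the set of all simplexes of $K$ (including $\emptyset$) whose link in $K$ is a stellar $m$-ball for some $m\ge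 0$. A move $(A,a)$ on $K$, or $(A,a)^{-1}$ resulting in $K$, is internal if $A\notin\partial K$. **Theorem 3.6.** Let $n\ge 0$ and let $K$ be a stellar $n$-ball. Then $K$ can be starred: for every $v\in V$ that is not a vertex of $\partial K$, $K$ is stellar equivalent to the cone $v\star\partial K$ using only internal moves, that is, $K$ can be changed to $v\star\partial K$ by a finite sequence of internal stellar subdivisions, internal stellar welds, and simplicial isomorphisms that fix every vertex of the boundary. -/

import Mathlib

/-!
Finite abstract simplicial complexes, with vertices in an ambient type `V`.

A simplex is identified with its finite set of vertices, and the empty simplex `∅` counts as a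
face of every simplex, so that links, joins and boundaries need no special cases (Mathlib's
`PreAbstractSimplicialComplex` leaves the empty simplex out). Collections of simplexes are sets
`K : Set (Finset V)`; `IsComplex K` says that such a collection is a finite simplicial complex.
-/

namespace StellarTheory

variable {V : Type*}

/-- `K` is a finite simplicial complex: a finite collection of simplexes, containing the empty
simplex and closed under passing to faces. -/
structure IsComplex (K : Set (Finset V)) : Prop where
  finite : K.Finite
  empty_mem : ∅ ∈ K
  mem_of_subset : ∀ ⦃A B : Finset V⦄, B ∈ K → A ⊆ B → A ∈ K

/-- The set of vertices occurring in a collection of simplexes. -/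
def vertices (K : Set (Finset V)) : Set V := {x | ∃ A ∈ K, x ∈ A}

/-- The complex of all faces of the simplex `A` (including `A` itself and `∅`). If `A` has
`n + 1` vertices then this is a copy of the standard complex `Δⁿ`. -/
def fullSimplex (A : Finset V) : Set (Finset V) := {B | B ⊆ A}

/-- The boundary complex `∂A` of the simplex `A`: all its proper faces. -/
def simplexBoundary (A : Finset V) : Set (Finset V) := {B | B ⊂ A}

variable [DecidableEq V]

/-- The join `K ⋆ L = {A ⋆ B : A ∈ K, B ∈ L}`, used only when `K` and `L` have no vertex in
common. -/
def join (K L : Set (Finset V)) : Set (Finset V) := {C | ∃ A ∈ K, ∃ B ∈ L, C = A ∪ B}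

/-- The cone `v ⋆ K`. -/
def cone (v : V) (K : Set (Finset V)) : Set (Finset V) := join (fullSimplex {v}) K

/-- The link of the simplex `A` in `K`. -/
def link (A : Finset V) (K : Set (Finset V)) : Set (Finset V) :=
  {B | B ∈ K ∧ Disjoint A B ∧ A ∪ B ∈ K}

/-- The closed star `A ⋆ lk(A, K)` of the simplex `A` in `K`. -/
def closedStar (A : Finset V) (K : Set (Finset V)) : Set (Finset V) := join (fullSimplex A) (link A K)

/-- `IsSubdivision A a K K'` says that `K' = (A, a)K`: the stellar subdivision of the complex `K`
at its nonempty simplex `A` with the new vertex `a`, which removes `st(A, K)` and replaces it by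
`a ⋆ ∂A ⋆ lk(A, K)`. -/
def IsSubdivision (A : Finset V) (a : V) (K K' : Set (Finset V)) : Prop :=
  IsComplex K ∧ A ∈ K ∧ A.Nonempty ∧ a ∉ vertices K ∧
    K' = (K \ closedStar A K) ∪ cone a (join (simplexBoundary A) (link A K))

/-- The map `f` restricts to a simplicial isomorphism from `K` to `L`: a bijection between their
vertices that induces a bijection between their simplexes. -/
def IsSimplicialIso (f : V → V) (K L : Set (Finset V)) : Prop :=
  Set.BijOn f (vertices K) (vertices L) ∧ Set.BijOn (fun A : Finset V => A.image f) K L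

/-- One step of a stellar equivalence: a stellar subdivision, a stellar weld (the inverse of a
stellar subdivision), or a simplicial isomorphism. -/
inductive StellarStep (K L : Set (Finset V)) : Prop
  | subdivision (A : Finset V) (a : V) (h : IsSubdivision A a K L)
  | weld (A : Finset V) (a : V) (h : IsSubdivision A a L K)
  | iso (f : V → V) (h : IsSimplicialIso f K L)

/-- Stellar equivalence `K ∼ L`. -/
def StellarEquiv (K L : Set (Finset V)) : Prop := Relation.ReflTransGen StellarStep K L

/-- A stellar `n`-ball (`n ≥ 0`): a simplicial complex that is stellar equivalent to `Δⁿ`. -/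
def IsStellarBall (n : ℕ) (K : Set (Finset V)) : Prop :=
  IsComplex K ∧ ∃ A : Finset V, A.card = n + 1 ∧ StellarEquiv K (fullSimplex A)

/-- The boundary `∂K`: all simplexes of `K` whose link in `K` is a stellar ball. -/
def boundary (K : Set (Finset V)) : Set (Finset V) :=
  {A | A ∈ K ∧ ∃ m : ℕ, IsStellarBall m (link A K)}

/-- One step of a stellar equivalence by internal moves. A subdivision `(A, a)` of a complex, or
the weld `(A, a)⁻¹` back to that complex, is internal if `A` is not in the boundary of the complex.
A simplicial isomorphism is admitted only if it fixes every vertex of the boundary. -/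
inductive InternalStep (K L : Set (Finset V)) : Prop
  | subdivision (A : Finset V) (a : V) (hA : A ∉ boundary K) (h : IsSubdivision A a K L)
  | weld (A : Finset V) (a : V) (hA : A ∉ boundary L) (h : IsSubdivision A a L K)
  | iso (f : V → V) (hf : ∀ x ∈ vertices (boundary K), f x = x) (h : IsSimplicialIso f K L)

/-- Stellar equivalence using only internal moves. -/
def InternalEquiv (K L : Set (Finset V)) : Prop := Relation.ReflTransGen InternalStep K L

end StellarTheory

set_option linter.unusedSectionVars false

namespace StellarTheory

variable {V : Type*} [DecidableEq V]

/-! The proof is an induction on the dimension and, inside it, on the chain of moves joining the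
ball to a simplex. Renaming a vertex is a subdivision at that vertex, so isomorphisms are absorbed
into moves. A simplex is starred by one subdivision at its top face. A move at an interior simplex
keeps the boundary, so starring passes across it at once. This leaves a boundary simplex `A`, with
`F = ∂K`.

From `K` to `(A, a)K` (`Starred.subd`): apply `(A, a)` to every complex in a starring of `K`. Moves
outside `F` neither create nor destroy `A`, and they commute with `(A, a)` up to admissible moves.
The chain ends at the subdivided cone, which is the cone on the subdivided boundary.

From `(A, a)K` back to `K` (`Starred.of_subd`): the link of `A` is a ball of smaller dimension with
boundary `D = lk(A, F)`, starred by induction. Lifted to `K`, its starring replaces the star of `A`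
by the cone from `a` on the boundary of that star, so `K` becomes `(A, a)K ∪ aA ⋆ D`. Starring `(A,
a)K` with the second piece held fixed gives `w ⋆ (A, a)F ∪ aA ⋆ D`. The cone `w ⋆ F` leads to the
same complex, because the link of `A` there is already the cone `w ⋆ D`.

The obstacle is a weld that would recreate a simplex already present in the surrounding complex.
`exists_subdSteps_eqv_cone` removes it: given a finite vertex set `W`, a starring can be rearranged
so that subdivisions at simplexes outside the boundary come first, followed only by moves at
simplexes with a vertex outside `W`. This rests on the commutation of subdivisions up to moves.

The boundary is controlled by parity. Links in a ball are balls or spheres, and a ball has an even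
number of simplexes (the empty one included), a sphere an odd number. Hence the boundary consists of
the simplexes with even link, is a complex, and is subdivided along with the ball. -/

/-! ### Stellar subdivision described by membership -/

theorem IsComplex.down {K : Set (Finset V)} (hK : IsComplex K) {A B : Finset V} (hB : B ∈ K)
    (h : A ⊆ B) : A ∈ K := hK.mem_of_subset hB h

/-- The stellar subdivision of `K` at `A` with new vertex `a`, described by membership. -/
def subd (A : Finset V) (a : V) (K : Set (Finset V)) : Set (Finset V) :=
  {C | ¬A ⊆ C ∧ (C ∈ K ∨ (a ∈ C ∧ C.erase a ∪ A ∈ K))}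

theorem notMem_of_notMem_vertices {K : Set (Finset V)} {a : V} {C : Finset V}
    (h : a ∉ vertices K) (hC : C ∈ K) : a ∉ C := fun h' => h ⟨C, hC, h'⟩

theorem notMem_of_mem_of_notMem_vertices {K : Set (Finset V)} {a : V} {C : Finset V}
    (h : a ∉ vertices K) (hC : a ∈ C) : C ∉ K := fun h' => h ⟨C, h', hC⟩

theorem IsComplex.singleton_mem {K : Set (Finset V)} (hK : IsComplex K) {a : V} :
    {a} ∈ K ↔ a ∈ vertices K :=
  ⟨fun h => ⟨_, h, by simp⟩, fun ⟨C, hC, h⟩ => hK.down hC (by simpa using h)⟩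

theorem mem_link {K : Set (Finset V)} (hK : IsComplex K) {A B : Finset V} :
    B ∈ link A K ↔ Disjoint A B ∧ A ∪ B ∈ K :=
  ⟨fun h => h.2, fun h => ⟨hK.down h.2 Finset.subset_union_right, h⟩⟩

theorem isComplex_link {K : Set (Finset V)} (hK : IsComplex K) {A : Finset V} (hA : A ∈ K) :
    IsComplex (link A K) where
  finite := hK.finite.subset fun _ h => h.1
  empty_mem := ⟨hK.empty_mem, by simp, by simpa⟩
  mem_of_subset B C hC h := by
    rw [mem_link hK] at *
    exact ⟨hC.1.mono_right h, hK.down hC.2 (Finset.union_subset_union_right h)⟩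

theorem mem_cone {K : Set (Finset V)} (hK : IsComplex K) {v : V} {C : Finset V} :
    C ∈ cone v K ↔ C.erase v ∈ K := by
  constructor
  · rintro ⟨A, hA, B, hB, rfl⟩
    refine hK.down hB ?_
    intro x hx
    simp only [Finset.mem_erase, Finset.mem_union] at hx
    rcases hx with ⟨h1, h2 | h2⟩
    · have := hA h2
      simp at this
      exact absurd this h1
    · exact h2
  · intro h
    refine ⟨C ∩ {v}, Finset.inter_subset_right, _, h, ?_⟩
    grind

theorem isSubdivision_iff {A : Finset V} {a : V} {K K' : Set (Finset V)} :
    IsSubdivision A a K K' ↔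
      IsComplex K ∧ A ∈ K ∧ A.Nonempty ∧ a ∉ vertices K ∧ K' = subd A a K := by
  unfold IsSubdivision
  refine and_congr_right fun hK => and_congr_right fun hA => and_congr_right fun hne =>
    and_congr_right fun ha => ?_
  suffices h : (K \ closedStar A K) ∪ cone a (join (simplexBoundary A) (link A K)) = subd A a K by
    rw [h]
  have haA : a ∉ A := notMem_of_notMem_vertices ha hA
  ext C
  constructor
  · rintro (⟨hC, hn⟩ | ⟨S, hS, T, ⟨D, hD, E, hE, rfl⟩, rfl⟩)
    · refine ⟨fun hAC => hn ⟨A, Finset.Subset.refl _, C \ A, ?_, ?_⟩, Or.inl hC⟩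
      · rw [mem_link hK]
        refine ⟨Finset.disjoint_sdiff, ?_⟩
        rwa [Finset.union_sdiff_of_subset hAC]
      · rw [Finset.union_sdiff_of_subset hAC]
    · rw [mem_link hK] at hE
      have hDA : D ⊂ A := hD
      obtain ⟨x, hxA, hxD⟩ := Finset.exists_of_ssubset hDA
      have hS' : S ⊆ {a} := hS
      have hxE : x ∉ E := Finset.disjoint_left.1 hE.1 hxA
      have hxS : x ∉ S := fun h => by
        have := hS' h
        simp at this
        exact haA (this ▸ hxA)
      have haE : a ∉ E := fun h =>
        notMem_of_notMem_vertices ha hE.2 (Finset.mem_union_right _ h)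
      refine ⟨fun h => by simpa [hxS, hxD, hxE] using h hxA, ?_⟩
      by_cases haS : a ∈ S
      · right
        refine ⟨by simp [haS], hK.down hE.2 ?_⟩
        have := hDA.1
        grind
      · left
        refine hK.down hE.2 ?_
        have := hDA.1
        grind
  · rintro ⟨hAC, hC | ⟨haC, hC⟩⟩
    · by_cases hst : C ∈ closedStar A K
      · right
        obtain ⟨D, hD, E, hE, rfl⟩ := hst
        refine ⟨∅, by simp [fullSimplex], D ∪ E, ⟨D, ?_, E, hE, rfl⟩, by simp⟩
        refine Finset.ssubset_iff_subset_ne.2 ⟨hD, ?_⟩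
        rintro rfl
        exact hAC Finset.subset_union_left
      · exact Or.inl ⟨hC, hst⟩
    · right
      refine ⟨{a}, by simp [fullSimplex], C.erase a, ⟨C.erase a ∩ A, ?_, C.erase a \ A, ?_, ?_⟩, ?_⟩
      · refine Finset.ssubset_iff_subset_ne.2 ⟨Finset.inter_subset_right, fun h => hAC ?_⟩
        rw [Finset.inter_eq_right] at h
        exact h.trans (Finset.erase_subset _ _)
      · rw [mem_link hK]
        refine ⟨Finset.disjoint_sdiff, ?_⟩
        rw [Finset.union_sdiff_self_eq_union, Finset.union_comm]
        exact hC
      · grind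
      · grind

theorem mem_subd_of_notMem {A C : Finset V} {a : V} {K : Set (Finset V)} (h : a ∉ C) :
    C ∈ subd A a K ↔ ¬A ⊆ C ∧ C ∈ K := by
  simp [subd, h]

theorem insert_mem_subd {A C : Finset V} {a : V} {K : Set (Finset V)} (h : a ∉ C) (hA : a ∉ A)
    (hK : a ∉ vertices K) : insert a C ∈ subd A a K ↔ ¬A ⊆ C ∧ C ∪ A ∈ K := by
  have h1 : insert a C ∉ K := notMem_of_mem_of_notMem_vertices hK (by simp)
  have h2 : A ⊆ insert a C ↔ A ⊆ C := by
    rw [Finset.subset_insert_iff_of_notMem hA]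
  simp [subd, h, h1, h2, Finset.erase_insert h]

theorem vertices_subd_subset {A : Finset V} {a : V} {K : Set (Finset V)} :
    vertices (subd A a K) ⊆ insert a (vertices K) := by
  rintro x ⟨C, ⟨_, h | ⟨_, h⟩⟩, hx⟩
  · exact Or.inr ⟨C, h, hx⟩
  · by_cases hxa : x = a
    · exact Or.inl hxa
    · exact Or.inr ⟨_, h, by simp [hxa, hx]⟩

theorem notMem_vertices_subd {A : Finset V} {a b : V} {K : Set (Finset V)} (hab : b ≠ a)
    (hb : b ∉ vertices K) : b ∉ vertices (subd A a K) := fun h => by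
  rcases vertices_subd_subset h with h | h
  · exact hab h
  · exact hb h

theorem isComplex_subd {A : Finset V} {a : V} {K : Set (Finset V)} (hK : IsComplex K)
    (hne : A.Nonempty) : IsComplex (subd A a K) where
  finite := by
    refine (hK.finite.biUnion fun B _ => (insert a B).powerset.finite_toSet).subset ?_
    rintro C ⟨_, h | ⟨_, h⟩⟩
    · exact Set.mem_biUnion h (by simp)
    · refine Set.mem_biUnion h ?_
      simp only [Finset.coe_powerset, Set.mem_preimage, Set.mem_powerset_iff, Finset.coe_subset]
      grind
  empty_mem := ⟨by simpa [Finset.subset_empty] using hne.ne_empty, Or.inl hK.empty_mem⟩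
  mem_of_subset B C hC h := by
    refine ⟨fun h' => hC.1 (h'.trans h), ?_⟩
    rcases hC.2 with h1 | ⟨h1, h2⟩
    · exact Or.inl (hK.down h1 h)
    · by_cases ha : a ∈ B
      · exact Or.inr ⟨ha, hK.down h2 (Finset.union_subset_union_left (Finset.erase_subset_erase _ h))⟩
      · exact Or.inl (hK.down h2 (by grind))

theorem IsSubdivision.left {A : Finset V} {a : V} {K K' : Set (Finset V)}
    (h : IsSubdivision A a K K') : IsComplex K := h.1

theorem IsSubdivision.right {A : Finset V} {a : V} {K K' : Set (Finset V)}
    (h : IsSubdivision A a K K') : IsComplex K' := by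
  obtain ⟨h1, h2, h3, h4, rfl⟩ := isSubdivision_iff.1 h
  exact isComplex_subd h1 h3

theorem IsComplex.subdivision {K : Set (Finset V)} (hK : IsComplex K) {A : Finset V} {a : V}
    (hA : A ∈ K) (hne : A.Nonempty) (ha : a ∉ vertices K) : IsSubdivision A a K (subd A a K) :=
  isSubdivision_iff.2 ⟨hK, hA, hne, ha, rfl⟩

theorem finite_vertices {K : Set (Finset V)} (hK : IsComplex K) : (vertices K).Finite := by
  have : vertices K = ⋃ A ∈ K, (A : Set V) := by
    ext x
    simp [vertices]
  rw [this]
  exact hK.finite.biUnion fun A _ => A.finite_toSet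

/-! ### Identities between iterated subdivisions -/

theorem ext_insert {S T : Set (Finset V)} (a : V) (h0 : ∀ C, a ∉ C → (C ∈ S ↔ C ∈ T))
    (h1 : ∀ C, a ∉ C → (insert a C ∈ S ↔ insert a C ∈ T)) : S = T := by
  ext C
  by_cases h : a ∈ C
  · have := h1 (C.erase a) (by simp)
    rwa [Finset.insert_erase h] at this
  · exact h0 C h

/-- Membership in two collections over the same vertices agrees once it agrees on the simplexes
`C`, `b C`, `a C` and `a b C`, where `C` contains neither `a` nor `b`. -/
theorem ext_insert₂ {S T : Set (Finset V)} {a b : V}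
    (h0 : ∀ C, a ∉ C → b ∉ C → (C ∈ S ↔ C ∈ T))
    (hb : ∀ C, a ∉ C → b ∉ C → (insert b C ∈ S ↔ insert b C ∈ T))
    (ha : ∀ C, a ∉ C → b ∉ C → (insert a C ∈ S ↔ insert a C ∈ T))
    (h2 : ∀ C, a ∉ C → b ∉ C → (insert a (insert b C) ∈ S ↔ insert a (insert b C) ∈ T)) :
    S = T := by
  refine ext_insert a (fun C hC => ?_) (fun C hC => ?_)
  · by_cases hbC : b ∈ C
    · have := hb (C.erase b) (by simp [hC]) (by simp)
      rwa [Finset.insert_erase hbC] at this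
    · exact h0 C hC hbC
  · by_cases hbC : b ∈ C
    · have := h2 (C.erase b) (by simp [hC]) (by simp)
      rwa [Finset.insert_erase hbC] at this
    · exact ha C hC hbC

/-- If `A` and `B` are disjoint or have no common coface, a simplex `C ∪ B` of `K` that contains `A`
already has `A ⊆ C`, and symmetrically. So neither subdivision disturbs the condition defining the
other. -/
theorem subd_comm {A B : Finset V} {a b : V} {K : Set (Finset V)} (hK : IsComplex K)
    (hA : A ∈ K) (hB : B ∈ K)
    (hab : a ≠ b) (ha : a ∉ vertices K) (hb : b ∉ vertices K)
    (h : Disjoint A B ∨ A ∪ B ∉ K) :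
    subd A a (subd B b K) = subd B b (subd A a K) := by
  have haA := notMem_of_notMem_vertices ha hA
  have haB := notMem_of_notMem_vertices ha hB
  have hbA := notMem_of_notMem_vertices hb hA
  have hbB := notMem_of_notMem_vertices hb hB
  have ha' : a ∉ vertices (subd B b K) := notMem_vertices_subd hab ha
  have hb' : b ∉ vertices (subd A a K) := notMem_vertices_subd hab.symm hb
  have key1 : ∀ C, C ∪ B ∈ K → A ⊆ C ∪ B → A ⊆ C := by
    rintro C hC hs
    rcases h with h | h
    · exact h.left_le_of_le_sup_right hs
    · exact absurd (hK.down hC (by grind)) h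
  have key2 : ∀ C, C ∪ A ∈ K → B ⊆ C ∪ A → B ⊆ C := by
    rintro C hC hs
    rcases h with h | h
    · exact h.symm.left_le_of_le_sup_right hs
    · exact absurd (hK.down hC (by grind)) h
  refine ext_insert₂ (a := a) (b := b) (fun C hC hbC => ?_) (fun C hC hbC => ?_) (fun C hC hbC => ?_)
    (fun C hC hbC => ?_)
  · rw [mem_subd_of_notMem hC, mem_subd_of_notMem hbC, mem_subd_of_notMem hbC,
      mem_subd_of_notMem hC]
    tauto
  · rw [mem_subd_of_notMem (by simp [hab, hC]), insert_mem_subd hbC hbB hb,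
      insert_mem_subd hbC hbB hb', mem_subd_of_notMem (by simp [hC, haB]),
      Finset.subset_insert_iff_of_notMem hbA]
    have := key1 C
    have : A ⊆ C → A ⊆ C ∪ B := fun h => h.trans Finset.subset_union_left
    tauto
  · rw [insert_mem_subd hC haA ha', mem_subd_of_notMem (by simp [hbC, hbA]),
      mem_subd_of_notMem (by simp [hbC, hab.symm]), insert_mem_subd hC haA ha,
      Finset.subset_insert_iff_of_notMem haB]
    have := key2 C
    have : B ⊆ C → B ⊆ C ∪ A := fun h => h.trans Finset.subset_union_left
    tauto
  · rw [insert_mem_subd (by simp [hC, hab]) haA ha', Finset.insert_union,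
      insert_mem_subd (by simp [hbC, hbA]) hbB hb, Finset.insert_comm,
      insert_mem_subd (by simp [hbC, hab.symm]) hbB hb', Finset.insert_union,
      insert_mem_subd (by simp [hC, haB]) haA ha, Finset.subset_insert_iff_of_notMem hbA,
      Finset.subset_insert_iff_of_notMem haB, Finset.union_right_comm C B A]
    have h1 : C ∪ A ∪ B ∈ K → A ⊆ C ∪ B → A ⊆ C := fun h => key1 C (hK.down h (by grind))
    have h2 : C ∪ A ∪ B ∈ K → B ⊆ C ∪ A → B ⊆ C := fun h => key2 C (hK.down h (by grind))
    constructor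
    · rintro ⟨hA, hB, h⟩
      exact ⟨fun hB' => hB (hB'.trans Finset.subset_union_left), fun hA' => hA (h1 h hA'), h⟩
    · rintro ⟨hB, hA, h⟩
      exact ⟨fun hA' => hA (hA'.trans Finset.subset_union_left), fun hB' => hB (h2 h hB'), h⟩

/-- Subdividing a simplex containing `A` before `A` itself amounts to subdividing a simplex
through the new vertex `a` afterwards. -/
theorem subd_subd_of_ssubset {A B : Finset V} {a b : V} {K : Set (Finset V)} (hK : IsComplex K)
    (hB : B ∈ K) (hAB : A ⊂ B)
    (hab : a ≠ b) (ha : a ∉ vertices K) (hb : b ∉ vertices K) :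
    subd A a (subd B b K) = subd (insert a (B \ A)) b (subd A a K) := by
  have hA := hK.down hB hAB.1
  have haA := notMem_of_notMem_vertices ha hA
  have haB := notMem_of_notMem_vertices ha hB
  have hbA := notMem_of_notMem_vertices hb hA
  have hbB := notMem_of_notMem_vertices hb hB
  have ha' : a ∉ vertices (subd B b K) := notMem_vertices_subd hab ha
  have hb' : b ∉ vertices (subd A a K) := notMem_vertices_subd hab.symm hb
  have hbR : b ∉ insert a (B \ A) := by simp [hab.symm, hbB]
  have hsub := hAB.1
  have sub1 : ∀ C : Finset V, a ∉ C → ¬insert a (B \ A) ⊆ C := fun C hC h => hC (h (by simp))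
  have sub2 : ∀ C : Finset V, a ∉ C → (insert a (B \ A) ⊆ insert a C ↔ B \ A ⊆ C) :=
    fun C hC => Finset.insert_subset_insert_iff (by simp [haB])
  refine ext_insert₂ (a := a) (b := b) (fun C hC hbC => ?_) (fun C hC hbC => ?_) (fun C hC hbC => ?_)
    (fun C hC hbC => ?_)
  · rw [mem_subd_of_notMem hC, mem_subd_of_notMem hbC, mem_subd_of_notMem hbC,
      mem_subd_of_notMem hC]
    have := sub1 C hC
    have : B ⊆ C → A ⊆ C := fun h => hsub.trans h
    tauto
  · rw [mem_subd_of_notMem (by simp [hab, hC]), insert_mem_subd hbC hbB hb,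
      insert_mem_subd hbC hbR hb', Finset.union_insert,
      insert_mem_subd (by simp [hC, haB]) haA ha,
      Finset.subset_insert_iff_of_notMem hbA]
    have := sub1 C hC
    have h1 : C ∪ B \ A ∪ A = C ∪ B := by grind
    have h2 : A ⊆ C ∪ B \ A ↔ A ⊆ C := by grind
    have : B ⊆ C → A ⊆ C := fun h => hsub.trans h
    rw [h1, h2]
    tauto
  · rw [insert_mem_subd hC haA ha', mem_subd_of_notMem (by simp [hbC, hbA]),
      mem_subd_of_notMem (by simp [hbC, hab.symm]), insert_mem_subd hC haA ha, sub2 C hC]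
    have : B ⊆ C ∪ A ↔ B \ A ⊆ C := by grind
    rw [this]
    tauto
  · rw [insert_mem_subd (by simp [hC, hab]) haA ha', Finset.insert_union,
      insert_mem_subd (by simp [hbC, hbA]) hbB hb, Finset.insert_comm,
      insert_mem_subd (by simp [hbC, hab.symm]) hbR hb',
      show insert a C ∪ insert a (B \ A) = insert a (C ∪ B \ A) by grind,
      insert_mem_subd (by simp [hC, haB]) haA ha, Finset.subset_insert_iff_of_notMem hbA,
      sub2 C hC]
    have h1 : C ∪ B \ A ∪ A = C ∪ A ∪ B := by grind
    have h2 : A ⊆ C ∪ B \ A ↔ A ⊆ C := by grind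
    have h3 : B ⊆ C ∪ A ↔ B \ A ⊆ C := by grind
    rw [h1, h2, h3]
    tauto

theorem ext_insert₃ {S T : Set (Finset V)} {a b c : V}
    (h0 : ∀ C, a ∉ C → b ∉ C → c ∉ C → (C ∈ S ↔ C ∈ T))
    (hb : ∀ C, a ∉ C → b ∉ C → c ∉ C → (insert b C ∈ S ↔ insert b C ∈ T))
    (ha : ∀ C, a ∉ C → b ∉ C → c ∉ C → (insert a C ∈ S ↔ insert a C ∈ T))
    (h2 : ∀ C, a ∉ C → b ∉ C → c ∉ C →
      (insert a (insert b C) ∈ S ↔ insert a (insert b C) ∈ T))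
    (h0' : ∀ C, a ∉ C → b ∉ C → c ∉ C → (insert c C ∈ S ↔ insert c C ∈ T))
    (hb' : ∀ C, a ∉ C → b ∉ C → c ∉ C →
      (insert c (insert b C) ∈ S ↔ insert c (insert b C) ∈ T))
    (ha' : ∀ C, a ∉ C → b ∉ C → c ∉ C →
      (insert c (insert a C) ∈ S ↔ insert c (insert a C) ∈ T))
    (h2' : ∀ C, a ∉ C → b ∉ C → c ∉ C → (insert c (insert a (insert b C)) ∈ S ↔
      insert c (insert a (insert b C)) ∈ T)) :
    S = T := by
  refine ext_insert₂ (a := a) (b := b) (fun C hC hbC => ?_) (fun C hC hbC => ?_) (fun C hC hbC => ?_)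
    (fun C hC hbC => ?_)
  all_goals
    by_cases hcC : c ∈ C
    · obtain ⟨D, hcD, rfl⟩ : ∃ D, c ∉ D ∧ C = insert c D :=
        ⟨C.erase c, by simp, (Finset.insert_erase hcC).symm⟩
      simp only [Finset.mem_insert, not_or] at hC hbC
      first
      | exact h0' D hC.2 hbC.2 hcD
      | (rw [Finset.insert_comm b c]; exact hb' D hC.2 hbC.2 hcD)
      | (rw [Finset.insert_comm a c]; exact ha' D hC.2 hbC.2 hcD)
      | (rw [Finset.insert_comm b c, Finset.insert_comm a c]; exact h2' D hC.2 hbC.2 hcD)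
    · first
      | exact h0 C hC hbC hcC
      | exact hb C hC hbC hcC
      | exact ha C hC hbC hcC
      | exact h2 C hC hbC hcC

section TwoSubdivisions

variable {A B C : Finset V} {a b : V} {K : Set (Finset V)}

theorem mem_subd_subd (haC : a ∉ C) (hbC : b ∉ C) :
    C ∈ subd B b (subd A a K) ↔ ¬B ⊆ C ∧ ¬A ⊆ C ∧ C ∈ K := by
  rw [mem_subd_of_notMem hbC, mem_subd_of_notMem haC]

theorem insert_left_mem_subd_subd (hab : a ≠ b) (haA : a ∉ A) (haB : a ∉ B)
    (ha : a ∉ vertices K) (haC : a ∉ C) (hbC : b ∉ C) :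
    insert a C ∈ subd B b (subd A a K) ↔ ¬B ⊆ C ∧ ¬A ⊆ C ∧ C ∪ A ∈ K := by
  rw [mem_subd_of_notMem (by simp [hab.symm, hbC]), insert_mem_subd haC haA ha,
    Finset.subset_insert_iff_of_notMem haB]

theorem insert_right_mem_subd_subd (hab : a ≠ b) (haB : a ∉ B) (hbB : b ∉ B)
    (hb : b ∉ vertices K) (haC : a ∉ C) (hbC : b ∉ C) :
    insert b C ∈ subd B b (subd A a K) ↔ ¬B ⊆ C ∧ ¬A ⊆ C ∪ B ∧ C ∪ B ∈ K := by
  rw [insert_mem_subd hbC hbB (notMem_vertices_subd hab.symm hb),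
    mem_subd_of_notMem (by simp [haC, haB])]

theorem insert_insert_mem_subd_subd (hab : a ≠ b) (haA : a ∉ A) (haB : a ∉ B) (hbB : b ∉ B)
    (ha : a ∉ vertices K) (hb : b ∉ vertices K) (haC : a ∉ C) (hbC : b ∉ C) :
    insert a (insert b C) ∈ subd B b (subd A a K) ↔
      ¬B ⊆ C ∧ ¬A ⊆ C ∪ B ∧ C ∪ B ∪ A ∈ K := by
  rw [Finset.insert_comm, insert_mem_subd (by simp [hab.symm, hbC]) hbB
    (notMem_vertices_subd hab.symm hb), Finset.insert_union,
    insert_mem_subd (by simp [haC, haB]) haA ha,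
    Finset.subset_insert_iff_of_notMem haB]

end TwoSubdivisions

theorem notMem_vertices_subd_subd {A B : Finset V} {a b c : V} {K : Set (Finset V)}
    (hac : a ≠ c) (hbc : b ≠ c) (hc : c ∉ vertices K) : c ∉ vertices (subd B b (subd A a K)) :=
  notMem_vertices_subd hbc.symm (notMem_vertices_subd hac.symm hc)

theorem subset_union_iff_sdiff_subset {A B C : Finset V} : A ⊆ C ∪ B ↔ A \ B ⊆ C := by
  grind

theorem subset_union_sdiff_iff {A B C : Finset V} : B ⊆ C ∪ B \ A ↔ A ∩ B ⊆ C := by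
  grind

theorem subset_union_sdiff_iff' {A B C : Finset V} : A ⊆ C ∪ B \ A ↔ A ⊆ C := by
  grind

/-- Subdividing two overlapping simplexes `A`, `B` in either order gives complexes with a common
further subdivision. -/
theorem subd_subd_subd_comm {A B : Finset V} {a b c : V} {K : Set (Finset V)}
    (hab : a ≠ b) (hac : a ≠ c) (hbc : b ≠ c) (haA : a ∉ A)
    (haB : a ∉ B) (hbA : b ∉ A) (hbB : b ∉ B) (hcA : c ∉ A) (hcB : c ∉ B)
    (ha : a ∉ vertices K) (hb : b ∉ vertices K) (hc : c ∉ vertices K) :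
    subd (insert a (B \ A)) c (subd B b (subd A a K)) =
      subd (insert b (A \ B)) c (subd A a (subd B b K)) := by
  have cT := notMem_vertices_subd_subd (A := A) (B := B) hac hbc hc
  have cT' := notMem_vertices_subd_subd (A := B) (B := A) hbc hac hc
  have cR : c ∉ insert a (B \ A) := by simp [hac.symm, hcB]
  have cQ : c ∉ insert b (A \ B) := by simp [hbc.symm, hcA]
  have na : ∀ {C : Finset V}, a ∉ C → ¬insert a (B \ A) ⊆ C := fun hC h => hC (h (by simp))
  have nb : ∀ {C : Finset V}, b ∉ C → ¬insert b (A \ B) ⊆ C := fun hC h => hC (h (by simp))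
  have sa : ∀ {C : Finset V}, a ∉ C → (insert a (B \ A) ⊆ insert a C ↔ B \ A ⊆ C) :=
    fun hC => Finset.insert_subset_insert_iff (by simp [haB])
  have sb : ∀ {C : Finset V}, b ∉ C → (insert b (A \ B) ⊆ insert b C ↔ A \ B ⊆ C) :=
    fun hC => Finset.insert_subset_insert_iff (by simp [hbA])
  have ba : ∀ {C : Finset V}, (insert a (B \ A) ⊆ insert b C ↔ insert a (B \ A) ⊆ C) :=
    Finset.subset_insert_iff_of_notMem (by simp [hab.symm, hbB])
  have ab : ∀ {C : Finset V}, (insert b (A \ B) ⊆ insert a C ↔ insert b (A \ B) ⊆ C) :=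
    Finset.subset_insert_iff_of_notMem (by simp [hab, haA])
  refine ext_insert₃ (a := a) (b := b) (c := c) (fun C haC hbC hcC => ?_) (fun C haC hbC hcC => ?_)
    (fun C haC hbC hcC => ?_) (fun C haC hbC hcC => ?_) (fun C haC hbC hcC => ?_)
    (fun C haC hbC hcC => ?_) (fun C haC hbC hcC => ?_) (fun C haC hbC hcC => ?_)
  -- All inclusions are reduced to inclusions in `C` of `A`, `B`, `A \ B`, `B \ A` or `A ∩ B`, and
  -- the larger unions to `C ∪ A ∪ B`. Each of the eight cases is then propositional.
  all_goals
    have haCR : a ∉ C ∪ B \ A := by simp [haC, haB]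
    have hbCR : b ∉ C ∪ B \ A := by simp [hbC, hbB]
    have haCQ : a ∉ C ∪ A \ B := by simp [haC, haA]
    have hbCQ : b ∉ C ∪ A \ B := by simp [hbC, hbA]
    have eB1 : A ⊆ C ∪ B ↔ A \ B ⊆ C := subset_union_iff_sdiff_subset
    have eB2 : B ⊆ C ∪ A ↔ B \ A ⊆ C := subset_union_iff_sdiff_subset
    have e1 : B ⊆ C ∪ B \ A ↔ A ∩ B ⊆ C := subset_union_sdiff_iff
    have e2 : A ⊆ C ∪ B \ A ↔ A ⊆ C := subset_union_sdiff_iff'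
    have e3 : A ⊆ C ∪ A \ B ↔ A ∩ B ⊆ C := by
      rw [Finset.inter_comm]; exact subset_union_sdiff_iff
    have e4 : B ⊆ C ∪ A \ B ↔ B ⊆ C := subset_union_sdiff_iff'
    have e0 : C ∪ B \ A ∪ B = C ∪ B := by
      rw [Finset.union_assoc, Finset.union_eq_right.2 Finset.sdiff_subset]
    have e0' : C ∪ A \ B ∪ A = C ∪ A := by
      rw [Finset.union_assoc, Finset.union_eq_right.2 Finset.sdiff_subset]
    have e5 : A ⊆ C ∪ B \ A ∪ B ↔ A \ B ⊆ C := by rw [e0, eB1]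
    have e6 : B ⊆ C ∪ A \ B ∪ A ↔ B \ A ⊆ C := by rw [e0', eB2]
    have u5 : C ∪ B ∪ A = C ∪ A ∪ B := Finset.union_right_comm _ _ _
    have u1 : C ∪ B \ A ∪ A = C ∪ A ∪ B := by
      rw [Finset.union_assoc, Finset.sdiff_union_self_eq_union, ← Finset.union_assoc, u5]
    have u2 : C ∪ A \ B ∪ B = C ∪ A ∪ B := by
      rw [Finset.union_assoc, Finset.sdiff_union_self_eq_union, ← Finset.union_assoc]
    have u3 : C ∪ B \ A ∪ B ∪ A = C ∪ A ∪ B := by rw [e0, u5]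
    have u4 : C ∪ A \ B ∪ A ∪ B = C ∪ A ∪ B := by rw [e0']
    have f1 : A ⊆ C → A \ B ⊆ C := Finset.sdiff_subset.trans
    have f2 : B ⊆ C → B \ A ⊆ C := Finset.sdiff_subset.trans
    have f3 : A ⊆ C → A ∩ B ⊆ C := Finset.inter_subset_left.trans
    have f4 : B ⊆ C → A ∩ B ⊆ C := Finset.inter_subset_right.trans
  · rw [mem_subd_of_notMem hcC, mem_subd_of_notMem hcC, mem_subd_subd haC hbC,
      mem_subd_subd hbC haC]
    exact ⟨fun ⟨_, h1, h2, h⟩ => ⟨nb hbC, h2, h1, h⟩, fun ⟨_, h1, h2, h⟩ => ⟨na haC, h2, h1, h⟩⟩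
  · rw [mem_subd_of_notMem (a := c) (by simp [hcC, hbc.symm]), mem_subd_of_notMem (a := c) (by simp [hcC, hbc.symm]),
      insert_right_mem_subd_subd hab haB hbB hb haC hbC,
      insert_left_mem_subd_subd hab.symm hbB hbA hb hbC haC, ba, sb hbC, eB1]
    exact ⟨fun ⟨_, h1, h2, h⟩ => ⟨h2, mt f1 h2, h1, h⟩, fun ⟨h1, _, h2, h⟩ => ⟨na haC, h2, h1, h⟩⟩
  · rw [mem_subd_of_notMem (a := c) (by simp [hcC, hac.symm]), mem_subd_of_notMem (a := c) (by simp [hcC, hac.symm]),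
      insert_left_mem_subd_subd hab haA haB ha haC hbC,
      insert_right_mem_subd_subd hab.symm hbA haA ha hbC haC, ab, sa haC, eB2]
    exact ⟨fun ⟨h1, _, h2, h⟩ => ⟨nb hbC, h2, h1, h⟩, fun ⟨_, h1, h2, h⟩ => ⟨h2, mt f2 h2, h1, h⟩⟩
  · rw [mem_subd_of_notMem (a := c) (by simp [hcC, hac.symm, hbc.symm]),
      mem_subd_of_notMem (a := c) (by simp [hcC, hac.symm, hbc.symm]),
      insert_insert_mem_subd_subd hab haA haB hbB ha hb haC hbC, Finset.insert_comm,
      insert_insert_mem_subd_subd hab.symm hbB hbA haA hb ha hbC haC, ba, Finset.insert_comm, ab,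
      sa haC, sb hbC, eB1, eB2, u5]
    exact ⟨fun ⟨h1, _, h2, h⟩ => ⟨h2, mt f1 h2, h1, h⟩, fun ⟨h1, _, h2, h⟩ => ⟨h2, mt f2 h2, h1, h⟩⟩
  · rw [insert_mem_subd hcC cR cT, insert_mem_subd hcC cQ cT', Finset.union_insert,
      Finset.union_insert, insert_left_mem_subd_subd hab haA haB ha haCR hbCR,
      insert_left_mem_subd_subd hab.symm hbB hbA hb hbCQ haCQ, e1, e2, e3, e4, u1, u2]
    exact ⟨fun ⟨_, h1, _, h⟩ => ⟨nb hbC, h1, mt f4 h1, h⟩, fun ⟨_, h1, _, h⟩ => ⟨na haC, h1, mt f3 h1, h⟩⟩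
  · rw [insert_mem_subd (by simp [hcC, hbc.symm]) cR cT,
      insert_mem_subd (by simp [hcC, hbc.symm]) cQ cT', Finset.union_insert,
      Finset.insert_union, Finset.insert_union, Finset.union_insert, Finset.insert_idem,
      insert_insert_mem_subd_subd hab haA haB hbB ha hb haCR hbCR,
      insert_left_mem_subd_subd hab.symm hbB hbA hb hbCQ haCQ, e1, e3, e4, e5, u3, u2, ba, sb hbC]
    exact ⟨fun ⟨_, h1, h2, h⟩ => ⟨h2, h1, mt f4 h1, h⟩, fun ⟨h2, h1, _, h⟩ => ⟨na haC, h1, h2, h⟩⟩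
  · rw [insert_mem_subd (by simp [hcC, hac.symm]) cR cT,
      insert_mem_subd (by simp [hcC, hac.symm]) cQ cT', Finset.union_insert,
      Finset.insert_union, Finset.insert_union, Finset.union_insert, Finset.insert_idem,
      Finset.insert_comm a b, insert_insert_mem_subd_subd hab.symm hbB hbA haA hb ha hbCQ haCQ,
      insert_left_mem_subd_subd hab haA haB ha haCR hbCR, e1, e2, e3, e6, u1, u4, ab, sa haC]
    exact ⟨fun ⟨h1, h2, _, h⟩ => ⟨nb hbC, h2, h1, h⟩, fun ⟨_, h1, h2, h⟩ => ⟨h2, h1, mt f3 h1, h⟩⟩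
  · have hcab : c ∉ insert a (insert b C) := by simp [hcC, hac.symm, hbc.symm]
    have g1 : insert a (B \ A) ⊆ insert a (insert b C) ↔ B \ A ⊆ C := by
      rw [Finset.insert_comm, ba, sa haC]
    have g2 : insert b (A \ B) ⊆ insert a (insert b C) ↔ A \ B ⊆ C := by rw [ab, sb hbC]
    have g3 : insert a (insert b C) ∪ insert a (B \ A) = insert a (insert b (C ∪ B \ A)) := by
      rw [Finset.union_insert, Finset.insert_union, Finset.insert_union, Finset.insert_idem]
    have g4 : insert a (insert b C) ∪ insert b (A \ B) = insert b (insert a (C ∪ A \ B)) := by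
      rw [Finset.insert_comm, Finset.union_insert, Finset.insert_union, Finset.insert_union,
        Finset.insert_idem]
    have l := insert_insert_mem_subd_subd hab haA haB hbB ha hb haCR hbCR
    have r := insert_insert_mem_subd_subd hab.symm hbB hbA haA hb ha hbCQ haCQ
    rw [e1, e5, u3] at l
    rw [e3, e6, u4] at r
    rw [insert_mem_subd hcab cR cT, insert_mem_subd hcab cQ cT', g1, g2, g3, g4, l, r]
    exact ⟨fun ⟨h1, h2, h3, h⟩ => ⟨h3, h2, h1, h⟩, fun ⟨h1, h2, h3, h⟩ => ⟨h3, h2, h1, h⟩⟩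

/-! ### Equivalence by moves relative to a subcomplex -/

/-- A stellar subdivision or weld at a simplex outside `F` whose extra vertex lies in `N`. -/
def Move (F : Set (Finset V)) (N : Set V) (K L : Set (Finset V)) : Prop :=
  ∃ A a, A ∉ F ∧ a ∈ N ∧ (IsSubdivision A a K L ∨ IsSubdivision A a L K)

/-- The equivalence relation generated by the moves `Move F N`. -/
def Eqv (F : Set (Finset V)) (N : Set V) : Set (Finset V) → Set (Finset V) → Prop :=
  Relation.ReflTransGen (Move F N)

section Eqv

variable {F : Set (Finset V)} {N : Set V} {K L J : Set (Finset V)}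

theorem Move.symm (h : Move F N K L) : Move F N L K := by
  obtain ⟨A, a, h1, h2, h3⟩ := h
  exact ⟨A, a, h1, h2, h3.symm⟩

theorem Move.isComplex_right (h : Move F N K L) : IsComplex L := by
  obtain ⟨A, a, -, -, h3 | h3⟩ := h
  exacts [h3.right, h3.left]

theorem Move.isComplex_left (h : Move F N K L) : IsComplex K := h.symm.isComplex_right

theorem Eqv.refl (K : Set (Finset V)) : Eqv F N K K := Relation.ReflTransGen.refl

theorem Eqv.symm (h : Eqv F N K L) : Eqv F N L K := by
  induction h with
  | refl => exact Eqv.refl _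
  | tail _ h ih => exact Relation.ReflTransGen.head h.symm ih

theorem Eqv.trans (h : Eqv F N K L) (h' : Eqv F N L J) : Eqv F N K J :=
  Relation.ReflTransGen.trans h h'

theorem Eqv.isComplex (h : Eqv F N K L) (hK : IsComplex K) : IsComplex L := by
  induction h with
  | refl => exact hK
  | tail _ h ih => exact h.isComplex_right

theorem Move.mono {F' : Set (Finset V)} {N' : Set V} (hF : F' ⊆ F) (hN : N ⊆ N')
    (h : Move F N K L) : Move F' N' K L := by
  obtain ⟨A, a, h1, h2, h3⟩ := h
  exact ⟨A, a, fun h => h1 (hF h), hN h2, h3⟩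

theorem Eqv.mono {F' : Set (Finset V)} {N' : Set V} (hF : F' ⊆ F) (hN : N ⊆ N')
    (h : Eqv F N K L) : Eqv F' N' K L :=
  Relation.ReflTransGen.mono (fun _ _ => Move.mono hF hN) _ _ h

theorem IsSubdivision.eqv {A : Finset V} {a : V} (h : IsSubdivision A a K L) (hA : A ∉ F)
    (ha : a ∈ N) : Eqv F N K L :=
  Relation.ReflTransGen.single ⟨A, a, hA, ha, Or.inl h⟩

theorem IsComplex.eqv_subd {A : Finset V} {a : V} (hK : IsComplex K) (hA : A ∈ K)
    (hne : A.Nonempty) (ha : a ∉ vertices K) (hAF : A ∉ F) (haN : a ∈ N) :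
    Eqv F N K (subd A a K) :=
  (hK.subdivision hA hne ha).eqv hAF haN

theorem Eqv.exists_finite (h : Eqv F N K L) : ∃ N', N'.Finite ∧ N' ⊆ N ∧ Eqv F N' K L := by
  induction h with
  | refl => exact ⟨∅, Set.finite_empty, Set.empty_subset _, Eqv.refl _⟩
  | tail _ h ih =>
    obtain ⟨N', h1, h2, h3⟩ := ih
    obtain ⟨A, a, hA, ha, h⟩ := h
    exact ⟨insert a N', h1.insert a, Set.insert_subset ha h2,
      (h3.mono subset_rfl (Set.subset_insert _ _)).trans
        (Relation.ReflTransGen.single ⟨A, a, hA, Set.mem_insert _ _, h⟩)⟩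

end Eqv

/-! ### Permutations of the vertices, and renaming by moves -/

/-- The image of a collection of simplexes under a permutation of the vertices. -/
def pmap (π : Equiv.Perm V) (K : Set (Finset V)) : Set (Finset V) :=
  {C | C.map π.symm.toEmbedding ∈ K}

section Perm

variable {F K L : Set (Finset V)} {N : Set V} {π σ : Equiv.Perm V} {A B C : Finset V} {a v : V}

theorem map_symm_map : (C.map π.toEmbedding).map π.symm.toEmbedding = C := by
  ext x; simp

theorem map_map_symm : (C.map π.symm.toEmbedding).map π.toEmbedding = C := by
  ext x; simp

theorem mem_pmap : C ∈ pmap π K ↔ C.map π.symm.toEmbedding ∈ K := Iff.rfl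

theorem map_mem_pmap : C.map π.toEmbedding ∈ pmap π K ↔ C ∈ K := by
  rw [mem_pmap, map_symm_map]

theorem pmap_eq_image : pmap π K = (fun C => C.map π.toEmbedding) '' K := by
  ext C
  constructor
  · intro h
    exact ⟨_, h, map_map_symm⟩
  · rintro ⟨D, hD, rfl⟩
    exact map_mem_pmap.2 hD

theorem map_eq_self_of_forall (h : ∀ x ∈ C, π x = x) : C.map π.toEmbedding = C := by
  ext x
  simp only [Finset.mem_map, Equiv.coe_toEmbedding]
  constructor
  · rintro ⟨y, hy, rfl⟩
    rwa [h y hy]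
  · intro hx
    exact ⟨x, hx, h x hx⟩

theorem pmap_eq_self (h : ∀ x ∈ vertices K, π x = x) : pmap π K = K := by
  rw [pmap_eq_image]
  ext C
  constructor
  · rintro ⟨D, hD, rfl⟩
    change D.map _ ∈ K
    rwa [map_eq_self_of_forall fun x hx => h x ⟨D, hD, hx⟩]
  · intro hC
    exact ⟨C, hC, map_eq_self_of_forall fun x hx => h x ⟨C, hC, hx⟩⟩

theorem vertices_pmap : vertices (pmap π K) = π '' vertices K := by
  rw [pmap_eq_image]
  ext x
  constructor
  · rintro ⟨_, ⟨D, hD, rfl⟩, hx⟩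
    simp only [Finset.mem_map, Equiv.coe_toEmbedding] at hx
    obtain ⟨y, hy, rfl⟩ := hx
    exact ⟨y, ⟨D, hD, hy⟩, rfl⟩
  · rintro ⟨y, ⟨D, hD, hy⟩, rfl⟩
    exact ⟨_, ⟨D, hD, rfl⟩, by simpa using hy⟩

theorem pmap_pmap : pmap σ (pmap π K) = pmap (σ * π) K := by
  ext C
  simp only [mem_pmap, Finset.map_map]
  rfl

theorem isComplex_pmap (hK : IsComplex K) : IsComplex (pmap π K) where
  finite := by
    rw [pmap_eq_image]
    exact hK.finite.image _
  empty_mem := by simpa [mem_pmap] using hK.empty_mem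
  mem_of_subset B C hC h := hK.down hC (Finset.map_subset_map.2 h)

theorem pmap_subd : pmap π (subd A a K) = subd (A.map π.toEmbedding) (π a) (pmap π K) := by
  ext C
  have h1 : A ⊆ C.map π.symm.toEmbedding ↔ A.map π.toEmbedding ⊆ C := by
    rw [← Finset.map_subset_map (f := π.toEmbedding), map_map_symm]
  have h2 : a ∈ C.map π.symm.toEmbedding ↔ π a ∈ C := by
    simp only [Finset.mem_map_equiv, Equiv.symm_symm]
  have h3 : ((C.erase (π a)) ∪ A.map π.toEmbedding).map π.symm.toEmbedding =
      (C.map π.symm.toEmbedding).erase a ∪ A := by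
    ext x
    simp only [Finset.mem_map_equiv, Equiv.symm_symm, Finset.mem_union, Finset.mem_erase, ne_eq,
      EmbeddingLike.apply_eq_iff_eq, Equiv.symm_apply_apply]
  simp only [mem_pmap, subd, Set.mem_ofPred_eq, h1, h2, h3]

theorem IsSubdivision.map_perm (h : IsSubdivision A a K L) :
    IsSubdivision (A.map π.toEmbedding) (π a) (pmap π K) (pmap π L) := by
  obtain ⟨h1, h2, h3, h4, rfl⟩ := isSubdivision_iff.1 h
  rw [isSubdivision_iff]
  refine ⟨isComplex_pmap h1, map_mem_pmap.2 h2, by simpa using h3, ?_, pmap_subd⟩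
  rw [vertices_pmap]
  rintro ⟨y, hy, h⟩
  exact h4 (π.injective h ▸ hy)

theorem Eqv.map_perm (h : Eqv F N K L) (π : Equiv.Perm V) :
    Eqv (pmap π F) (π '' N) (pmap π K) (pmap π L) := by
  refine Relation.ReflTransGen.lift (pmap π) ?_ _ _ h
  rintro X Y ⟨A, a, hA, ha, h⟩
  exact ⟨_, _, by rwa [map_mem_pmap], Set.mem_image_of_mem _ ha,
    h.imp IsSubdivision.map_perm IsSubdivision.map_perm⟩

theorem pmap_cone (hK : IsComplex K) : pmap π (cone v K) = cone (π v) (pmap π K) := by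
  ext C
  rw [mem_pmap, mem_cone hK, mem_cone (isComplex_pmap hK), mem_pmap]
  have : (C.erase (π v)).map π.symm.toEmbedding = (C.map π.symm.toEmbedding).erase v := by
    ext x
    simp only [Finset.mem_map_equiv, Equiv.symm_symm, Finset.mem_erase, ne_eq,
      EmbeddingLike.apply_eq_iff_eq]
  rw [this]

/-- Since `∂{x}` contains only the empty simplex, the star of `x` is replaced by the same star with
apex `a`. Subdividing at a vertex therefore renames it. -/
theorem subd_singleton {x a : V} (ha : a ∉ vertices K) (hxa : x ≠ a) :
    subd {x} a K = pmap (Equiv.swap x a) K := by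
  refine ext_insert a (fun C hC => ?_) (fun C hC => ?_)
  · rw [mem_subd_of_notMem hC, mem_pmap, Equiv.symm_swap, Finset.singleton_subset_iff]
    by_cases hx : x ∈ C
    · have : C.map (Equiv.swap x a).toEmbedding ∉ K :=
        notMem_of_mem_of_notMem_vertices ha (by simpa [Finset.mem_map_equiv] using hx)
      tauto
    · rw [map_eq_self_of_forall]
      · tauto
      · intro y hy
        exact Equiv.swap_apply_of_ne_of_ne (fun h => hx (h ▸ hy)) (fun h => hC (h ▸ hy))
  · rw [insert_mem_subd hC (by simpa using hxa.symm) ha, mem_pmap, Equiv.symm_swap,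
      Finset.singleton_subset_iff]
    by_cases hx : x ∈ C
    · have : (insert a C).map (Equiv.swap x a).toEmbedding ∉ K :=
        notMem_of_mem_of_notMem_vertices ha (by simp [Finset.mem_map_equiv, hx])
      tauto
    · rw [Finset.map_insert, map_eq_self_of_forall]
      · simp [hx]
      · intro y hy
        exact Equiv.swap_apply_of_ne_of_ne (fun h => hx (h ▸ hy)) (fun h => hC (h ▸ hy))

/-- A subdivision at a vertex in `M` with new vertex in `N`, which renames that vertex. -/
def RenameStep (M N : Set V) (K L : Set (Finset V)) : Prop :=
  ∃ x ∈ M, ∃ y ∈ N, IsSubdivision {x} y K L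

/-- Every moved vertex goes to a name unused in `K`, so the vertices can be renamed one at a time.
The induction is on the number of moved vertices. -/
theorem rename_chain {M : Set V} (hK : IsComplex K)
    (h : ∀ x ∈ vertices K, π x ≠ x → π x ∉ vertices K ∧ x ∈ M ∧ π x ∈ N) :
    Relation.ReflTransGen (RenameStep M N) K (pmap π K) := by
  obtain ⟨n, hn⟩ : ∃ n, {x ∈ vertices K | π x ≠ x}.ncard = n := ⟨_, rfl⟩
  induction n generalizing K π with
  | zero =>
    rw [Set.ncard_eq_zero ((finite_vertices hK).subset (Set.sep_subset _ _))] at hn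
    rw [pmap_eq_self]
    intro x hx
    by_contra hne
    exact (Set.eq_empty_iff_forall_notMem.1 hn) x ⟨hx, hne⟩
  | succ n ih =>
    have hfin := (finite_vertices hK).subset (Set.sep_subset _ (fun x => π x ≠ x))
    obtain ⟨x, hx, hne⟩ := (Set.ncard_pos hfin).1 (by omega)
    obtain ⟨h1, h2, h3⟩ := h x hx hne
    have hsub := hK.subdivision (hK.singleton_mem.2 hx) (by simp) h1
    have hswap := subd_singleton h1 hne.symm
    have hK' : IsComplex (pmap (Equiv.swap x (π x)) K) := isComplex_pmap hK
    have hv : vertices (pmap (Equiv.swap x (π x)) K) = insert (π x) (vertices K \ {x}) := by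
      rw [vertices_pmap]
      ext y
      constructor
      · rintro ⟨z, hz, rfl⟩
        by_cases hzx : z = x
        · subst hzx
          simp
        · have : z ≠ π x := fun h => h1 (h ▸ hz)
          rw [Equiv.swap_apply_of_ne_of_ne hzx this]
          exact Or.inr ⟨hz, hzx⟩
      · rintro (rfl | ⟨hy, hyx⟩)
        · exact ⟨x, hx, by simp⟩
        · have : y ≠ π x := fun h => h1 (h ▸ hy)
          exact ⟨y, hy, Equiv.swap_apply_of_ne_of_ne hyx this⟩
    -- The renaming still to be done once `x` has become `π x`: it fixes the new vertex and agrees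
    -- with `π` on the others.
    set τ : Equiv.Perm V := π * Equiv.swap x (π x) with hτ
    have hτ1 : τ (π x) = π x := by simp [hτ]
    have hτ2 : ∀ y ∈ vertices K \ {x}, τ y = π y := by
      intro y hy
      have : y ≠ π x := fun h => h1 (h ▸ hy.1)
      simp [hτ, Equiv.swap_apply_of_ne_of_ne hy.2 this]
    have hmoved : {y ∈ vertices (pmap (Equiv.swap x (π x)) K) | τ y ≠ y} =
        {y ∈ vertices K | π y ≠ y} \ {x} := by
      rw [hv]
      ext y
      constructor
      · rintro ⟨rfl | hy, hne'⟩
        · exact absurd hτ1 hne'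
        · exact ⟨⟨hy.1, by rwa [hτ2 y hy] at hne'⟩, hy.2⟩
      · rintro ⟨⟨hy, hne'⟩, hyx⟩
        exact ⟨Or.inr ⟨hy, hyx⟩, by rwa [hτ2 y ⟨hy, hyx⟩]⟩
    have key := ih (π := τ) hK' (by
      rw [hv]
      rintro y (rfl | hy) hne'
      · exact absurd hτ1 hne'
      · rw [hτ2 y hy] at hne' ⊢
        obtain ⟨g1, g2, g3⟩ := h y hy.1 hne'
        refine ⟨?_, g2, g3⟩
        rintro (hh | hh)
        · exact hy.2 (π.injective hh)
        · exact g1 hh.1) (by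
      rw [hmoved, Set.ncard_sdiff_singleton_of_mem (show x ∈ {y ∈ vertices K | π y ≠ y} from ⟨hx, hne⟩)]
      omega)
    rw [pmap_pmap, hτ, mul_assoc, Equiv.swap_mul_self, mul_one] at key
    refine Relation.ReflTransGen.head ⟨x, h2, π x, h3, ?_⟩ key
    rw [← hswap]
    exact hsub

theorem RenameStep.move {M : Set V} (h : RenameStep M N K L) (hF : ∀ x ∈ M, {x} ∉ F) :
    Move F N K L := by
  obtain ⟨x, hx, y, hy, h⟩ := h
  exact ⟨{x}, y, hF x hx, hy, Or.inl h⟩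

theorem exists_perm_avoid [Infinite V] (D : Set V) {U : Set V} (T : Finset V) (hD : D.Finite)
    (hU : U.Finite) : ∃ π : Equiv.Perm V, (∀ x ∈ D, π x = x) ∧ ∀ x ∈ T, x ∉ D → π x ∉ U := by
  induction T using Finset.induction_on with
  | empty => exact ⟨1, by simp, by simp⟩
  | insert x T hx ih =>
    obtain ⟨π, h1, h2⟩ := ih
    by_cases hgood : x ∈ D ∨ π x ∉ U
    · refine ⟨π, h1, fun y hy hyD => ?_⟩
      rcases Finset.mem_insert.1 hy with rfl | hy
      · exact hgood.resolve_left hyD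
      · exact h2 y hy hyD
    · push Not at hgood
      -- Avoiding the images of `T` ensures that the correcting transposition leaves the earlier
      -- choices intact.
      obtain ⟨y, hy⟩ := ((hD.union hU).union (T.finite_toSet.image π)).exists_notMem
      simp only [Set.mem_union, not_or] at hy
      obtain ⟨⟨hyD, hyU⟩, hyT⟩ := hy
      refine ⟨Equiv.swap (π x) y * π, fun d hd => ?_, fun t ht htD => ?_⟩
      · rw [Equiv.Perm.mul_apply, h1 d hd, Equiv.swap_apply_of_ne_of_ne]
        · intro h
          have : x = d := π.injective (by rw [h1 d hd, h])
          exact hgood.1 (this ▸ hd)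
        · rintro rfl
          exact hyD hd
      · rcases Finset.mem_insert.1 ht with rfl | ht
        · simpa using hyU
        · rw [Equiv.Perm.mul_apply, Equiv.swap_apply_of_ne_of_ne]
          · exact h2 t ht htD
          · exact fun h => h2 t ht htD (h ▸ hgood.2)
          · exact fun h => hyT ⟨t, ht, h⟩

/-- A permutation may send vertices of `K` onto other vertices of `K`, where direct renaming is
impossible. Instead `K` and its image are both renamed to a common copy, which uses fresh names for
all vertices that `π` moves. -/
theorem eqv_pmap [Infinite V] (hK : IsComplex K) (π : Equiv.Perm V) :
    Eqv ∅ Set.univ K (pmap π K) := by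
  set D : Set V := {x ∈ vertices K | π x = x} with hD
  have hfin := finite_vertices hK
  have hfin' := finite_vertices (isComplex_pmap (π := π) hK)
  obtain ⟨σ, h1, h2⟩ := exists_perm_avoid D (U := vertices K ∪ vertices (pmap π K)) hfin.toFinset
    (hfin.subset (Set.sep_subset _ _)) (hfin.union hfin')
  have hmove : ∀ {X Y : Set (Finset V)}, RenameStep Set.univ Set.univ X Y →
      Move ∅ Set.univ X Y := fun h => h.move (by simp)
  have e1 : Eqv ∅ Set.univ K (pmap σ K) := by
    refine Relation.ReflTransGen.mono (fun _ _ => hmove) _ _ (rename_chain hK ?_)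
    intro x hx hne
    refine ⟨fun h => h2 x (by simpa using hx) (fun hxD => hne (h1 x hxD)) (Or.inl h), ?_⟩
    simp
  have e2 : Eqv ∅ Set.univ (pmap π K) (pmap (σ * π⁻¹) (pmap π K)) := by
    refine Relation.ReflTransGen.mono (fun _ _ => hmove) _ _ (rename_chain (isComplex_pmap hK) ?_)
    rw [vertices_pmap]
    rintro _ ⟨x, hx, rfl⟩ hne
    have hπ : (σ * π⁻¹) (π x) = σ x := by simp
    rw [hπ] at hne ⊢
    refine ⟨fun h => h2 x (by simpa using hx) (fun hxD => hne ?_) (Or.inr ?_), ?_⟩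
    · rw [h1 x hxD, hxD.2]
    · rw [vertices_pmap]
      exact h
    · simp
  rw [pmap_pmap, mul_assoc, inv_mul_cancel, mul_one] at e2
  exact e1.trans e2.symm

/-- Multiple transitivity of the symmetric group: an isomorphism matters only on finitely many
vertices, so it may be taken to be a permutation of `V`. -/
theorem exists_perm_eqOn {f : V → V} {S : Set V} (hS : S.Finite) (hf : Set.InjOn f S) :
    ∃ π : Equiv.Perm V, ∀ x ∈ S, π x = f x := by
  have := Equiv.Perm.isMultiplyPretransitive V hS.toFinset.card
  let e := hS.toFinset.equivFin.symm
  obtain ⟨π, hπ⟩ := MulAction.exists_smul_eq (Equiv.Perm V)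
    (⟨fun i => (e i : V), fun i j h => e.injective (Subtype.ext h)⟩ :
      Fin hS.toFinset.card ↪ V)
    ⟨fun i => f (e i), fun i j h => e.injective (Subtype.ext (hf (hS.mem_toFinset.1 (e i).2)
      (hS.mem_toFinset.1 (e j).2) h))⟩
  refine ⟨π, fun x hx => ?_⟩
  have := DFunLike.congr_fun hπ (e.symm ⟨x, by simpa using hx⟩)
  change π (e (e.symm _)) = f (e (e.symm _)) at this
  simpa using this

theorem IsSimplicialIso.exists_perm {f : V → V} (hK : IsComplex K)
    (h : IsSimplicialIso f K L) : ∃ π : Equiv.Perm V, L = pmap π K := by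
  obtain ⟨π, hπ⟩ := exists_perm_eqOn (finite_vertices hK) h.1.injOn
  refine ⟨π, ?_⟩
  rw [pmap_eq_image, ← h.2.image_eq]
  refine Set.image_congr fun C hC => ?_
  ext x
  simp only [Finset.mem_image, Finset.mem_map, Equiv.coe_toEmbedding]
  refine exists_congr fun y => and_congr_right fun hy => ?_
  rw [hπ y ⟨C, hC, hy⟩]

theorem StellarEquiv.eqv [Infinite V] (hK : IsComplex K) (h : StellarEquiv K L) :
    Eqv ∅ Set.univ K L := by
  induction h with
  | refl => exact Eqv.refl _
  | tail _ h ih =>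
    have hc := ih.isComplex hK
    refine ih.trans ?_
    cases h with
    | subdivision A a h => exact h.eqv (by simp) (by simp)
    | weld A a h => exact (h.eqv (by simp) (by simp)).symm
    | iso f h =>
      obtain ⟨π, rfl⟩ := h.exists_perm hc
      exact eqv_pmap hc π

theorem Eqv.stellarEquiv (h : Eqv F N K L) : StellarEquiv K L := by
  refine Relation.ReflTransGen.mono ?_ _ _ h
  rintro X Y ⟨A, a, -, -, h | h⟩
  exacts [.subdivision A a h, .weld A a h]

end Perm

/-- An equivalence with a cone over `F` can be rerouted, after renaming the vertices outside `F`,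
so that the vertices it introduces avoid a given finite set `W`. -/
theorem Eqv.exists_rename [Infinite V] {F K : Set (Finset V)} {v : V} {W : Set V}
    (hK : IsComplex K) (hF : IsComplex F) (h : Eqv F (vertices F)ᶜ K (cone v F))
    (hv : v ∉ vertices F) (hW : W.Finite) :
    ∃ π : Equiv.Perm V, ∃ w, w ∉ W ∧ Eqv F Wᶜ (pmap π K) (cone w F) ∧
      Relation.ReflTransGen (RenameStep (vertices F)ᶜ Wᶜ) K (pmap π K) := by
  obtain ⟨N, hN, hNF, h⟩ := h.exists_finite
  have hKf := finite_vertices hK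
  have hfin : (insert v (N ∪ vertices K)).Finite := (hN.union hKf).insert v
  obtain ⟨π, h1, h2⟩ := exists_perm_avoid (vertices F) (U := W ∪ vertices K) hfin.toFinset
    (finite_vertices hF) (hW.union hKf)
  simp only [Set.Finite.mem_toFinset] at h2
  refine ⟨π, π v, fun h => h2 v (by simp) hv (Or.inl h), ?_, ?_⟩
  · have h' := h.map_perm π
    rw [pmap_cone hF, pmap_eq_self h1] at h'
    refine h'.mono subset_rfl ?_
    rintro _ ⟨x, hx, rfl⟩ hxW
    exact h2 x (by simp [hx]) (hNF hx) (Or.inl hxW)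
  · refine rename_chain hK fun x hx hne => ?_
    have hxF : x ∉ vertices F := fun h => hne (h1 x h)
    have := h2 x (by simp [hx]) hxF
    exact ⟨fun h => this (Or.inr h), hxF, fun h => this (Or.inl h)⟩

/-! ### Commutation of subdivisions up to moves -/

section Commute

variable {G K : Set (Finset V)} {N : Set V} {A B : Finset V} {a b : V}

theorem eqv_subd_subd_of_ssubset (hK : IsComplex K) (hB : B ∈ K) (hAB : A ⊂ B)
    (hab : a ≠ b) (ha : a ∉ vertices K) (hb : b ∉ vertices K) (hG : insert a (B \ A) ∉ G)
    (hbN : b ∈ N) (hne : A.Nonempty) :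
    Eqv G N (subd A a K) (subd A a (subd B b K)) := by
  rw [subd_subd_of_ssubset hK hB hAB hab ha hb]
  have haB := notMem_of_notMem_vertices ha hB
  refine (isComplex_subd hK hne).eqv_subd ?_ (by simp) (notMem_vertices_subd hab.symm hb) hG hbN
  rw [insert_mem_subd (by simp [haB]) (fun h => haB (hAB.1 h)) ha,
    Finset.sdiff_union_of_subset hAB.1]
  refine ⟨fun h => ?_, hB⟩
  obtain ⟨x, hx⟩ := hne
  exact (Finset.mem_sdiff.1 (h hx)).2 hx

theorem isSubdivision_exchange {c : V} (hK : IsComplex K) (hAB : A ∪ B ∈ K)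
    (hdisj : ¬Disjoint A B) (hab : a ≠ b) (hac : a ≠ c) (hbc : b ≠ c) (ha : a ∉ vertices K)
    (hb : b ∉ vertices K) (hc : c ∉ vertices K) :
    IsSubdivision (insert a (B \ A)) c (subd B b (subd A a K))
      (subd (insert a (B \ A)) c (subd B b (subd A a K))) := by
  obtain ⟨x, hxA, hxB⟩ := Finset.not_disjoint_iff.1 hdisj
  have haA : a ∉ A := fun h => notMem_of_notMem_vertices ha hAB (Finset.mem_union_left _ h)
  have haB : a ∉ B := fun h => notMem_of_notMem_vertices ha hAB (Finset.mem_union_right _ h)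
  have hbB : b ∉ B := fun h => notMem_of_notMem_vertices hb hAB (Finset.mem_union_right _ h)
  refine (isComplex_subd (isComplex_subd hK ⟨x, hxA⟩) ⟨x, hxB⟩).subdivision ?_ (by simp)
    (notMem_vertices_subd_subd hac hbc hc)
  rw [insert_left_mem_subd_subd hab haA haB ha (by simp [haB]) (by simp [hbB]),
    Finset.sdiff_union_self_eq_union, Finset.union_comm]
  exact ⟨fun h => (Finset.mem_sdiff.1 (h hxB)).2 hxA,
    fun h => (Finset.mem_sdiff.1 (h hxA)).2 hxA, hAB⟩

/-- When the two orders give different complexes, these have a common subdivision: subdividing one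
at `a (B \ A)` and the other at `b (A \ B)`, both with the same fresh vertex `c`, gives equal
results. Cofiniteness of `N` provides `c`. -/
theorem eqv_subd_subd_comm [Infinite V] (hK : IsComplex K) (hA : A ∈ K) (hB : B ∈ K)
    (hab : a ≠ b) (ha : a ∉ vertices K) (hb : b ∉ vertices K)
    (hGa : insert a (B \ A) ∉ G) (hGb : insert b (A \ B) ∉ G) (hN : Nᶜ.Finite) :
    Eqv G N (subd B b (subd A a K)) (subd A a (subd B b K)) := by
  by_cases h : Disjoint A B ∨ A ∪ B ∉ K
  · rw [subd_comm hK hA hB hab ha hb h]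
    exact Eqv.refl _
  · push Not at h
    obtain ⟨c, hc⟩ := ((hN.union (finite_vertices hK)).union (Set.toFinite {a, b})).exists_notMem
    simp only [Set.mem_union, Set.mem_insert_iff, Set.mem_singleton_iff, not_or] at hc
    obtain ⟨⟨hcN, hc⟩, hca, hcb⟩ := hc
    have hcN' : c ∈ N := by simpa using hcN
    have s1 := isSubdivision_exchange hK h.2 h.1 hab (Ne.symm hca) (Ne.symm hcb) ha hb hc
    have s2 := isSubdivision_exchange hK (Finset.union_comm A B ▸ h.2) (fun h' => h.1 h'.symm)
      hab.symm (Ne.symm hcb) (Ne.symm hca) hb ha hc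
    rw [subd_subd_subd_comm hab (Ne.symm hca) (Ne.symm hcb)
      (notMem_of_notMem_vertices ha hA) (notMem_of_notMem_vertices ha hB)
      (notMem_of_notMem_vertices hb hA) (notMem_of_notMem_vertices hb hB)
      (notMem_of_notMem_vertices hc hA) (notMem_of_notMem_vertices hc hB) ha hb hc] at s1
    exact (s1.eqv hGa hcN').trans (s2.eqv hGb hcN').symm

/-- Carries the move `(B, b)` across the subdivision `(A, a)`. If `A ⊆ B`, then `(A, a)` destroys
`B`, and the move is made at `a (B \ A)` instead. Otherwise `B` survives, and the two subdivisions
are swapped. The case `B ⊆ A` is excluded because `(B, b)` would destroy `A`. -/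
theorem eqv_subd_subd_of_move [Infinite V] (hK : IsComplex K) (hA : A ∈ K) (hB : B ∈ K)
    (hne : A.Nonempty) (hne' : B.Nonempty) (hBA : ¬B ⊆ A) (hab : a ≠ b) (ha : a ∉ vertices K)
    (hb : b ∉ vertices K)
    (hG : B ∉ G) (hGa : insert a (B \ A) ∉ G) (hGb : insert b (A \ B) ∉ G) (hbN : b ∈ N)
    (hN : Nᶜ.Finite) :
    Eqv G N (subd A a K) (subd A a (subd B b K)) := by
  by_cases hAB : A ⊆ B
  · exact eqv_subd_subd_of_ssubset hK hB ⟨hAB, hBA⟩ hab ha hb hGa hbN hne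
  · refine Eqv.trans ?_ (eqv_subd_subd_comm hK hA hB hab ha hb hGa hGb hN)
    refine (isComplex_subd hK hne).eqv_subd ?_ hne' (notMem_vertices_subd hab.symm hb) hG hbN
    rw [mem_subd_of_notMem (notMem_of_notMem_vertices ha hB)]
    exact ⟨hAB, hB⟩

end Commute

/-! ### Rearranging an equivalence: subdivisions first -/

/-- The simplexes with all vertices in `W`. -/
def within (W : Set V) : Set (Finset V) := {C | (C : Set V) ⊆ W}

/-- `K'` is the subdivision of `K` at `E` with some new vertex outside `W` if `E` is a simplex of
`K`, and `K` itself otherwise. -/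
def SubdAt (W : Set V) (E : Finset V) (K K' : Set (Finset V)) : Prop :=
  (E ∉ K ∧ K' = K) ∨ ∃ e, e ∉ W ∧ IsSubdivision E e K K'

section SubdAt

variable {W : Set V} {E B : Finset V} {K L J X Y Z T : Set (Finset V)} {a b e : V}

theorem insert_notMem_within {C : Finset V} (ha : a ∉ W) : insert a C ∉ within W :=
  fun h => ha (h (by simp))

theorem SubdAt.isComplex (h : SubdAt W E K X) (hK : IsComplex K) : IsComplex X := by
  rcases h with ⟨_, rfl⟩ | ⟨e, _, h⟩
  exacts [hK, h.right]

theorem IsComplex.exists_subdAt [Infinite V] (hK : IsComplex K) (hW : W.Finite)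
    (hE : E.Nonempty) : ∃ X, SubdAt W E K X := by
  by_cases h : E ∈ K
  · obtain ⟨e, he⟩ := (hW.union (finite_vertices hK)).exists_notMem
    simp only [Set.mem_union, not_or] at he
    exact ⟨_, Or.inr ⟨e, he.1, hK.subdivision h hE he.2⟩⟩
  · exact ⟨K, Or.inl ⟨h, rfl⟩⟩

/-- The new vertex `e` is renamed to `a` by a subdivision at `{e}`, which is admissible because `e`
lies outside `W`. Thus the choice of the new vertex is immaterial. -/
theorem eqv_subd_rename (hK : IsComplex K) (hE : E ∈ K) (hne : E.Nonempty)
    (he : e ∉ vertices K) (ha : a ∉ vertices K) (heW : e ∉ W) (haW : a ∉ W) :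
    Eqv (within W) Wᶜ (subd E e K) (subd E a K) := by
  by_cases hea : e = a
  · subst hea
    exact Eqv.refl _
  have haV : a ∉ vertices (subd E e K) := notMem_vertices_subd (Ne.symm hea) ha
  have h : subd {e} a (subd E e K) = subd E a K := by
    rw [subd_singleton haV hea, pmap_subd, Equiv.swap_apply_left, map_eq_self_of_forall,
      pmap_eq_self]
    · rintro x hx
      exact Equiv.swap_apply_of_ne_of_ne (by rintro rfl; exact he hx) (by rintro rfl; exact ha hx)
    · rintro x hx
      exact Equiv.swap_apply_of_ne_of_ne (by rintro rfl; exact he ⟨E, hE, hx⟩)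
        (by rintro rfl; exact ha ⟨E, hE, hx⟩)
  rw [← h]
  refine (isComplex_subd hK hne).eqv_subd ?_ (by simp) haV ?_ haW
  · rw [← insert_empty_eq, insert_mem_subd (by simp) (notMem_of_notMem_vertices he hE) he]
    exact ⟨fun h => hne.ne_empty (Finset.subset_empty.1 h), by simpa using hE⟩
  · intro h
    exact heW (h (by simp))

theorem SubdAt.unique (hX : SubdAt W E K X) (hY : SubdAt W E K Y) :
    Eqv (within W) Wᶜ X Y := by
  rcases hX with ⟨h1, rfl⟩ | ⟨e, he, h1⟩
  · rcases hY with ⟨h2, rfl⟩ | ⟨e', he', h2⟩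
    · exact Eqv.refl _
    · exact absurd (isSubdivision_iff.1 h2).2.1 h1
  · obtain ⟨hK, hE, hne, heK, rfl⟩ := isSubdivision_iff.1 h1
    rcases hY with ⟨h2, rfl⟩ | ⟨e', he', h2⟩
    · exact absurd hE h2
    · obtain ⟨-, -, -, heK', rfl⟩ := isSubdivision_iff.1 h2
      exact eqv_subd_rename hK hE hne heK heK' he he'

theorem SubdAt.eqv_of_not (h : SubdAt W E K X) (hE : E ∉ within W) :
    Eqv (within W) Wᶜ K X := by
  rcases h with ⟨_, rfl⟩ | ⟨e, he, h⟩
  exacts [Eqv.refl _, h.eqv hE he]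

theorem subdAt_subd (hK : IsComplex K) (hE : E ∈ K) (hne : E.Nonempty) (he : e ∉ vertices K)
    (heW : e ∉ W) : SubdAt W E K (subd E e K) :=
  Or.inr ⟨e, heW, hK.subdivision hE hne he⟩

/-- The vertices of `E` lie in `W`, while `b` and some vertex of `B` do not. So the move neither
creates nor destroys `E`, and it can be carried across the subdivision at `E`. -/
theorem SubdAt.eqv_of_isSubdivision [Infinite V] (hW : W.Finite) (hE : E ∈ within W)
    (hne : E.Nonempty) (hB : B ∉ within W) (hb : b ∉ W) (h : IsSubdivision B b K L)
    (hX : SubdAt W E K X) (hY : SubdAt W E L Y) : Eqv (within W) Wᶜ X Y := by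
  have hL := h.right
  have hsub := h
  obtain ⟨hK, hBK, hBne, hbK, rfl⟩ := isSubdivision_iff.1 h
  have hbE : b ∉ E := fun h => hb (hE h)
  have hBE : ¬B ⊆ E := fun h => hB fun x hx => hE (h hx)
  have hmem : E ∈ subd B b K ↔ E ∈ K := by
    rw [mem_subd_of_notMem hbE]
    tauto
  by_cases hEK : E ∈ K
  · obtain ⟨a, ha⟩ := (((hW.union (finite_vertices hK)).union
      (finite_vertices hL)).union (Set.finite_singleton b)).exists_notMem
    simp only [Set.mem_union, Set.mem_singleton_iff, not_or] at ha
    obtain ⟨⟨⟨haW, haK⟩, haL⟩, hab⟩ := ha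
    have h1 := hX.unique (subdAt_subd hK hEK hne haK haW)
    have h2 := hY.unique (subdAt_subd hL (hmem.2 hEK) hne haL haW)
    refine h1.trans (Eqv.trans ?_ h2.symm)
    exact eqv_subd_subd_of_move hK hEK hBK hne hBne hBE hab haK hbK hB
      (insert_notMem_within haW) (insert_notMem_within hb) hb (by simpa using hW)
  · rcases hX with ⟨_, rfl⟩ | ⟨e, he, h1⟩
    · rcases hY with ⟨_, rfl⟩ | ⟨e, he, h2⟩
      · exact hsub.eqv hB hb
      · exact absurd (hmem.1 (isSubdivision_iff.1 h2).2.1) hEK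
    · exact absurd (isSubdivision_iff.1 h1).2.1 hEK

/-- Subdividing at `E` respects the equivalence by moves which introduce no vertex in `W` and take
place at simplexes with a vertex outside `W`. -/
theorem SubdAt.congr [Infinite V] (hW : W.Finite) (hne : E.Nonempty)
    (h : Eqv (within W) Wᶜ K J) (hX : SubdAt W E K X) (hY : SubdAt W E J Y) :
    Eqv (within W) Wᶜ X Y := by
  by_cases hE : E ∈ within W
  · induction h generalizing Y with
    | refl => exact hX.unique hY
    | tail _ hm ih =>
      obtain ⟨Z, hZ⟩ := hm.isComplex_left.exists_subdAt hW hne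
      refine (ih hZ).trans ?_
      obtain ⟨B, b, hB, hb, h | h⟩ := hm
      · exact SubdAt.eqv_of_isSubdivision hW hE hne hB hb h hZ hY
      · exact (SubdAt.eqv_of_isSubdivision hW hE hne hB hb h hY hZ).symm
  -- Here `E` has a vertex outside `W`, so subdividing at it is itself an admissible move.
  · exact (hX.eqv_of_not hE).symm.trans (h.trans (hY.eqv_of_not hE))

/-- Subdivisions at `B` and at `E` commute up to equivalence. -/
theorem SubdAt.comm [Infinite V] (hW : W.Finite) (hK : IsComplex K) (hBne : B.Nonempty)
    (hEne : E.Nonempty) (hX : SubdAt W B K X) (hY : SubdAt W E X Y) (hZ : SubdAt W E K Z)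
    (hT : SubdAt W B Z T) : Eqv (within W) Wᶜ Y T := by
  by_cases hB : B ∈ within W
  swap
  · exact ((SubdAt.congr hW hEne (hX.eqv_of_not hB) hZ hY).symm.trans (hT.eqv_of_not hB))
  by_cases hE : E ∈ within W
  swap
  · exact ((hY.eqv_of_not hE).symm.trans (SubdAt.congr hW hBne (hZ.eqv_of_not hE) hX hT))
  obtain ⟨a, ha⟩ := (hW.union (finite_vertices hK)).exists_notMem
  obtain ⟨b, hb⟩ := ((hW.union (finite_vertices hK)).union (Set.finite_singleton a)).exists_notMem
  simp only [Set.mem_union, Set.mem_singleton_iff, not_or] at ha hb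
  obtain ⟨haW, haK⟩ := ha
  obtain ⟨⟨hbW, hbK⟩, hba⟩ := hb
  have hab : a ≠ b := Ne.symm hba
  have haE : a ∉ E := fun h => haW (hE h)
  have hbE : b ∉ E := fun h => hbW (hE h)
  have haB : a ∉ B := fun h => haW (hB h)
  have hbB : b ∉ B := fun h => hbW (hB h)
  -- By `SubdAt.unique` and `SubdAt.congr` it is enough to treat one choice of new vertices.
  suffices h : ∃ X' Y' Z' T', SubdAt W B K X' ∧ SubdAt W E X' Y' ∧ SubdAt W E K Z' ∧
      SubdAt W B Z' T' ∧ Eqv (within W) Wᶜ Y' T' by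
    obtain ⟨X', Y', Z', T', h1, h2, h3, h4, h5⟩ := h
    exact (SubdAt.congr hW hEne (hX.unique h1) hY h2).trans
      (h5.trans (SubdAt.congr hW hBne (hZ.unique h3) hT h4).symm)
  by_cases hEK : E ∈ K
  swap
  · obtain ⟨X', hX'⟩ := hK.exists_subdAt (E := B) hW hBne
    refine ⟨X', X', K, X', hX', Or.inl ⟨?_, rfl⟩, Or.inl ⟨hEK, rfl⟩, hX', Eqv.refl _⟩
    rcases hX' with ⟨_, rfl⟩ | ⟨c, hc, h⟩
    · exact hEK
    · obtain ⟨-, -, -, -, rfl⟩ := isSubdivision_iff.1 h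
      rw [mem_subd_of_notMem fun h => hc (hE h)]
      exact fun h => hEK h.2
  by_cases hBK : B ∈ K
  swap
  · obtain ⟨Z', hZ'⟩ := hK.exists_subdAt (E := E) hW hEne
    refine ⟨K, Z', Z', Z', Or.inl ⟨hBK, rfl⟩, hZ', hZ', Or.inl ⟨?_, rfl⟩, Eqv.refl _⟩
    rcases hZ' with ⟨_, rfl⟩ | ⟨c, hc, h⟩
    · exact hBK
    · obtain ⟨-, -, -, -, rfl⟩ := isSubdivision_iff.1 h
      rw [mem_subd_of_notMem fun h => hc (hB h)]
      exact fun h => hBK h.2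
  have hKB := isComplex_subd (a := b) hK hBne
  have hKE := isComplex_subd (a := a) hK hEne
  have haV : a ∉ vertices (subd B b K) := notMem_vertices_subd hab haK
  have hbV : b ∉ vertices (subd E a K) := notMem_vertices_subd hba hbK
  have sB := subdAt_subd hK hBK hBne hbK hbW
  have sE := subdAt_subd hK hEK hEne haK haW
  by_cases hEB : E ⊆ B
  -- Subdividing at a face `E` of `B` destroys `B`, so the later subdivision at `B` does nothing.
  · have h2 : SubdAt W B (subd E a K) (subd E a K) :=
      Or.inl ⟨by rw [mem_subd_of_notMem haB]; tauto, rfl⟩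
    by_cases hBE : B ⊆ E
    · have hEq := hEB.antisymm hBE
      subst hEq
      exact ⟨_, _, _, _, sB, Or.inl ⟨by rw [mem_subd_of_notMem hbE]; tauto, rfl⟩, sE, h2,
        eqv_subd_rename hK hEK hEne hbK haK hbW haW⟩
    · refine ⟨_, _, _, _, sB, subdAt_subd hKB ?_ hEne haV haW, sE, h2, ?_⟩
      · rw [mem_subd_of_notMem hbE]
        exact ⟨hBE, hEK⟩
      · exact (eqv_subd_subd_of_ssubset hK hBK ⟨hEB, hBE⟩ hab haK hbK
          (insert_notMem_within haW) hbW hEne).symm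
  · have h2 : SubdAt W B (subd E a K) (subd B b (subd E a K)) := by
      refine subdAt_subd hKE ?_ hBne hbV hbW
      rw [mem_subd_of_notMem haB]
      exact ⟨hEB, hBK⟩
    by_cases hBE : B ⊆ E
    · refine ⟨_, _, _, _, sB, Or.inl ⟨by rw [mem_subd_of_notMem hbE]; tauto, rfl⟩, sE, h2, ?_⟩
      exact eqv_subd_subd_of_ssubset hK hEK ⟨hBE, hEB⟩ hba hbK haK
        (insert_notMem_within hbW) haW hBne
    · refine ⟨_, _, _, _, sB, subdAt_subd hKB ?_ hEne haV haW, sE, h2, ?_⟩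
      · rw [mem_subd_of_notMem hbE]
        exact ⟨hBE, hEK⟩
      · exact (eqv_subd_subd_comm hK hEK hBK hab haK hbK (insert_notMem_within haW)
          (insert_notMem_within hbW) (by simpa using hW)).symm

/-- A subdivision at some simplex outside `F`, or nothing. -/
def SubdStep (F : Set (Finset V)) (W : Set V) (K L : Set (Finset V)) : Prop :=
  ∃ E, E ∉ F ∧ SubdAt W E K L

variable {F : Set (Finset V)}

theorem SubdStep.isComplex (hK : IsComplex K) (h : Relation.ReflTransGen (SubdStep F W) K L) :
    IsComplex L := by
  induction h with
  | refl => exact hK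
  | tail _ h ih =>
    obtain ⟨E, _, h⟩ := h
    exact h.isComplex ih

theorem nonempty_of_notMem (hF : ∅ ∈ F) (hE : E ∉ F) : E.Nonempty := by
  rw [Finset.nonempty_iff_ne_empty]
  rintro rfl
  exact hE hF

/-- After suitable subdivisions at simplexes outside `F`, an equivalence can be carried out by
moves at simplexes that have a vertex outside `W`. -/
theorem exists_subdSteps_eqv [Infinite V] (hW : W.Finite) (hF : ∅ ∈ F)
    (hJ : ∀ B ∈ J, B ∉ F → B ∉ within W) (h : Eqv F Wᶜ K J) (hK : IsComplex K) :
    ∃ L, Relation.ReflTransGen (SubdStep F W) K L ∧ Eqv (within W) Wᶜ L J := by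
  induction h using Relation.ReflTransGen.head_induction_on with
  | refl => exact ⟨J, Relation.ReflTransGen.refl, Eqv.refl _⟩
  | head hm _ ih =>
    obtain ⟨M, hM, hMJ⟩ := ih hm.isComplex_right
    obtain ⟨B, b, hB, hb, h | h⟩ := hm
    · exact ⟨M, Relation.ReflTransGen.head ⟨B, hB, Or.inr ⟨b, hb, h⟩⟩ hM, hMJ⟩
    · have hBne := nonempty_of_notMem hF hB
      -- For a weld, `K` is the subdivision at `B` of the next complex. The subdivisions found for
      -- that complex are performed on `K` instead; at each stage the result agrees, up to moves,
      -- with the subdivision at `B` of the original one.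
      have key : ∀ {X Y T}, IsComplex X → Relation.ReflTransGen (SubdStep F W) X Y →
          SubdAt W B X T → ∃ T', Relation.ReflTransGen (SubdStep F W) T T' ∧
            ∃ Y', SubdAt W B Y Y' ∧ Eqv (within W) Wᶜ T' Y' := by
        intro X Y T hX hXY hT
        induction hXY with
        | refl => exact ⟨T, Relation.ReflTransGen.refl, T, hT, Eqv.refl _⟩
        | tail hXZ hs ih =>
          obtain ⟨T', h1, Z', hZ', hT'⟩ := ih
          have hZ := SubdStep.isComplex hX hXZ
          obtain ⟨E, hE, hs⟩ := hs
          have hEne := nonempty_of_notMem hF hE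
          have hTc := SubdStep.isComplex (hT.isComplex hX) h1
          obtain ⟨T'', hT''⟩ := hTc.exists_subdAt (E := E) hW hEne
          obtain ⟨Z'', hZ''⟩ := (hZ'.isComplex hZ).exists_subdAt (E := E) hW hEne
          obtain ⟨Y', hY'⟩ := (hs.isComplex hZ).exists_subdAt (E := B) hW hBne
          exact ⟨T'', h1.tail ⟨E, hE, hT''⟩, Y', hY',
            (SubdAt.congr hW hEne hT' hT'' hZ'').trans
              (SubdAt.comm hW hZ hBne hEne hZ' hZ'' hs hY')⟩
      obtain ⟨T', h1, Y', hY', hT'⟩ := key h.left hM (Or.inr ⟨b, hb, h⟩)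
      refine ⟨T', h1, hT'.trans ?_⟩
      obtain ⟨J', hJ'⟩ := (hMJ.isComplex (SubdStep.isComplex h.left hM)).exists_subdAt
        (E := B) hW hBne
      refine (SubdAt.congr hW hBne hMJ hY' hJ').trans ?_
      -- If `B` has a vertex outside `W`, subdividing `J` at `B` is an admissible move. If not, `B`
      -- is not in `J` by `hJ`, and the subdivision does nothing.
      by_cases hBW : B ∈ within W
      · rcases hJ' with ⟨_, rfl⟩ | ⟨e, he, h⟩
        · exact Eqv.refl _
        · exact absurd hBW (hJ B (isSubdivision_iff.1 h).2.1 hB)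
      · exact (hJ'.eqv_of_not hBW).symm

/-- If `K` can be starred relative to `F`, then after subdivisions outside `F` it can be starred
by moves at simplexes with a vertex outside the given finite set `W`. -/
theorem exists_subdSteps_eqv_cone [Infinite V] {v : V} (hW : W.Finite) (hK : IsComplex K)
    (hF : IsComplex F) (h : Eqv F (vertices F)ᶜ K (cone v F))
    (hv : v ∉ vertices F) :
    ∃ w, w ∉ W ∧ ∃ L, Relation.ReflTransGen (SubdStep F W) K L ∧
      Eqv (within W) Wᶜ L (cone w F) := by
  obtain ⟨π, w, hw, h1, h2⟩ := h.exists_rename hK hF hv hW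
  obtain ⟨L, hL, hL'⟩ := exists_subdSteps_eqv hW hF.empty_mem (fun B hB hBF hBW => by
    rw [mem_cone hF, Finset.erase_eq_of_notMem fun h => hw (hBW h)] at hB
    exact hBF hB) h1 (isComplex_pmap hK)
  refine ⟨w, hw, L, Relation.ReflTransGen.trans ?_ hL, hL'⟩
  refine Relation.ReflTransGen.mono ?_ _ _ h2
  rintro X Y ⟨x, hx, y, hy, h⟩
  exact ⟨{x}, fun h => hx ⟨_, h, by simp⟩, Or.inr ⟨y, hy, h⟩⟩

end SubdAt

/-! ### Subdividing with a second complex carried along -/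

section Union

variable {K X : Set (Finset V)} {B : Finset V} {b : V}

theorem IsComplex.union (hK : IsComplex K) (hX : IsComplex X) : IsComplex (K ∪ X) where
  finite := hK.finite.union hX.finite
  empty_mem := Or.inl hK.empty_mem
  mem_of_subset _ _ h hs := h.imp (fun h => hK.down h hs) fun h => hX.down h hs

theorem vertices_union : vertices (K ∪ X) = vertices K ∪ vertices X := by
  ext x
  constructor
  · rintro ⟨C, h | h, hx⟩
    exacts [Or.inl ⟨C, h, hx⟩, Or.inr ⟨C, h, hx⟩]
  · rintro (⟨C, h, hx⟩ | ⟨C, h, hx⟩)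
    exacts [⟨C, Or.inl h, hx⟩, ⟨C, Or.inr h, hx⟩]

/-- No simplex of `X` contains `B`, so the subdivision takes place in `K` alone. -/
theorem subd_union (hX : IsComplex X) (hB : B ∉ X) (hbB : b ∉ B) (hbK : b ∉ vertices K)
    (hbX : b ∉ vertices X) : subd B b (K ∪ X) = subd B b K ∪ X := by
  have hb : b ∉ vertices (K ∪ X) := by
    rw [vertices_union]
    exact fun h => h.elim hbK hbX
  refine ext_insert b (fun C hC => ?_) (fun C hC => ?_)
  · have h1 : C ∈ X → ¬B ⊆ C := fun h h' => hB (hX.down h h')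
    rw [mem_subd_of_notMem hC, Set.mem_union, Set.mem_union, mem_subd_of_notMem hC]
    tauto
  · have h1 : C ∪ B ∉ X := fun h => hB (hX.down h Finset.subset_union_right)
    have h2 : insert b C ∉ X := notMem_of_mem_of_notMem_vertices hbX (by simp)
    rw [insert_mem_subd hC hbB hb, Set.mem_union, Set.mem_union, insert_mem_subd hC hbB hbK]
    tauto

theorem IsSubdivision.union {K' : Set (Finset V)} (h : IsSubdivision B b K K')
    (hX : IsComplex X) (hB : B ∉ X) (hbX : b ∉ vertices X) :
    IsSubdivision B b (K ∪ X) (K' ∪ X) := by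
  obtain ⟨hK, hBK, hne, hb, rfl⟩ := isSubdivision_iff.1 h
  refine isSubdivision_iff.2 ⟨hK.union hX, Or.inl hBK, hne, ?_, ?_⟩
  · rw [vertices_union]
    exact fun h => h.elim hb hbX
  · rw [subd_union hX hB (notMem_of_notMem_vertices hb hBK) hb hbX]

end Union

/-! ### Bistellar exchange -/

section Exchange

/-- The exchange of `S` for `E`: if the link of `S` in `K` is `∂E ⋆ N`, then `S ⋆ ∂E ⋆ N` is
replaced by `∂S ⋆ E ⋆ N`. -/
def exchange (S E : Finset V) (K : Set (Finset V)) : Set (Finset V) :=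
  {C | ¬S ⊆ C ∧ (C ∈ K ∨ (E ⊆ C ∧ C \ E ∪ S ∈ K))}

variable {S E : Finset V} {K : Set (Finset V)} {z : V}

/-- `H` expresses, without naming `N`, that the link of `S` has the form `∂E ⋆ N`. -/
theorem isComplex_exchange (hK : IsComplex K) (hS : S.Nonempty)
    (H : ∀ C, C ∪ S ∈ K ↔ ¬E ⊆ C ∧ C \ E ∪ S ∈ K) : IsComplex (exchange S E K) where
  finite := by
    refine (hK.finite.union (hK.finite.biUnion fun B _ =>
      (B ∪ E).powerset.finite_toSet)).subset ?_
    rintro C ⟨_, h | ⟨_, h⟩⟩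
    · exact Or.inl h
    · refine Or.inr (Set.mem_biUnion h ?_)
      simp only [Finset.coe_powerset, Set.mem_preimage, Set.mem_powerset_iff, Finset.coe_subset]
      grind
  empty_mem := ⟨by simpa [Finset.subset_empty] using hS.ne_empty, Or.inl hK.empty_mem⟩
  mem_of_subset B C hC h := by
    refine ⟨fun h' => hC.1 (h'.trans h), ?_⟩
    rcases hC.2 with h1 | ⟨h1, h2⟩
    · exact Or.inl (hK.down h1 h)
    · have h3 : B \ E ∪ S ∈ K := hK.down h2
        (Finset.union_subset_union_left (Finset.sdiff_subset_sdiff h subset_rfl))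
      by_cases hE : E ⊆ B
      · exact Or.inr ⟨hE, h3⟩
      · exact Or.inl (hK.down ((H B).2 ⟨hE, h3⟩) Finset.subset_union_left)

/-- Both `S ⋆ ∂E ⋆ N` and `∂S ⋆ E ⋆ N` become `z ⋆ ∂S ⋆ ∂E ⋆ N`. So the exchange is a subdivision at
`S` followed by a weld to `E`. -/
theorem subd_exchange (hK : IsComplex K) (hSE : Disjoint S E) (hEK : E ∉ K)
    (hzK : z ∉ vertices K) (hzE : z ∉ E) (hzS : z ∉ S)
    (H : ∀ C, C ∪ S ∈ K ↔ ¬E ⊆ C ∧ C \ E ∪ S ∈ K) :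
    subd E z (exchange S E K) = subd S z K := by
  have hz : z ∉ vertices (exchange S E K) := by
    rintro ⟨C, ⟨_, h | ⟨_, h⟩⟩, hz⟩
    · exact hzK ⟨C, h, hz⟩
    · exact hzK ⟨_, h, by simp [hz, hzE]⟩
  refine ext_insert z (fun C hC => ?_) (fun C hC => ?_)
  · rw [mem_subd_of_notMem hC, mem_subd_of_notMem hC]
    have : C ∈ K → ¬E ⊆ C := fun h h' => hEK (hK.down h h')
    constructor
    · rintro ⟨h1, h2, h3 | h3⟩
      · exact ⟨h2, h3⟩
      · exact absurd h3.1 h1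
    · rintro ⟨h1, h2⟩
      exact ⟨this h2, h1, Or.inl h2⟩
  · rw [insert_mem_subd hC hzE hz, insert_mem_subd hC hzS hzK, H]
    have h1 : S ⊆ C ∪ E ↔ S ⊆ C :=
      ⟨fun h => hSE.left_le_of_le_sup_right h, fun h => h.trans Finset.subset_union_left⟩
    have h2 : C ∪ E ∉ K := fun h => hEK (hK.down h Finset.subset_union_right)
    have h3 : (C ∪ E) \ E = C \ E := Finset.union_sdiff_right C E
    constructor
    · rintro ⟨g1, g2, g3 | ⟨_, g3⟩⟩
      · exact absurd g3 h2
      · exact ⟨fun h => g2 (h1.2 h), g1, h3 ▸ g3⟩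
    · rintro ⟨g1, g2, g3⟩
      exact ⟨g2, fun h => g1 (h1.1 h), Or.inr ⟨Finset.subset_union_right, h3.symm ▸ g3⟩⟩

end Exchange

/-! ### Coning off the star of a simplex -/

section Block

variable {A E : Finset V} {a e w z : V} {D K F L L' : Set (Finset V)} {W : Set V}

/-- The join of the simplex `a A` with `D`. -/
def block (A : Finset V) (a : V) (D : Set (Finset V)) : Set (Finset V) :=
  {C | C \ insert a A ∈ D}

theorem isComplex_block (hD : IsComplex D) : IsComplex (block A a D) where
  finite := by
    refine (hD.finite.biUnion fun B _ => (B ∪ insert a A).powerset.finite_toSet).subset ?_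
    intro C hC
    refine Set.mem_biUnion hC ?_
    simp only [Finset.coe_powerset, Set.mem_preimage, Set.mem_powerset_iff, Finset.coe_subset]
    exact subset_union_iff_sdiff_subset.2 subset_rfl
  empty_mem := by simpa [block] using hD.empty_mem
  mem_of_subset B C hC h := hD.down hC (Finset.sdiff_subset_sdiff h subset_rfl)

theorem notMem_vertices_block (hzD : z ∉ vertices D) (hzA : z ∉ A) (hza : z ≠ a) :
    z ∉ vertices (block A a D) := by
  rintro ⟨C, hC, hz⟩
  exact hzD ⟨_, hC, by simp [hz, hzA, hza]⟩

theorem notMem_block (hED : E ∉ D) (hAE : Disjoint A E) (haE : a ∉ E) :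
    E ∉ block A a D := by
  have : E \ insert a A = E := by
    rw [Finset.sdiff_eq_self_iff_disjoint, Finset.disjoint_insert_right]
    exact ⟨haE, hAE.symm⟩
  simpa [block, this] using hED

theorem insert_notMem_block (hED : E ∉ D) (hAE : Disjoint A E) (haE : a ∉ E) :
    insert a E ∉ block A a D := by
  have : insert a E \ insert a A = E := by
    have h := Finset.disjoint_left.1 hAE
    ext x
    simp only [Finset.mem_sdiff, Finset.mem_insert, not_or]
    constructor
    · rintro ⟨h1 | h1, h2, h3⟩
      exacts [absurd h1 h2, h1]
    · exact fun hx => ⟨Or.inr hx, fun h' => haE (h' ▸ hx), fun h' => h h' hx⟩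
  simpa [block, this] using hED

/-- Starring the star of `A`, where `D` is the boundary of the link of `A`, commutes with
subdividing the link of `A`. -/
theorem subd_starAt (hK : IsComplex K) (hD : IsComplex D) (hAE : Disjoint A E)
    (hE : E.Nonempty) (hED : E ∉ D) (hAEK : A ∪ E ∈ K) (hae : a ≠ e) (ha : a ∉ vertices K)
    (he : e ∉ vertices K) (heD : e ∉ vertices D) :
    subd (insert a E) e (subd A a K ∪ block A a D) =
      subd A a (subd (A ∪ E) e K) ∪ block A a D := by
  have haE : a ∉ E := fun h => notMem_of_notMem_vertices ha hAEK (Finset.mem_union_right _ h)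
  have heE : e ∉ E := fun h => notMem_of_notMem_vertices he hAEK (Finset.mem_union_right _ h)
  have heA : e ∉ A := fun h => notMem_of_notMem_vertices he hAEK (Finset.mem_union_left _ h)
  have hss : A ⊂ A ∪ E := by
    refine ⟨Finset.subset_union_left, fun h => ?_⟩
    obtain ⟨x, hx⟩ := hE
    exact Finset.disjoint_left.1 hAE (h (Finset.mem_union_right _ hx)) hx
  -- The simplex `aE` is not in the block, so only the first part changes. There the rule for a pair
  -- `A ⊂ A ∪ E` applies.
  rw [subd_union (isComplex_block hD) (insert_notMem_block hED hAE haE)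
    (by simp [hae.symm, heE]) (notMem_vertices_subd hae.symm he)
    (notMem_vertices_block heD heA hae.symm), subd_subd_of_ssubset hK hAEK hss hae ha he,
    Finset.union_sdiff_cancel_left hAE]

theorem isSubdivision_starAt (hK : IsComplex K) (hD : IsComplex D) (hAE : Disjoint A E)
    (hA : A.Nonempty)
    (hE : E.Nonempty) (hED : E ∉ D) (hAEK : A ∪ E ∈ K) (hae : a ≠ e) (ha : a ∉ vertices K)
    (he : e ∉ vertices K) (heD : e ∉ vertices D) :
    IsSubdivision (insert a E) e (subd A a K ∪ block A a D)
      (subd A a (subd (A ∪ E) e K) ∪ block A a D) := by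
  have haE : a ∉ E := fun h => notMem_of_notMem_vertices ha hAEK (Finset.mem_union_right _ h)
  have haA : a ∉ A := fun h => notMem_of_notMem_vertices ha hAEK (Finset.mem_union_left _ h)
  have heA : e ∉ A := fun h => notMem_of_notMem_vertices he hAEK (Finset.mem_union_left _ h)
  refine isSubdivision_iff.2 ⟨(isComplex_subd hK hA).union (isComplex_block hD), Or.inl ?_,
    by simp, ?_, (subd_starAt hK hD hAE hE hED hAEK hae ha he heD).symm⟩
  · rw [insert_mem_subd haE haA ha, Finset.union_comm]
    refine ⟨fun h => ?_, hAEK⟩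
    obtain ⟨x, hx⟩ := hA
    exact Finset.disjoint_left.1 hAE hx (h hx)
  · rw [vertices_union]
    exact fun h => h.elim (notMem_vertices_subd hae.symm he)
      (notMem_vertices_block heD heA hae.symm)

theorem subd_eq_self (hK : IsComplex K) (hA : A ∉ K) : subd A a K = K := by
  ext C
  have h1 : C ∈ K → ¬A ⊆ C := fun h h' => hA (hK.down h h')
  have h2 : C.erase a ∪ A ∉ K := fun h => hA (hK.down h Finset.subset_union_right)
  simp only [subd, Set.mem_ofPred_eq]
  tauto

/-- The link of an old simplex in a stellar subdivision. -/
theorem link_subd {C : Finset V} (hK : IsComplex K) (hA : A.Nonempty) (haK : a ∉ vertices K)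
    (haA : a ∉ A) (haC : a ∉ C) : link C (subd A a K) = subd (A \ C) a (link C K) := by
  have hc := isComplex_subd (a := a) hK hA
  have haL : a ∉ vertices (link C K) := fun ⟨D, hD, h⟩ => haK ⟨D, hD.1, h⟩
  have hsub : ∀ D, A ⊆ C ∪ D ↔ A \ C ⊆ D := fun D => by
    rw [Finset.union_comm]; exact subset_union_iff_sdiff_subset
  refine ext_insert a (fun D hD => ?_) (fun D hD => ?_)
  · rw [mem_link hc, mem_subd_of_notMem (by simp [haC, hD]), mem_subd_of_notMem hD, mem_link hK,
      hsub]
    tauto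
  · rw [mem_link hc, Finset.union_insert, insert_mem_subd (by simp [haC, hD]) haA
      haK, insert_mem_subd hD (by simp [haA]) haL, mem_link hK, hsub,
      Finset.disjoint_insert_right, Finset.disjoint_union_right,
      show C ∪ (D ∪ A \ C) = C ∪ D ∪ A by
        ext x; simp only [Finset.mem_union, Finset.mem_sdiff]; tauto]
    have := Finset.disjoint_sdiff (s := C) (t := A)
    tauto

theorem link_subd_union (hK : IsComplex K) (hAE : Disjoint A E) (hE : E.Nonempty)
    (hAEK : A ∪ E ∈ K) (he : e ∉ vertices K) :
    link A (subd (A ∪ E) e K) = subd E e (link A K) := by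
  have heAE := notMem_of_notMem_vertices he hAEK
  rw [link_subd hK (hE.mono Finset.subset_union_right) he heAE
    (fun h => heAE (Finset.mem_union_left _ h)), Finset.union_sdiff_cancel_left hAE]

theorem link_subd_of_union_notMem (hK : IsComplex K) (hA : A ∈ K) (hAE : Disjoint A E)
    (hE : E.Nonempty) (hEK : A ∪ E ∉ K) (hzK : z ∉ vertices K) (hzA : z ∉ A) (hzE : z ∉ E) :
    link A (subd E z K) = link A K := by
  rw [link_subd hK hE hzK hzE hzA, Finset.sdiff_eq_self_of_disjoint hAE.symm,
    subd_eq_self (isComplex_link hK hA)]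
  exact fun h => hEK ((mem_link hK).1 h).2

end Block

theorem union_sdiff_sdiff_union {A C E : Finset V} {e : V} (hd : Disjoint A C) (hEC : E ⊆ C)
    (he : e ∉ C) : ((A ∪ C) \ E) \ (A ∪ {e}) ∪ E = C := by
  ext x
  have k1 := @Finset.disjoint_left.1 hd x
  have k2 := @hEC x
  have k3 : x ∈ C → x ≠ e := fun hx hxe => he (hxe ▸ hx)
  simp only [Finset.mem_union, Finset.mem_sdiff, Finset.mem_singleton]
  tauto

/-! ### Lifting a starring of the link of a simplex to the whole complex -/

section StarLink

/-- The setting for starring the star of a simplex `A` of a complex whose boundary is `F`: `D` is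
the link of `A` in `F`, and `W` is a finite set of vertices containing those of `F`, `D` and `A`,
as well as the vertex `a` at which the star of `A` is to be starred. -/
structure StarSetting (F D : Set (Finset V)) (W : Set V) (A : Finset V) (a : V) : Prop where
  isComplex_D : IsComplex D
  finite : W.Finite
  vertices_F : vertices F ⊆ W
  vertices_D : vertices D ⊆ W
  within_A : ∀ x ∈ A, x ∈ W
  a_mem : a ∈ W
  a_notMem : a ∉ vertices F
  nonempty : A.Nonempty
  mem_D : ∀ E, Disjoint A E → A ∪ E ∈ F → E ∈ D

variable {A E : Finset V} {a e w z : V} {D K F L L' : Set (Finset V)} {W : Set V}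

/-- Every complex in which `A` has link `L` can be changed, by moves outside `F`, so that the star
of `A` gets replaced by the cone on its boundary. -/
def StarrableLink (F D : Set (Finset V)) (A : Finset V) (a : V) (L : Set (Finset V)) : Prop :=
  ∀ K, IsComplex K → A ∈ K → a ∉ vertices K → link A K = L →
    Eqv F (vertices F)ᶜ K (subd A a K ∪ block A a D)

theorem StarSetting.notMem_F (h : StarSetting F D W A a) (hE : ¬(E : Set V) ⊆ W) : E ∉ F :=
  fun hEF => hE fun _ hx => h.vertices_F ⟨E, hEF, hx⟩

theorem StarSetting.notMem_D (h : StarSetting F D W A a) (hE : ¬(E : Set V) ⊆ W) : E ∉ D :=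
  fun hEF => hE fun _ hx => h.vertices_D ⟨E, hEF, hx⟩

/-- A simplex `E` about to enter the link of `A` may already occur in `K` away from the star of `A`.
Subdividing it with a fresh vertex removes it without changing that link. The same move is available
after the star of `A` has been coned off, because `E ∉ D` keeps `E` out of the block. -/
theorem StarSetting.exists_notMem [Infinite V] (h : StarSetting F D W A a)
    (hK : IsComplex K) (haK : a ∉ vertices K) (hAK : A ∈ K)
    (hE : E.Nonempty) (hAE : Disjoint A E) (hEL : E ∉ link A K) (hED : E ∉ D) (hEF : E ∉ F) :
    ∃ K', IsComplex K' ∧ A ∈ K' ∧ a ∉ vertices K' ∧ link A K' = link A K ∧ E ∉ K' ∧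
      Eqv F (vertices F)ᶜ K K' ∧
      Eqv F (vertices F)ᶜ (subd A a K ∪ block A a D) (subd A a K' ∪ block A a D) := by
  by_cases hEK : E ∈ K
  swap
  · exact ⟨K, hK, hAK, haK, rfl, hEK, Eqv.refl _, Eqv.refl _⟩
  obtain ⟨z, hz⟩ := (h.finite.union (finite_vertices hK)).exists_notMem
  simp only [Set.mem_union, not_or] at hz
  obtain ⟨hzW, hzK⟩ := hz
  have haz : a ≠ z := fun h' => hzW (h' ▸ h.a_mem)
  have hzA : z ∉ A := fun h' => hzW (h.within_A z h')
  have hzE := notMem_of_notMem_vertices hzK hEK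
  have haE := notMem_of_notMem_vertices haK hEK
  have hAEK : A ∪ E ∉ K := fun h' => hEL ((mem_link hK).2 ⟨hAE, h'⟩)
  have hAE' : ¬A ⊆ E := fun h' => by
    obtain ⟨x, hx⟩ := h.nonempty
    exact Finset.disjoint_left.1 hAE hx (h' hx)
  have hEA' : ¬E ⊆ A := fun h' => by
    obtain ⟨x, hx⟩ := hE
    exact Finset.disjoint_left.1 hAE (h' hx) hx
  have hzF : z ∈ (vertices F)ᶜ := fun h' => hzW (h.vertices_F h')
  refine ⟨subd E z K, isComplex_subd hK hE, ?_, notMem_vertices_subd haz haK,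
    link_subd_of_union_notMem hK hAK hAE hE hAEK hzK hzA hzE, ?_,
    hK.eqv_subd hEK hE hzK hEF hzF, ?_⟩
  · rw [mem_subd_of_notMem hzA]
    exact ⟨hEA', hAK⟩
  · rw [mem_subd_of_notMem hzE]
    tauto
  · rw [subd_comm hK hAK hEK haz haK hzK (Or.inl hAE)]
    refine IsSubdivision.eqv (IsSubdivision.union ?_ (isComplex_block h.isComplex_D)
      (notMem_block hED hAE haE)
      (notMem_vertices_block (fun h' => hzW (h.vertices_D h')) hzA haz.symm)) hEF hzF
    refine (isComplex_subd hK h.nonempty).subdivision ?_ hE (notMem_vertices_subd haz.symm hzK)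
    rw [mem_subd_of_notMem haE]
    exact ⟨hAE', hEK⟩

/-- The link of `wA` is `D`, and `a ⋆ ∂(wA) ⋆ D` is the union of `a ⋆ ∂A ⋆ w ⋆ D` and `a ⋆ A ⋆ D`.
So a single subdivision at `wA` cones off the star of `A`. -/
theorem StarSetting.starrableLink_cone (h : StarSetting F D W A a) (hw : w ∉ W) :
    StarrableLink F D A a (cone w D) := by
  intro K hK hA ha hlink
  have haA := notMem_of_notMem_vertices ha hA
  have hwA : w ∉ A := fun h' => hw (h.within_A w h')
  have haw : a ≠ w := fun h' => hw (h' ▸ h.a_mem)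
  have hmem : ∀ C, C ∪ A ∈ K ↔ (C \ A).erase w ∈ D := by
    intro C
    rw [← mem_cone h.isComplex_D, ← hlink, mem_link hK, Finset.union_sdiff_self_eq_union,
      Finset.union_comm]
    exact ⟨fun h => ⟨Finset.disjoint_sdiff, h⟩, fun h => h.2⟩
  have hsub : ∀ C, insert w A ⊆ C ↔ w ∈ C ∧ A ⊆ C := fun C => Finset.insert_subset_iff
  have hmem' : ∀ C, C ∪ insert w A ∈ K ↔ C ∪ A ∈ K := by
    intro C
    rw [Finset.union_insert, ← Finset.insert_union, hmem, hmem,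
      Finset.insert_sdiff_of_notMem _ hwA, Finset.erase_insert_eq_erase]
  have hAw : insert w A ∈ K := by
    have := (hmem' ∅).2 (by simpa using hA)
    simpa using this
  have hD' : ∀ C, C ∈ D → w ∉ C := fun C hC hwC => hw (h.vertices_D ⟨C, hC, hwC⟩)
  suffices heq : subd A a K ∪ block A a D = subd (insert w A) a K by
    rw [heq]
    refine hK.eqv_subd hAw (by simp) ha (h.notMem_F ?_) h.a_notMem
    exact fun h' => hw (h' (by simp))
  have hDK : ∀ C, C \ A ∈ D → C ∪ A ∈ K := fun C hC =>
    (hmem C).2 (h.isComplex_D.down hC (Finset.erase_subset _ _))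
  have hwC : ∀ C, C \ A ∈ D → w ∉ C := fun C hC hwC => hD' _ hC (by simp [hwC, hwA])
  have hCD : ∀ C, C ∪ A ∈ K → w ∉ C → C \ A ∈ D := fun C hC hwC => by
    have := (hmem C).1 hC
    rwa [Finset.erase_eq_of_notMem (by simp [hwC])] at this
  refine ext_insert a (fun C hC => ?_) (fun C hC => ?_)
  · have hb : C ∈ block A a D ↔ C \ A ∈ D := by
      simp only [block, Set.mem_ofPred_eq, Finset.sdiff_insert]
      rw [Finset.erase_eq_of_notMem (by simp [hC])]
    rw [Set.mem_union, mem_subd_of_notMem hC, mem_subd_of_notMem hC, hb, hsub]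
    constructor
    · rintro (⟨h1, h2⟩ | h1)
      · exact ⟨fun h' => h1 h'.2, h2⟩
      · exact ⟨fun h' => hwC C h1 h'.1, hK.down (hDK C h1) Finset.subset_union_left⟩
    · rintro ⟨h1, h2⟩
      by_cases hAC : A ⊆ C
      · refine Or.inr (hCD C ?_ fun h' => h1 ⟨h', hAC⟩)
        rwa [Finset.union_eq_left.2 hAC]
      · exact Or.inl ⟨hAC, h2⟩
  · have hb : insert a C ∈ block A a D ↔ C \ A ∈ D := by
      simp only [block, Set.mem_ofPred_eq, Finset.sdiff_insert,
        Finset.insert_sdiff_of_notMem _ haA]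
      rw [Finset.erase_insert (by simp [hC])]
    rw [Set.mem_union, insert_mem_subd hC haA ha, insert_mem_subd hC (by simp [haw, haA]) ha, hb,
      hsub, hmem']
    constructor
    · rintro (⟨h1, h2⟩ | h1)
      · exact ⟨fun h' => h1 h'.2, h2⟩
      · exact ⟨fun h' => hwC C h1 h'.1, hDK C h1⟩
    · rintro ⟨h1, h2⟩
      by_cases hAC : A ⊆ C
      · exact Or.inr (hCD C h2 fun h' => h1 ⟨h', hAC⟩)
      · exact Or.inl ⟨hAC, h2⟩

/-- Subdividing `K` at `A ∪ E` performs `(E, e)` on the link of `A`. In the coned-off complex the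
corresponding move is at `aE`. If `e` already occurs in `K`, it is renamed first. -/
theorem StarSetting.starrableLink_of_subd [Infinite V] (h : StarSetting F D W A a)
    (hs : IsSubdivision E e L L') (hED : E ∉ D) (he : e ∉ W)
    (hL : StarrableLink F D A a L') : StarrableLink F D A a L := by
  intro K hK hA ha hlink
  obtain ⟨hLc, hEL, hE, heL, rfl⟩ := isSubdivision_iff.1 hs
  have heA : e ∉ A := fun h' => he (h.within_A e h')
  have hae : a ≠ e := fun h' => he (h' ▸ h.a_mem)
  have hne : ¬(({e} : Finset V) : Set V) ⊆ W := by simpa using he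
  obtain ⟨K', hK', hA', ha', hlink', heK', e1, e2⟩ := h.exists_notMem (E := {e}) hK ha
    hA (by simp) (by simpa using heA) (by rwa [hlink, hLc.singleton_mem]) (h.notMem_D hne)
    (h.notMem_F hne)
  rw [hK'.singleton_mem] at heK'
  rw [hlink] at hlink'
  have hEL' : E ∈ link A K' := hlink' ▸ hEL
  obtain ⟨hAE, hAEK⟩ := (mem_link hK').1 hEL'
  have heF : e ∈ (vertices F)ᶜ := fun h' => he (h.vertices_F h')
  have heD : e ∉ vertices D := fun h' => he (h.vertices_D h')
  have haE : a ∉ E := fun h' => notMem_of_notMem_vertices ha' hAEK (Finset.mem_union_right _ h')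
  have hneAE : (A ∪ E).Nonempty := hE.mono Finset.subset_union_right
  have m1 : Eqv F (vertices F)ᶜ K' (subd (A ∪ E) e K') :=
    hK'.eqv_subd hAEK hneAE heK' (fun h' => hED (h.mem_D E hAE h')) heF
  have m2 := (isSubdivision_starAt hK' h.isComplex_D hAE h.nonempty hE hED hAEK hae ha' heK'
    heD).eqv (F := F) (N := (vertices F)ᶜ)
    (fun h' => h.a_notMem ⟨_, h', by simp⟩) heF
  have m3 := hL (subd (A ∪ E) e K') (isComplex_subd hK' hneAE) (by
    rw [mem_subd_of_notMem heA]
    refine ⟨fun h' => ?_, hA'⟩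
    obtain ⟨x, hx⟩ := hE
    exact Finset.disjoint_left.1 hAE (h' (Finset.mem_union_right _ hx)) hx)
    (notMem_vertices_subd hae ha') (by rw [link_subd_union hK' hAE hE hAEK heK', hlink'])
  exact e1.trans (m1.trans (m3.trans (m2.symm.trans e2.symm)))

set_option maxHeartbeats 400000 in
-- A weld of the link is lifted by a bistellar exchange. The link of `Ae` in `K` is that of `e` in
-- the subdivided link, namely `∂E ⋆ lk(E, L)`, so exchanging `Ae` for `E` gives a complex `M` in
-- which `A` has link `L`. A subdivision of `M` at `E` and one of `K` at `Ae` coincide. In the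
-- coned-off complexes the corresponding subdivisions are at `E` and at `ae`.
theorem StarSetting.starrableLink_subd [Infinite V] (h : StarSetting F D W A a)
    (hs : IsSubdivision E e L L') (hEW : ¬(E : Set V) ⊆ W) (he : e ∉ W)
    (hL : StarrableLink F D A a L) : StarrableLink F D A a L' := by
  intro K hK hA ha hlink
  have hL'c := hs.right
  obtain ⟨hLc, hEL, hE, heL, rfl⟩ := isSubdivision_iff.1 hs
  have heE := notMem_of_notMem_vertices heL hEL
  have heA : e ∉ A := fun h' => he (h.within_A e h')
  have hae : a ≠ e := fun h' => he (h' ▸ h.a_mem)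
  have hEL' : E ∉ subd E e L := by
    rw [mem_subd_of_notMem heE]
    tauto
  have heL' : {e} ∈ subd E e L := by
    rw [← insert_empty_eq, insert_mem_subd (by simp) heE heL]
    exact ⟨fun h' => hE.ne_empty (Finset.subset_empty.1 h'), by simpa using hEL⟩
  -- Since `E` has a vertex outside `W`, the subdivision `(E, e)` removes no vertex in `W`. This
  -- keeps `a` and the vertices of `A` out of `L`.
  have hLW : ∀ y ∈ W, y ∈ vertices L → {y} ∈ link A K := by
    intro y hyW hyL
    have hye : e ≠ y := fun h' => he (h' ▸ hyW)
    rw [hlink, mem_subd_of_notMem (by simpa using hye), hLc.singleton_mem]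
    refine ⟨fun h' => hEW fun x hx => ?_, hyL⟩
    have := h' hx
    rw [Finset.mem_singleton] at this
    exact this ▸ hyW
  have hAL : ∀ y ∈ A, y ∉ vertices L := by
    intro y hy hyL
    have := ((mem_link hK).1 (hLW y (h.within_A y hy) hyL)).1
    simp [hy] at this
  have haL : a ∉ vertices L := fun h' =>
    ha (hK.singleton_mem.1 (hLW a h.a_mem h').1)
  have hAE : Disjoint A E := Finset.disjoint_left.2 fun x hx hxE => hAL x hx ⟨E, hEL, hxE⟩
  have haE : a ∉ E := fun h' => haL ⟨E, hEL, h'⟩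
  have hEF := h.notMem_F hEW
  have hED := h.notMem_D hEW
  obtain ⟨K', hK', hA', ha', hlink', hEK', e1, e2⟩ := h.exists_notMem (E := E) hK ha
    hA hE hAE (by rwa [hlink]) hED hEF
  rw [hlink] at hlink'
  obtain ⟨hdisj, hAeK⟩ := (mem_link hK').1 (hlink' ▸ heL')
  have hneAe : (A ∪ {e}).Nonempty := h.nonempty.mono Finset.subset_union_left
  have hSE : Disjoint (A ∪ {e}) E := by
    rw [Finset.disjoint_union_left]
    exact ⟨hAE, by simpa using heE⟩
  have hne : ¬(({e} : Finset V) : Set V) ⊆ W := by simpa using he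
  -- Identifies the link of `A ∪ {e}` in `K'` with the join of `∂E` and the link of `E` in `L`.
  have hmem : ∀ C, C ∪ (A ∪ {e}) ∈ K' ↔ ¬E ⊆ C ∧ C \ (A ∪ {e}) ∪ E ∈ L := by
    intro C
    have h1 : C ∪ (A ∪ {e}) = A ∪ insert e (C \ (A ∪ {e})) := by
      ext x
      simp only [Finset.mem_union, Finset.mem_insert, Finset.mem_sdiff, Finset.mem_singleton]
      tauto
    have h2 : C ∪ (A ∪ {e}) ∈ K' ↔ insert e (C \ (A ∪ {e})) ∈ link A K' := by
      rw [mem_link hK', h1]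
      refine ⟨fun h' => ⟨?_, h'⟩, fun h' => h'.2⟩
      rw [Finset.disjoint_insert_right]
      refine ⟨heA, Finset.disjoint_left.2 fun x hx hx' => ?_⟩
      simp [hx] at hx'
    rw [h2, hlink', insert_mem_subd (by simp) heE heL, Finset.subset_sdiff]
    exact and_congr_left fun _ => not_congr ⟨fun h => h.1, fun h => ⟨h, hSE.symm⟩⟩
  have H : ∀ C, C ∪ (A ∪ {e}) ∈ K' ↔ ¬E ⊆ C ∧ C \ E ∪ (A ∪ {e}) ∈ K' := by
    intro C
    rw [hmem, hmem]
    have h1 : ¬E ⊆ C \ E := fun h' => by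
      obtain ⟨x, hx⟩ := hE
      exact (Finset.mem_sdiff.1 (h' hx)).2 hx
    have h2 : (C \ E) \ (A ∪ {e}) ∪ E = C \ (A ∪ {e}) ∪ E := by
      ext x
      simp only [Finset.mem_union, Finset.mem_sdiff]
      tauto
    rw [h2]
    exact ⟨fun h' => ⟨h'.1, h1, h'.2⟩, fun h' => ⟨h'.1, h'.2.2⟩⟩
  obtain ⟨z, hz⟩ := (((h.finite.union (finite_vertices hK')).union E.finite_toSet).union
    (Set.finite_singleton e)).exists_notMem
  simp only [Set.mem_union, Finset.mem_coe, Set.mem_singleton_iff, not_or] at hz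
  obtain ⟨⟨⟨hzW, hzK⟩, hzE⟩, hze⟩ := hz
  have hzA : z ∉ A := fun h' => hzW (h.within_A z h')
  have haz : a ≠ z := fun h' => hzW (h' ▸ h.a_mem)
  have hzF : z ∈ (vertices F)ᶜ := fun h' => hzW (h.vertices_F h')
  have hzD : z ∉ vertices D := fun h' => hzW (h.vertices_D h')
  set M := exchange (A ∪ {e}) E K' with hM
  have hMc : IsComplex M := isComplex_exchange hK' hneAe H
  have hsubM : subd E z M = subd (A ∪ {e}) z K' :=
    subd_exchange hK' hSE hEK' hzK hzE (by simp [hzA, hze]) H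
  have hMv : ∀ x, x ∉ vertices K' → x ∉ E → x ∉ vertices M := by
    rintro x hx hxE ⟨C, ⟨_, h' | ⟨_, h'⟩⟩, hxC⟩
    · exact hx ⟨C, h', hxC⟩
    · exact hx ⟨_, h', by simp [hxC, hxE]⟩
  have haM := hMv a ha' haE
  have hzM := hMv z hzK hzE
  have hAM : A ∈ M := ⟨fun h' => heA (h' (by simp)), Or.inl hA'⟩
  have hlinkM : link A M = L := by
    ext C
    rw [mem_link hMc]
    by_cases heC : e ∈ C
    · refine iff_of_false (fun h' => h'.2.1 ?_) (notMem_of_mem_of_notMem_vertices heL heC)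
      exact Finset.union_subset_union_right (by simpa using heC)
    have h0 : ¬A ∪ {e} ⊆ A ∪ C := fun h' => by
      have : e ∈ A ∪ C := h' (by simp)
      simp [heA, heC] at this
    have h1 : Disjoint A C → (A ∪ C ∈ K' ↔ ¬E ⊆ C ∧ C ∈ L) := by
      intro hd
      have : A ∪ C ∈ K' ↔ C ∈ link A K' := by
        rw [mem_link hK']
        tauto
      rw [this, hlink', mem_subd_of_notMem heC]
    have h2 : E ⊆ A ∪ C ↔ E ⊆ C := ⟨fun h' => hAE.symm.left_le_of_le_sup_left h',
      fun h' => h'.trans Finset.subset_union_right⟩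
    have h3 : Disjoint A C → E ⊆ C → ((A ∪ C) \ E ∪ (A ∪ {e}) ∈ K' ↔ C ∈ L) := by
      intro hd hEC
      rw [hmem]
      have g1 : ¬E ⊆ (A ∪ C) \ E := fun h' => by
        obtain ⟨x, hx⟩ := hE
        exact (Finset.mem_sdiff.1 (h' hx)).2 hx
      have g2 : ((A ∪ C) \ E) \ (A ∪ {e}) ∪ E = C := union_sdiff_sdiff_union hd hEC heC
      rw [g2]
      exact and_iff_right g1
    constructor
    · rintro ⟨hd, -, h' | ⟨h', h''⟩⟩
      · exact ((h1 hd).1 h').2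
      · exact (h3 hd (h2.1 h')).1 h''
    · intro hCL
      have hd : Disjoint A C := Finset.disjoint_left.2 fun x hx hxC => hAL x hx ⟨C, hCL, hxC⟩
      refine ⟨hd, h0, ?_⟩
      by_cases hEC : E ⊆ C
      · exact Or.inr ⟨h2.2 hEC, (h3 hd hEC).2 hCL⟩
      · exact Or.inl ((h1 hd).2 ⟨hEC, hCL⟩)
  have hEM : E ∈ M := by
    have : E ∈ link A M := hlinkM ▸ hEL
    exact this.1
  have hAeF : A ∪ {e} ∉ F := h.notMem_F fun h' => he (h' (by simp))
  have m1 : Eqv F (vertices F)ᶜ K' (subd (A ∪ {e}) z K') :=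
    hK'.eqv_subd hAeK hneAe hzK hAeF hzF
  have m2 : Eqv F (vertices F)ᶜ M (subd (A ∪ {e}) z K') := by
    rw [← hsubM]
    exact hMc.eqv_subd hEM hE hzM hEF hzF
  have m3 := hL M hMc hAM haM hlinkM
  have m4 := (isSubdivision_starAt hK' h.isComplex_D hdisj h.nonempty (by simp) (h.notMem_D hne)
    hAeK haz ha' hzK hzD).eqv (F := F) (N := (vertices F)ᶜ)
    (fun h' => h.a_notMem ⟨_, h', by simp⟩) hzF
  have hAE' : ¬A ⊆ E := fun h' => by
    obtain ⟨x, hx⟩ := h.nonempty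
    exact Finset.disjoint_left.1 hAE hx (h' hx)
  have m5 : Eqv F (vertices F)ᶜ (subd A a M ∪ block A a D)
      (subd A a (subd (A ∪ {e}) z K') ∪ block A a D) := by
    rw [← hsubM, subd_comm hMc hAM hEM haz haM hzM (Or.inl hAE)]
    refine IsSubdivision.eqv (IsSubdivision.union ?_ (isComplex_block h.isComplex_D)
      (notMem_block hED hAE haE) (notMem_vertices_block hzD hzA haz.symm)) hEF hzF
    refine (isComplex_subd hMc h.nonempty).subdivision ?_ hE (notMem_vertices_subd haz.symm hzM)
    rw [mem_subd_of_notMem haE]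
    exact ⟨hAE', hEM⟩
  exact e1.trans (m1.trans (m2.symm.trans (m3.trans (m5.trans (m4.symm.trans e2.symm)))))

/-- The starring of `L` is first rearranged by `exists_subdSteps_eqv_cone`. Starrability is then
traced back from the cone: through moves in both directions at simplexes with a vertex outside `W`,
and then through subdivisions only. -/
theorem StarSetting.starrableLink [Infinite V] (h : StarSetting F D W A a) {v : V}
    (hL : IsComplex L) (hv : v ∉ vertices D) (hE : Eqv D (vertices D)ᶜ L (cone v D)) :
    StarrableLink F D A a L := by
  obtain ⟨w, hw, L', h1, h2⟩ := exists_subdSteps_eqv_cone h.finite hL h.isComplex_D hE hv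
  have hL' : StarrableLink F D A a L' := by
    clear h1
    induction h2 using Relation.ReflTransGen.head_induction_on with
    | refl => exact h.starrableLink_cone hw
    | head hm _ ih =>
      obtain ⟨B, b, hB, hb, h' | h'⟩ := hm
      · exact h.starrableLink_of_subd h' (h.notMem_D hB) hb ih
      · exact h.starrableLink_subd h' hB hb ih
  clear h2 hE hL
  induction h1 using Relation.ReflTransGen.head_induction_on with
  | refl => exact hL'
  | head hm _ ih =>
    obtain ⟨B, hB, ⟨-, rfl⟩ | ⟨b, hb, h'⟩⟩ := hm
    · exact ih
    · exact h.starrableLink_of_subd h' hB hb ih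

end StarLink

theorem isComplex_fullSimplex (A : Finset V) : IsComplex (fullSimplex A) where
  finite := by
    refine A.powerset.finite_toSet.subset fun C hC => ?_
    simp only [Finset.coe_powerset, Set.mem_preimage, Set.mem_powerset_iff, Finset.coe_subset]
    exact hC
  empty_mem := Finset.empty_subset A
  mem_of_subset _ _ h h' := Finset.Subset.trans h' h

theorem isComplex_simplexBoundary {A : Finset V} (hA : A.Nonempty) :
    IsComplex (simplexBoundary A) where
  finite := (isComplex_fullSimplex A).finite.subset fun _ hC => hC.1
  empty_mem := Finset.empty_ssubset.2 hA
  mem_of_subset _ _ h h' := lt_of_le_of_lt h' h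

/-! ### Joins with the boundary of a simplex; balls and spheres -/

section BdJoin

/-- The join `∂A ⋆ M`, for a simplex `A` without vertices in `M`. -/
def bdJoin (A : Finset V) (M : Set (Finset V)) : Set (Finset V) :=
  {C | ¬A ⊆ C ∧ C \ A ∈ M}

variable {A A' B : Finset V} {M N : Set (Finset V)} {b x : V} {k d : ℕ}

theorem mem_bdJoin {C : Finset V} : C ∈ bdJoin A M ↔ ¬A ⊆ C ∧ C \ A ∈ M := Iff.rfl

theorem isComplex_bdJoin (hM : IsComplex M) (hA : A.Nonempty) : IsComplex (bdJoin A M) where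
  finite := by
    refine (hM.finite.biUnion fun B _ => (B ∪ A).powerset.finite_toSet).subset ?_
    rintro C ⟨-, hC⟩
    refine Set.mem_biUnion hC ?_
    simp only [Finset.coe_powerset, Set.mem_preimage, Set.mem_powerset_iff, Finset.coe_subset]
    exact subset_union_iff_sdiff_subset.2 subset_rfl
  empty_mem := ⟨by simpa [Finset.subset_empty] using hA.ne_empty, by simpa using hM.empty_mem⟩
  mem_of_subset _ _ hC h := ⟨fun h' => hC.1 (h'.trans h),
    hM.down hC.2 (Finset.sdiff_subset_sdiff h subset_rfl)⟩

theorem vertices_bdJoin_subset : vertices (bdJoin A M) ⊆ A ∪ vertices M := by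
  rintro x ⟨C, hC, hx⟩
  by_cases hA : x ∈ A
  · exact Or.inl hA
  · exact Or.inr ⟨_, hC.2, by simp [hx, hA]⟩

theorem bdJoin_singleton (hx : x ∉ vertices M) : bdJoin {x} M = M := by
  ext C
  rw [mem_bdJoin, Finset.singleton_subset_iff, Finset.sdiff_singleton_eq_erase]
  by_cases h : x ∈ C
  · exact iff_of_false (fun h' => h'.1 h) (notMem_of_mem_of_notMem_vertices hx h)
  · rw [Finset.erase_eq_of_notMem h]
    tauto

theorem pmap_bdJoin {π : Equiv.Perm V} :
    pmap π (bdJoin A M) = bdJoin (A.map π.toEmbedding) (pmap π M) := by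
  ext C
  have h1 : A ⊆ C.map π.symm.toEmbedding ↔ A.map π.toEmbedding ⊆ C := by
    rw [← Finset.map_subset_map (f := π.toEmbedding), map_map_symm]
  have h3 : (C \ A.map π.toEmbedding).map π.symm.toEmbedding = C.map π.symm.toEmbedding \ A := by
    ext x
    simp only [Finset.mem_map_equiv, Equiv.symm_symm, Finset.mem_sdiff, Equiv.symm_apply_apply]
  rw [mem_pmap, mem_bdJoin, mem_bdJoin, mem_pmap, h1, h3]

/-- Some permutation of `V` carries `A` to `A'` and fixes the vertices of `M`. -/
theorem eqv_bdJoin_of_card_eq [Infinite V] (hM : IsComplex M) (hA : A.Nonempty)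
    (hcard : A.card = A'.card) (hAM : ∀ x ∈ A, x ∉ vertices M) (hAM' : ∀ x ∈ A', x ∉ vertices M) :
    Eqv ∅ Set.univ (bdJoin A M) (bdJoin A' M) := by
  let e := Finset.equivOfCardEq hcard
  let f : V → V := fun x => if h : x ∈ A then e ⟨x, h⟩ else x
  have hf1 : ∀ x (h : x ∈ A), f x = e ⟨x, h⟩ := fun x h => by simp [f, h]
  have hf2 : ∀ x ∉ A, f x = x := fun x h => by simp [f, h]
  have hinj : Set.InjOn f (↑A ∪ vertices M) := by
    intro x hx y hy hxy
    by_cases hxA : x ∈ A <;> by_cases hyA : y ∈ A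
    · rw [hf1 x hxA, hf1 y hyA] at hxy
      have := e.injective (Subtype.ext hxy)
      simpa using this
    · rw [hf1 x hxA, hf2 y hyA] at hxy
      exact absurd (hy.resolve_left hyA) (hxy ▸ hAM' _ (e ⟨x, hxA⟩).2)
    · rw [hf2 x hxA, hf1 y hyA] at hxy
      exact absurd (hx.resolve_left hxA) (hxy ▸ hAM' _ (e ⟨y, hyA⟩).2)
    · rwa [hf2 x hxA, hf2 y hyA] at hxy
  obtain ⟨π, hπ⟩ := exists_perm_eqOn (A.finite_toSet.union (finite_vertices hM)) hinj
  have h1 : A.map π.toEmbedding = A' := by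
    refine Finset.eq_of_subset_of_card_le (fun y hy => ?_) (by simp [hcard])
    simp only [Finset.mem_map, Equiv.coe_toEmbedding] at hy
    obtain ⟨x, hx, rfl⟩ := hy
    rw [hπ x (Or.inl hx), hf1 x hx]
    exact (e ⟨x, hx⟩).2
  have h2 : pmap π M = M := pmap_eq_self fun x hx => by
    rw [hπ x (Or.inr hx), hf2 x fun h => hAM x h hx]
  have := eqv_pmap (isComplex_bdJoin hM hA) π
  rwa [pmap_bdJoin, h1, h2] at this

theorem subd_bdJoin (hAB : Disjoint A B) (hbA : b ∉ A) (hbB : b ∉ B)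
    (hb : b ∉ vertices M) : subd B b (bdJoin A M) = bdJoin A (subd B b M) := by
  have hb' : b ∉ vertices (bdJoin A M) := fun h =>
    (vertices_bdJoin_subset h).elim (fun h => hbA h) hb
  have h1 : ∀ C, B ⊆ C \ A ↔ B ⊆ C := fun C => by
    rw [Finset.subset_sdiff]
    exact and_iff_left hAB.symm
  refine ext_insert b (fun C hC => ?_) (fun C hC => ?_)
  · rw [mem_subd_of_notMem hC, mem_bdJoin, mem_bdJoin, mem_subd_of_notMem (by simp [hC]), h1]
    tauto
  · rw [insert_mem_subd hC hbB hb', mem_bdJoin, mem_bdJoin, Finset.insert_sdiff_of_notMem _ hbA,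
      insert_mem_subd (by simp [hC]) hbB hb, h1, Finset.subset_insert_iff_of_notMem hbA,
      Finset.union_sdiff_distrib, Finset.sdiff_eq_self_of_disjoint hAB.symm]
    have : A ⊆ C ∪ B ↔ A ⊆ C :=
      ⟨fun h => hAB.left_le_of_le_sup_right h, fun h => h.trans Finset.subset_union_left⟩
    rw [this]
    tauto

theorem IsSubdivision.eqv_bdJoin (h : IsSubdivision B b M N) (hA : A.Nonempty)
    (hAM : ∀ x ∈ A, x ∉ vertices M) (hbA : b ∉ A) :
    Eqv ∅ Set.univ (bdJoin A M) (bdJoin A N) := by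
  obtain ⟨hM, hB, hne, hb, rfl⟩ := isSubdivision_iff.1 h
  have hAB : Disjoint A B := Finset.disjoint_left.2 fun x hx hxB => hAM x hx ⟨B, hB, hxB⟩
  rw [← subd_bdJoin hAB hbA (notMem_of_notMem_vertices hb hB) hb]
  refine (isComplex_bdJoin hM hA).eqv_subd ⟨fun h => ?_, ?_⟩ hne (fun h => ?_) (by simp) (by simp)
  · obtain ⟨x, hx⟩ := hA
    exact Finset.disjoint_left.1 hAB hx (h hx)
  · rwa [Finset.sdiff_eq_self_of_disjoint hAB.symm]
  · exact (vertices_bdJoin_subset h).elim (fun h => hbA h) hb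

theorem exists_card_eq_avoid [Infinite V] {S : Set V} (hS : S.Finite) (n : ℕ) :
    ∃ A : Finset V, A.card = n ∧ ∀ x ∈ A, x ∉ S := by
  obtain ⟨A, h1, h2⟩ := hS.infinite_compl.exists_subset_card_eq n
  exact ⟨A, h2, fun x hx => h1 hx⟩

/-- Joining with the boundary of a simplex respects stellar equivalence. -/
theorem Eqv.bdJoin [Infinite V] (hM : IsComplex M) (hA : A.Nonempty)
    (h : Eqv ∅ Set.univ M N) (hcard : A.card = A'.card) (hAM : ∀ x ∈ A, x ∉ vertices M)
    (hAN : ∀ x ∈ A', x ∉ vertices N) :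
    Eqv ∅ Set.univ (bdJoin A M) (StellarTheory.bdJoin A' N) := by
  induction h generalizing A' with
  | refl => exact eqv_bdJoin_of_card_eq hM hA hcard hAM hAN
  | @tail X Y _ hm ih =>
    have hX := hm.isComplex_left
    have hY := hm.isComplex_right
    obtain ⟨B, b, -, -, hs⟩ := hm
    -- The simplex is renamed before each move so that it avoids the vertex which that move
    -- introduces.
    obtain ⟨A'', h1, h2⟩ := exists_card_eq_avoid
      (((finite_vertices hX).union (finite_vertices hY)).union (Set.finite_singleton b)) A'.card
    have h3 : ∀ x ∈ A'', x ∉ vertices X := fun x hx h => h2 x hx (Or.inl (Or.inl h))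
    have h4 : ∀ x ∈ A'', x ∉ vertices Y := fun x hx h => h2 x hx (Or.inl (Or.inr h))
    have h5 : b ∉ A'' := fun h => h2 b h (Or.inr rfl)
    have hA'' : A''.Nonempty := by
      rw [← Finset.card_pos, h1, ← hcard]
      exact hA.card_pos
    refine (ih (hcard.trans h1.symm) h3).trans (Eqv.trans ?_
      (eqv_bdJoin_of_card_eq hY hA'' h1 h4 hAN))
    rcases hs with hs | hs
    · exact hs.eqv_bdJoin hA'' h3 h5
    · exact (hs.eqv_bdJoin hA'' h4 h5).symm

/-- `M` is stellar equivalent to a simplex with `d > 0` vertices. -/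
def IsBall (d : ℕ) (M : Set (Finset V)) : Prop :=
  IsComplex M ∧ ∃ A : Finset V, A.card = d ∧ 0 < d ∧ Eqv ∅ Set.univ M (fullSimplex A)

/-- `M` is stellar equivalent to the boundary of a simplex with `d + 1` vertices. -/
def IsSphere (d : ℕ) (M : Set (Finset V)) : Prop :=
  IsComplex M ∧ ∃ A : Finset V, A.card = d + 1 ∧ Eqv ∅ Set.univ M (simplexBoundary A)

theorem IsBall.congr (h : IsBall d M) (hN : Eqv ∅ Set.univ M N) : IsBall d N := by
  obtain ⟨hM, A, h1, h2, h3⟩ := h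
  exact ⟨hN.isComplex hM, A, h1, h2, hN.symm.trans h3⟩

theorem IsSphere.congr (h : IsSphere d M) (hN : Eqv ∅ Set.univ M N) : IsSphere d N := by
  obtain ⟨hM, A, h1, h3⟩ := h
  exact ⟨hN.isComplex hM, A, h1, hN.symm.trans h3⟩

/-- Writing the simplex `B` as `b ⋆ (B \ b)` turns `∂A ⋆ B` into `b ⋆ ∂A ⋆ (B \ b)`, which is what
starring `A` at `b` makes of the simplex `A ∪ (B \ b)`. -/
theorem bdJoin_fullSimplex (hAB : Disjoint A B) (hb : b ∈ B) :
    bdJoin A (fullSimplex B) = subd A b (fullSimplex (A ∪ B.erase b)) := by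
  have hbA : b ∉ A := fun h => Finset.disjoint_left.1 hAB h hb
  have hbv : b ∉ vertices (fullSimplex (A ∪ B.erase b)) := by
    rintro ⟨C, hC, h⟩
    simpa [hbA] using hC h
  refine ext_insert b (fun C hC => ?_) (fun C hC => ?_)
  · rw [mem_subd_of_notMem hC, mem_bdJoin]
    refine and_congr_right fun _ => ?_
    change C \ A ⊆ B ↔ C ⊆ A ∪ B.erase b
    rw [Finset.union_comm, subset_union_iff_sdiff_subset, Finset.subset_erase]
    exact (and_iff_left (by simp [hC])).symm
  · rw [insert_mem_subd hC hbA hbv, mem_bdJoin, Finset.subset_insert_iff_of_notMem hbA,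
      Finset.insert_sdiff_of_notMem _ hbA]
    refine and_congr_right fun _ => ?_
    change insert b (C \ A) ⊆ B ↔ C ∪ A ⊆ A ∪ B.erase b
    rw [Finset.union_comm A, subset_union_iff_sdiff_subset, Finset.union_sdiff_right,
      Finset.subset_erase, Finset.insert_subset_iff]
    exact ⟨fun h => ⟨h.2, by simp [hC]⟩, fun h => ⟨hb, h.1⟩⟩

theorem bdJoin_simplexBoundary (hAB : Disjoint A B) (hb : b ∈ B) :
    bdJoin A (simplexBoundary B) = subd A b (simplexBoundary (A ∪ B.erase b)) := by
  have hbA : b ∉ A := fun h => Finset.disjoint_left.1 hAB h hb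
  have hbv : b ∉ vertices (simplexBoundary (A ∪ B.erase b)) := by
    rintro ⟨C, hC, h⟩
    simpa [hbA] using hC.1 h
  have hdis : Disjoint A (B.erase b) := hAB.mono_right (Finset.erase_subset _ _)
  refine ext_insert b (fun C hC => ?_) (fun C hC => ?_)
  · rw [mem_subd_of_notMem hC, mem_bdJoin]
    refine and_congr_right fun hAC => ?_
    change C \ A ⊂ B ↔ C ⊂ A ∪ B.erase b
    rw [Finset.ssubset_iff_subset_ne, Finset.ssubset_iff_subset_ne, Finset.union_comm,
      subset_union_iff_sdiff_subset, Finset.subset_erase]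
    have h1 : b ∉ C \ A := by simp [hC]
    constructor
    · rintro ⟨h, -⟩
      refine ⟨⟨h, h1⟩, ?_⟩
      rintro rfl
      exact hAC Finset.subset_union_right
    · rintro ⟨⟨h, -⟩, -⟩
      exact ⟨h, fun h' => h1 (h' ▸ hb)⟩
  · rw [insert_mem_subd hC hbA hbv, mem_bdJoin, Finset.subset_insert_iff_of_notMem hbA,
      Finset.insert_sdiff_of_notMem _ hbA]
    refine and_congr_right fun _ => ?_
    change insert b (C \ A) ⊂ B ↔ C ∪ A ⊂ A ∪ B.erase b
    have hbCA : b ∉ C \ A := by simp [hC]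
    conv_lhs => rw [← Finset.insert_erase hb]
    rw [← Finset.sdiff_union_self_eq_union, Finset.union_comm (C \ A)]
    simp only [ssubset_iff_subset_not_subset]
    rw [Finset.insert_subset_insert_iff hbCA, Finset.insert_subset_insert_iff (by simp)]
    have h1 : ∀ {X Y : Finset V}, Disjoint A X → (A ∪ X ⊆ A ∪ Y ↔ X ⊆ Y) := fun {X Y} hX => by
      constructor
      · intro h
        exact hX.symm.left_le_of_le_sup_left (Finset.subset_union_right.trans h)
      · exact Finset.union_subset_union_right
    rw [h1 Finset.disjoint_sdiff, h1 hdis]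

theorem IsBall.bdJoin [Infinite V] (h : IsBall d M) (hA : A.card = k + 1)
    (hAM : ∀ x ∈ A, x ∉ vertices M) : IsBall (k + d) (bdJoin A M) := by
  obtain ⟨hM, B, h1, h2, h3⟩ := h
  have hAne : A.Nonempty := Finset.card_pos.1 (by omega)
  obtain ⟨A', hA', hA'B⟩ := exists_card_eq_avoid B.finite_toSet A.card
  have hv : ∀ x ∈ A', x ∉ vertices (fullSimplex B) := fun x hx ⟨C, hC, h⟩ => hA'B x hx (hC h)
  obtain ⟨b, hb⟩ : B.Nonempty := Finset.card_pos.1 (by omega)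
  have hdis : Disjoint A' B := Finset.disjoint_left.2 fun x hx h => hA'B x hx h
  have hA'ne : A'.Nonempty := Finset.card_pos.1 (by omega)
  refine ⟨isComplex_bdJoin hM hAne, A' ∪ B.erase b, ?_, by omega,
    (h3.bdJoin hM hAne hA'.symm hAM hv).trans ?_⟩
  · rw [Finset.card_union_of_disjoint (hdis.mono_right (Finset.erase_subset _ _)),
      Finset.card_erase_of_mem hb]
    omega
  · rw [bdJoin_fullSimplex hdis hb]
    refine ((isComplex_fullSimplex _).eqv_subd ?_ hA'ne ?_ (by simp) (by simp)).symm
    · exact Finset.subset_union_left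
    · rintro ⟨C, hC, h⟩
      have := hC h
      simp only [Finset.mem_union, Finset.mem_erase, ne_eq, not_true_eq_false, false_and,
        or_false] at this
      exact hA'B b this hb

theorem IsSphere.bdJoin [Infinite V] (h : IsSphere d M) (hA : A.card = k + 1)
    (hAM : ∀ x ∈ A, x ∉ vertices M) : IsSphere (k + d) (bdJoin A M) := by
  obtain ⟨hM, B, h1, h3⟩ := h
  have hAne : A.Nonempty := Finset.card_pos.1 (by omega)
  obtain ⟨A', hA', hA'B⟩ := exists_card_eq_avoid B.finite_toSet A.card
  have hv : ∀ x ∈ A', x ∉ vertices (simplexBoundary B) :=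
    fun x hx ⟨C, hC, h⟩ => hA'B x hx (hC.1 h)
  obtain ⟨b, hb⟩ : B.Nonempty := Finset.card_pos.1 (by omega)
  have hdis : Disjoint A' B := Finset.disjoint_left.2 fun x hx h => hA'B x hx h
  have hdis' := hdis.mono_right (Finset.erase_subset b B)
  have hA'ne : A'.Nonempty := Finset.card_pos.1 (by omega)
  have hbv : b ∉ vertices (simplexBoundary (A' ∪ B.erase b)) := by
    rintro ⟨C, hC, h⟩
    have := hC.1 h
    simp only [Finset.mem_union, Finset.mem_erase, ne_eq, not_true_eq_false, false_and,
      or_false] at this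
    exact hA'B b this hb
  refine ⟨isComplex_bdJoin hM hAne, A' ∪ B.erase b, ?_,
    (h3.bdJoin hM hAne hA'.symm hAM hv).trans ?_⟩
  · rw [Finset.card_union_of_disjoint hdis', Finset.card_erase_of_mem hb]
    omega
  · have hc := isComplex_simplexBoundary (hA'ne.mono
      (Finset.subset_union_left (s₂ := B.erase b)))
    rw [bdJoin_simplexBoundary hdis hb]
    -- If `B = {b}`, then `A'` is the whole simplex, hence not in its boundary, and there is nothing
    -- to subdivide.
    by_cases hmem : A' ∈ simplexBoundary (A' ∪ B.erase b)
    · exact (hc.eqv_subd hmem hA'ne hbv (by simp) (by simp)).symm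
    · rw [subd_eq_self hc hmem]
      exact Eqv.refl _

end BdJoin

/-! ### Links in balls and spheres -/

section Links

variable {A C D : Finset V} {K L M N : Set (Finset V)} {a : V} {d : ℕ}

/-- The link of a simplex through the new vertex of a stellar subdivision. -/
theorem link_insert_subd (hK : IsComplex K) (hA : A.Nonempty) (ha : a ∉ vertices K)
    (haA : a ∉ A) (haC : a ∉ C) :
    link (insert a C) (subd A a K) = bdJoin (A \ C) (link (C ∪ A) K) := by
  have hc := isComplex_subd (a := a) hK hA
  refine ext_insert a (fun D hD => ?_) (fun D hD => ?_)
  · rw [mem_link hc, Finset.insert_union, insert_mem_subd (by simp [haC, hD]) haA ha, mem_bdJoin,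
      mem_link hK, Finset.disjoint_insert_left, Finset.union_comm C D,
      subset_union_iff_sdiff_subset]
    have h1 : Disjoint (C ∪ A) (D \ (A \ C)) ↔ Disjoint C D := by
      simp only [Finset.disjoint_left, Finset.mem_union, Finset.mem_sdiff]
      exact forall_congr' fun x => by tauto
    have h2 : C ∪ A ∪ D \ (A \ C) = D ∪ C ∪ A := by
      ext x
      simp only [Finset.mem_union, Finset.mem_sdiff]
      tauto
    rw [h1, h2]
    tauto
  · refine iff_of_false (fun h => ?_) (fun h => ?_)
    · have := ((mem_link hc).1 h).1
      simp at this
    · exact notMem_of_mem_of_notMem_vertices ha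
        (C := insert a D \ (A \ C)) (by simp [haA]) h.2.1

theorem link_link {B : Finset V} (hK : IsComplex K) (hA : A ∈ K) (hAB : Disjoint A B) :
    link B (link A K) = link (A ∪ B) K := by
  ext C
  rw [mem_link (isComplex_link hK hA), mem_link hK, mem_link hK, Finset.disjoint_union_left,
    Finset.disjoint_union_right, Finset.union_assoc]
  tauto

/-- The links of all simplexes of `K` belong to the class `P`. -/
def AllLinks (P : ℕ → Set (Finset V) → Prop) (d : ℕ) (K : Set (Finset V)) : Prop :=
  ∀ C ∈ K, ∃ k, C.card + k = d ∧ P k (link C K)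

theorem eqv_subd_of_isComplex (hK : IsComplex K) (hA : A.Nonempty) (ha : a ∉ vertices K) :
    Eqv ∅ Set.univ K (subd A a K) := by
  by_cases h : A ∈ K
  · exact hK.eqv_subd h hA ha (by simp) (by simp)
  · rw [subd_eq_self hK h]
    exact Eqv.refl _

theorem eqv_link_subd (hK : IsComplex K) (hA : A ∈ K) (ha : a ∉ vertices K) (hC : C ∈ K)
    (hAC : ¬A ⊆ C) : Eqv ∅ Set.univ (link C K) (link C (subd A a K)) := by
  have hne : A.Nonempty := by
    rw [Finset.nonempty_iff_ne_empty]
    rintro rfl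
    exact hAC (Finset.empty_subset C)
  rw [link_subd hK hne ha (notMem_of_notMem_vertices ha hA) (notMem_of_notMem_vertices ha hC)]
  refine eqv_subd_of_isComplex (isComplex_link hK hC) ?_ fun ⟨D, hD, h⟩ => ha ⟨D, hD.1, h⟩
  rwa [Finset.sdiff_nonempty]

theorem notMem_vertices_link {x : V} (hx : x ∈ C) : x ∉ vertices (link C K) :=
  fun ⟨_, hD, h⟩ => Finset.disjoint_left.1 hD.2.1 hx h

/-- The link of a surviving simplex is changed at most by a subdivision, which `h1` covers. The link
of `aC` is `∂(A \ C) ⋆ lk(C ∪ A, K)`, which `h2` covers. -/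
theorem allLinks_subd_iff {P : ℕ → Set (Finset V) → Prop}
    (h1 : ∀ {k M N}, P k M → Eqv ∅ Set.univ M N → P k N)
    (h2 : ∀ {k d A M}, P d M → A.card = k + 1 → (∀ x ∈ A, x ∉ vertices M) →
      P (k + d) (bdJoin A M)) (h : IsSubdivision A a K L) :
    AllLinks P d K ↔ AllLinks P d L := by
  obtain ⟨hK, hA, hne, ha, rfl⟩ := isSubdivision_iff.1 h
  have haA := notMem_of_notMem_vertices ha hA
  constructor
  · intro H C hC
    by_cases haC : a ∈ C
    · obtain ⟨C, haC', rfl⟩ : ∃ C', a ∉ C' ∧ C = insert a C' :=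
        ⟨C.erase a, by simp, (Finset.insert_erase haC).symm⟩
      rw [insert_mem_subd haC' haA ha] at hC
      obtain ⟨k, hk, hP⟩ := H _ hC.2
      have hpos : 0 < (A \ C).card := Finset.card_pos.2 (Finset.sdiff_nonempty.2 hC.1)
      obtain ⟨j, hj⟩ : ∃ j, (A \ C).card = j + 1 := ⟨(A \ C).card - 1, by omega⟩
      refine ⟨j + k, ?_, ?_⟩
      · rw [Finset.card_insert_of_notMem haC', ← hk, ← Finset.union_sdiff_self_eq_union,
          Finset.card_union_of_disjoint Finset.disjoint_sdiff]
        omega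
      · rw [link_insert_subd hK hne ha haA haC']
        exact h2 hP hj fun x hx => notMem_vertices_link
          (Finset.mem_union_right _ (Finset.sdiff_subset hx))
    · rw [mem_subd_of_notMem haC] at hC
      obtain ⟨k, hk, hP⟩ := H C hC.2
      exact ⟨k, hk, h1 hP (eqv_link_subd hK hA ha hC.2 hC.1)⟩
  · intro H C hC
    have haC := notMem_of_notMem_vertices ha hC
    by_cases hAC : A ⊆ C
    -- A simplex `C` containing `A` disappears, but its link survives as that of `a (C \ x)`: here
    -- `A \ (C \ x) = {x}`, and joining with `∂{x}` changes nothing.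
    · obtain ⟨x, hx⟩ := hne
      have hxC := hAC hx
      have haCx : a ∉ C.erase x := fun h => haC (Finset.erase_subset _ _ h)
      have hu : C.erase x ∪ A = C := by
        ext y
        have := @hAC y
        simp only [Finset.mem_union, Finset.mem_erase]
        by_cases hyx : y = x
        · subst hyx
          tauto
        · tauto
      have hs : A \ C.erase x = {x} := by
        ext y
        have := @hAC y
        simp only [Finset.mem_sdiff, Finset.mem_erase, Finset.mem_singleton]
        by_cases hyx : y = x
        · subst hyx
          tauto
        · tauto
      obtain ⟨k, hk, hP⟩ := H (insert a (C.erase x)) (by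
        rw [insert_mem_subd haCx haA ha, hu]
        exact ⟨fun h => by simpa using h hx, hC⟩)
      rw [link_insert_subd hK ⟨x, hx⟩ ha haA haCx, hs, hu,
        bdJoin_singleton (notMem_vertices_link hxC)] at hP
      refine ⟨k, ?_, hP⟩
      rw [← hk, Finset.card_insert_of_notMem haCx, Finset.card_erase_add_one hxC]
    · obtain ⟨k, hk, hP⟩ := H C (by
        rw [mem_subd_of_notMem haC]
        exact ⟨hAC, hC⟩)
      exact ⟨k, hk, h1 hP (eqv_link_subd hK hA ha hC hAC).symm⟩

theorem AllLinks.congr {P : ℕ → Set (Finset V) → Prop}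
    (h1 : ∀ {k M N}, P k M → Eqv ∅ Set.univ M N → P k N)
    (h2 : ∀ {k d A M}, P d M → A.card = k + 1 → (∀ x ∈ A, x ∉ vertices M) →
      P (k + d) (bdJoin A M)) (h : AllLinks P d K) (hKL : Eqv ∅ Set.univ K L) :
    AllLinks P d L := by
  induction hKL with
  | refl => exact h
  | tail _ hm ih =>
    obtain ⟨A, a, -, -, hs | hs⟩ := hm
    · exact (allLinks_subd_iff (P := P) (fun h h' => h1 h h') (fun h h' h'' => h2 h h' h'') hs).1 ih
    · exact (allLinks_subd_iff (P := P) (fun h h' => h1 h h') (fun h h' h'' => h2 h h' h'') hs).2 ih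

theorem link_fullSimplex (hC : C ⊆ A) : link C (fullSimplex A) = fullSimplex (A \ C) := by
  ext D
  rw [mem_link (isComplex_fullSimplex A)]
  change Disjoint C D ∧ C ∪ D ⊆ A ↔ D ⊆ A \ C
  rw [Finset.subset_sdiff, Finset.union_subset_iff, disjoint_comm]
  tauto

theorem link_simplexBoundary (hC : C ⊂ A) :
    link C (simplexBoundary A) = simplexBoundary (A \ C) := by
  have hA : A.Nonempty := (Finset.empty_subset C).trans_ssubset hC |> Finset.empty_ssubset.1
  ext D
  rw [mem_link (isComplex_simplexBoundary hA)]
  change Disjoint C D ∧ C ∪ D ⊂ A ↔ D ⊂ A \ C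
  simp only [ssubset_iff_subset_not_subset]
  rw [Finset.subset_sdiff, Finset.union_subset_iff, disjoint_comm, Finset.union_comm,
    subset_union_iff_sdiff_subset]
  have := hC.1
  tauto

theorem IsSphere.allLinks [Infinite V] (h : IsSphere d K) : AllLinks IsSphere d K := by
  obtain ⟨hK, A, hA, hE⟩ := h
  have hbase : AllLinks IsSphere d (simplexBoundary A) := by
    intro C hC
    have hcard := Finset.card_lt_card hC
    refine ⟨d - C.card, by omega, ?_⟩
    rw [link_simplexBoundary hC]
    refine ⟨isComplex_simplexBoundary (Finset.sdiff_nonempty.2 hC.2), A \ C, ?_, Eqv.refl _⟩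
    rw [Finset.card_sdiff_of_subset hC.1]
    omega
  exact hbase.congr (fun h h' => h.congr h') (fun h h' h'' => h.bdJoin h' h'') hE.symm

theorem simplexBoundary_singleton (x : V) : simplexBoundary {x} = fullSimplex ∅ := by
  ext C
  change C ⊂ {x} ↔ C ⊆ ∅
  rw [Finset.ssubset_singleton_iff, Finset.subset_empty]

theorem IsBall.allLinks [Infinite V] (h : IsBall d K) :
    AllLinks (fun k M => IsBall k M ∨ IsSphere k M) d K := by
  obtain ⟨hK, A, hA, hd, hE⟩ := h
  have hbase : AllLinks (fun k M => IsBall k M ∨ IsSphere k M) d (fullSimplex A) := by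
    intro C hC
    have hCA : C ⊆ A := hC
    have hcard := Finset.card_le_card hCA
    have hcard' := Finset.card_sdiff_of_subset hCA
    refine ⟨d - C.card, by omega, ?_⟩
    rw [link_fullSimplex hCA]
    by_cases hne : C.card < d
    · exact Or.inl ⟨isComplex_fullSimplex _, A \ C, by omega, by omega, Eqv.refl _⟩
    -- The link of the top simplex contains only the empty simplex. It is the sphere with `d = 0`,
    -- the boundary of a single vertex.
    · obtain ⟨x⟩ : Nonempty V := inferInstance
      refine Or.inr ⟨isComplex_fullSimplex _, {x}, ?_, ?_⟩
      · rw [Finset.card_singleton]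
        omega
      · rw [simplexBoundary_singleton, Finset.card_eq_zero.1 (show (A \ C).card = 0 by omega)]
        exact Eqv.refl _
  refine hbase.congr ?_ ?_ hE.symm
  · rintro k M N (h | h) h'
    exacts [Or.inl (h.congr h'), Or.inr (h.congr h')]
  · rintro k d A M (h | h) h' h''
    exacts [Or.inl (h.bdJoin h' h''), Or.inr (h.bdJoin h' h'')]

end Links

/-! ### Parity of the number of simplexes -/

section Parity

variable {K L M : Set (Finset V)} {A : Finset V} {a x : V} {d k : ℕ}

theorem ncard_sep_add_ncard_sep_not {α : Type*} {S : Set α} (hS : S.Finite) (p : α → Prop) :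
    {C | C ∈ S ∧ p C}.ncard + {C | C ∈ S ∧ ¬p C}.ncard = S.ncard := by
  rw [← Set.ncard_union_eq _ (hS.subset fun _ h => h.1) (hS.subset fun _ h => h.1)]
  · congr 1
    ext C
    by_cases h : p C <;> simp [h]
  · rw [Set.disjoint_left]
    exact fun C h h' => h'.2 h.2

/-- Adding or removing `x` pairs off the members of `S`. -/
theorem even_ncard_of_insert_mem_iff {S : Set (Finset V)} (hS : S.Finite)
    (h : ∀ C, x ∉ C → (C ∈ S ↔ insert x C ∈ S)) : Even S.ncard := by
  rw [← ncard_sep_add_ncard_sep_not hS fun C => x ∈ C]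
  have himg : {C | C ∈ S ∧ x ∈ C} = (fun C => insert x C) '' {C | C ∈ S ∧ x ∉ C} := by
    ext C
    constructor
    · rintro ⟨hC, hx⟩
      refine ⟨C.erase x, ⟨(h _ (by simp)).2 ?_, by simp⟩, Finset.insert_erase hx⟩
      rwa [Finset.insert_erase hx]
    · rintro ⟨D, ⟨hD, hx⟩, rfl⟩
      exact ⟨(h _ hx).1 hD, by simp⟩
  rw [himg, Set.InjOn.ncard_image]
  · exact ⟨_, rfl⟩
  · intro C hC D hD hCD
    have := congrArg (fun E => Finset.erase E x) hCD
    simpa [Finset.erase_insert hC.2, Finset.erase_insert hD.2] using this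

/-- The number of `C` with `C ∪ A ∈ K` is even, since a vertex of `A` may be added or removed
freely. Those containing `A` are the simplexes removed, and the others, joined to `a`, are the
simplexes added. -/
theorem IsSubdivision.even_ncard_iff (h : IsSubdivision A a K L) :
    Even K.ncard ↔ Even L.ncard := by
  have hL := h.right
  obtain ⟨hK, hA, hne, ha, rfl⟩ := isSubdivision_iff.1 h
  have haA := notMem_of_notMem_vertices ha hA
  set G : Set (Finset V) := {C | C ∪ A ∈ K} with hG
  have hGfin : G.Finite := hK.finite.subset fun C hC => hK.down hC Finset.subset_union_left
  have hGa : ∀ C ∈ G, a ∉ C := fun C hC hC' =>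
    notMem_of_notMem_vertices ha hC (Finset.mem_union_left _ hC')
  have hGeven : Even G.ncard := by
    obtain ⟨x, hx⟩ := hne
    refine even_ncard_of_insert_mem_iff (x := x) hGfin fun C _ => ?_
    change C ∪ A ∈ K ↔ insert x C ∪ A ∈ K
    rw [Finset.insert_union, Finset.insert_eq_of_mem (Finset.mem_union_right _ hx)]
  have h1 : {C | C ∈ G ∧ A ⊆ C} = {C | C ∈ K ∧ A ⊆ C} := by
    ext C
    refine and_congr_left fun hC => ?_
    change C ∪ A ∈ K ↔ C ∈ K
    rw [Finset.union_eq_left.2 hC]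
  have h2 : {C | C ∈ subd A a K ∧ a ∈ C} = (fun C => insert a C) '' {C | C ∈ G ∧ ¬A ⊆ C} := by
    ext C
    constructor
    · rintro ⟨hC, hx⟩
      rw [← Finset.insert_erase hx, insert_mem_subd (by simp) haA ha] at hC
      exact ⟨C.erase a, ⟨hC.2, hC.1⟩, Finset.insert_erase hx⟩
    · rintro ⟨D, ⟨hD, hx⟩, rfl⟩
      exact ⟨(insert_mem_subd (hGa D hD) haA ha).2 ⟨hx, hD⟩, by simp⟩
  have h3 : {C | C ∈ subd A a K ∧ ¬a ∈ C} = {C | C ∈ K ∧ ¬A ⊆ C} := by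
    ext C
    constructor
    · rintro ⟨hC, hx⟩
      rw [mem_subd_of_notMem hx] at hC
      exact ⟨hC.2, hC.1⟩
    · rintro ⟨hC, hx⟩
      have haC := notMem_of_notMem_vertices ha hC
      exact ⟨(mem_subd_of_notMem haC).2 ⟨hx, hC⟩, haC⟩
  have h2' : {C | C ∈ subd A a K ∧ a ∈ C}.ncard = {C | C ∈ G ∧ ¬A ⊆ C}.ncard := by
    rw [h2, Set.InjOn.ncard_image]
    intro C hC D hD hCD
    have := congrArg (fun E => Finset.erase E a) hCD
    simpa [Finset.erase_insert (hGa C hC.1), Finset.erase_insert (hGa D hD.1)] using this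
  have e1 := ncard_sep_add_ncard_sep_not hGfin fun C => A ⊆ C
  have e2 := ncard_sep_add_ncard_sep_not hK.finite fun C => A ⊆ C
  have e3 := ncard_sep_add_ncard_sep_not hL.finite fun C => a ∈ C
  rw [h1] at e1
  rw [h2', h3] at e3
  rw [← e1, Nat.even_add] at hGeven
  rw [← e2, ← e3, Nat.even_add, Nat.even_add, hGeven]

theorem Eqv.even_ncard_iff {F : Set (Finset V)} {N : Set V} (h : Eqv F N K L) :
    Even K.ncard ↔ Even L.ncard := by
  induction h with
  | refl => rfl
  | tail _ hm ih =>
    obtain ⟨A, a, -, -, hs | hs⟩ := hm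
    · exact ih.trans hs.even_ncard_iff
    · exact ih.trans hs.even_ncard_iff.symm

theorem even_ncard_fullSimplex (hA : A.Nonempty) : Even (fullSimplex A).ncard := by
  obtain ⟨x, hx⟩ := hA
  refine even_ncard_of_insert_mem_iff (x := x) (isComplex_fullSimplex A).finite fun C _ => ?_
  change C ⊆ A ↔ insert x C ⊆ A
  simp [Finset.insert_subset_iff, hx]

theorem not_even_ncard_simplexBoundary (hA : A.Nonempty) :
    ¬Even (simplexBoundary A).ncard := by
  have h : simplexBoundary A = fullSimplex A \ {A} := by
    ext C
    exact Finset.ssubset_iff_subset_ne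
  have h' := Set.ncard_sdiff_singleton_add_one (Finset.Subset.refl A : A ∈ fullSimplex A)
    (isComplex_fullSimplex A).finite
  have h'' := even_ncard_fullSimplex hA
  rwa [← h', ← h, Nat.even_add_one] at h''

theorem IsBall.even_ncard (h : IsBall d K) : Even K.ncard := by
  obtain ⟨-, A, hA, hd, hE⟩ := h
  exact hE.even_ncard_iff.2 (even_ncard_fullSimplex (Finset.card_pos.1 (by omega)))

theorem IsSphere.not_even_ncard (h : IsSphere d K) : ¬Even K.ncard := by
  obtain ⟨-, A, hA, hE⟩ := h
  rw [hE.even_ncard_iff]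
  exact not_even_ncard_simplexBoundary (Finset.card_pos.1 (by omega))

end Parity

/-! ### The boundary of a ball -/

section Boundary

variable [Infinite V] {K L M : Set (Finset V)} {A B C E : Finset V} {a x : V} {d k n : ℕ}

theorem isStellarBall_iff_isBall : IsStellarBall n K ↔ IsBall (n + 1) K := by
  constructor
  · rintro ⟨hK, A, hA, h⟩
    exact ⟨hK, A, hA, Nat.succ_pos n, h.eqv hK⟩
  · rintro ⟨hK, A, hA, -, h⟩
    exact ⟨hK, A, hA, h.stellarEquiv⟩

theorem IsBall.exists_isBall_link (hK : IsBall d K) (hC : C ∈ boundary K) :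
    ∃ k, C.card + k = d ∧ IsBall k (link C K) := by
  obtain ⟨hCK, m, hm⟩ := hC
  obtain ⟨k, hk, h | h⟩ := hK.allLinks C hCK
  · exact ⟨k, hk, h⟩
  · exact absurd (isStellarBall_iff_isBall.1 hm).even_ncard h.not_even_ncard

/-- Each link is a ball or a sphere, and parity decides which. -/
theorem IsBall.mem_boundary (hK : IsBall d K) :
    C ∈ boundary K ↔ C ∈ K ∧ Even (link C K).ncard := by
  constructor
  · rintro ⟨hCK, m, hm⟩
    exact ⟨hCK, (isStellarBall_iff_isBall.1 hm).even_ncard⟩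
  · rintro ⟨hCK, he⟩
    obtain ⟨k, hk, h | h⟩ := hK.allLinks C hCK
    · obtain ⟨j, rfl⟩ : ∃ j, k = j + 1 := by
        obtain ⟨-, -, -, h, -⟩ := h
        exact ⟨k - 1, by omega⟩
      exact ⟨hCK, j, isStellarBall_iff_isBall.2 h⟩
    · exact absurd he h.not_even_ncard

theorem IsBall.isSphere_link (hK : IsBall d K) (hC : C ∈ K) (hC' : C ∉ boundary K) :
    ∃ k, C.card + k = d ∧ IsSphere k (link C K) := by
  obtain ⟨k, hk, h | h⟩ := hK.allLinks C hC
  · exact absurd (hK.mem_boundary.2 ⟨hC, h.even_ncard⟩) hC'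
  · exact ⟨k, hk, h⟩

theorem boundary_subset : boundary K ⊆ K := fun _ h => h.1

theorem link_empty (hK : IsComplex K) : link ∅ K = K := by
  ext C
  rw [mem_link hK]
  simp

/-- The link of an interior simplex is a sphere, and all links in a sphere are spheres. So every
simplex with an interior face is interior. -/
theorem IsBall.isComplex_boundary (hK : IsBall d K) : IsComplex (boundary K) where
  finite := hK.1.finite.subset boundary_subset
  empty_mem := by
    rw [hK.mem_boundary, link_empty hK.1]
    exact ⟨hK.1.empty_mem, hK.even_ncard⟩
  mem_of_subset A B hB hAB := by
    by_contra hA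
    have hAK := hK.1.down hB.1 hAB
    obtain ⟨k, -, h⟩ := hK.isSphere_link hAK hA
    have hmem : B \ A ∈ link A K := by
      rw [mem_link hK.1, Finset.union_sdiff_of_subset hAB]
      exact ⟨Finset.disjoint_sdiff, hB.1⟩
    obtain ⟨j, -, h'⟩ := h.allLinks _ hmem
    rw [link_link hK.1 hAK Finset.disjoint_sdiff, Finset.union_sdiff_of_subset hAB] at h'
    exact h'.not_even_ncard (hK.mem_boundary.1 hB).2

/-- Old links keep their parity. A new link is the join of some `∂(A \ C)` with an old link, and
such a join is again a ball or a sphere, as the old link was. The formula also covers interior `A`,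
where the right-hand side is unchanged. -/
theorem IsBall.boundary_subd (hK : IsBall d K) (hA : A ∈ K) (hne : A.Nonempty)
    (ha : a ∉ vertices K) : boundary (subd A a K) = subd A a (boundary K) := by
  have hL : IsBall d (subd A a K) := hK.congr (hK.1.eqv_subd hA hne ha (by simp) (by simp))
  have haA := notMem_of_notMem_vertices ha hA
  have ha' : a ∉ vertices (boundary K) := fun ⟨C, hC, h⟩ => ha ⟨C, hC.1, h⟩
  refine ext_insert a (fun C hC => ?_) (fun C hC => ?_)
  · rw [hL.mem_boundary, mem_subd_of_notMem hC, mem_subd_of_notMem hC, hK.mem_boundary, and_assoc]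
    exact and_congr_right fun h1 => and_congr_right fun h2 =>
      (eqv_link_subd hK.1 hA ha h2 h1).even_ncard_iff.symm
  · rw [hL.mem_boundary, insert_mem_subd hC haA ha, insert_mem_subd hC haA ha', hK.mem_boundary,
      and_assoc]
    refine and_congr_right fun h1 => and_congr_right fun h2 => ?_
    rw [link_insert_subd hK.1 hne ha haA hC]
    have hpos : 0 < (A \ C).card := Finset.card_pos.2 (Finset.sdiff_nonempty.2 h1)
    obtain ⟨j, hj⟩ : ∃ j, (A \ C).card = j + 1 := ⟨(A \ C).card - 1, by omega⟩
    have hv : ∀ x ∈ A \ C, x ∉ vertices (link (C ∪ A) K) := fun x hx =>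
      notMem_vertices_link (Finset.mem_union_right _ (Finset.sdiff_subset hx))
    obtain ⟨k, hk, h | h⟩ := hK.allLinks _ h2
    · exact iff_of_true (h.bdJoin hj hv).even_ncard h.even_ncard
    · exact iff_of_false (h.bdJoin hj hv).not_even_ncard h.not_even_ncard

theorem isBall_fullSimplex (hA : A.Nonempty) : IsBall A.card (fullSimplex A) :=
  ⟨isComplex_fullSimplex A, A, rfl, hA.card_pos, Eqv.refl _⟩

theorem boundary_fullSimplex (hA : A.Nonempty) : boundary (fullSimplex A) = simplexBoundary A := by
  ext C
  rw [(isBall_fullSimplex hA).mem_boundary]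
  constructor
  · rintro ⟨hC, he⟩
    refine Finset.ssubset_iff_subset_ne.2 ⟨hC, ?_⟩
    rintro rfl
    rw [link_fullSimplex (Finset.Subset.refl C), Finset.sdiff_self] at he
    have : fullSimplex (∅ : Finset V) = {∅} := by
      ext C
      exact Finset.subset_empty
    rw [this, Set.ncard_singleton] at he
    exact absurd he (by decide)
  · intro hC
    refine ⟨hC.1, ?_⟩
    rw [link_fullSimplex hC.1]
    exact even_ncard_fullSimplex (Finset.sdiff_nonempty.2 hC.2)

theorem IsBall.mem_boundary_link (hK : IsBall d K) (hA : A ∈ K) (hL : IsBall k (link A K))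
    (hAE : Disjoint A E) : E ∈ boundary (link A K) ↔ A ∪ E ∈ boundary K := by
  rw [hL.mem_boundary, hK.mem_boundary, link_link hK.1 hA hAE, mem_link hK.1]
  exact ⟨fun h => ⟨h.1.2, h.2⟩, fun h => ⟨⟨hAE, h.1⟩, h.2⟩⟩

end Boundary

/-! ### Cones -/

section Cone

variable {F K : Set (Finset V)} {A C : Finset V} {a v : V}

theorem vertices_cone_subset (hF : IsComplex F) : vertices (cone v F) ⊆ insert v (vertices F) := by
  rintro x ⟨C, hC, hx⟩
  by_cases hxv : x = v
  · exact Or.inl hxv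
  · exact Or.inr ⟨_, (mem_cone hF).1 hC, by simp [hxv, hx]⟩

theorem isComplex_cone (hF : IsComplex F) : IsComplex (cone v F) where
  finite := by
    refine (hF.finite.biUnion fun B _ => (insert v B).powerset.finite_toSet).subset ?_
    intro C hC
    refine Set.mem_biUnion ((mem_cone hF).1 hC) ?_
    simp only [Finset.coe_powerset, Set.mem_preimage, Set.mem_powerset_iff, Finset.coe_subset]
    exact Finset.subset_insert_iff.2 subset_rfl
  empty_mem := by
    rw [mem_cone hF]
    exact hF.empty_mem
  mem_of_subset B C hC h := by
    rw [mem_cone hF] at *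
    exact hF.down hC (Finset.erase_subset_erase _ h)

theorem mem_cone_of_notMem (hF : IsComplex F) (hC : v ∉ C) : C ∈ cone v F ↔ C ∈ F := by
  rw [mem_cone hF, Finset.erase_eq_of_notMem hC]

theorem insert_mem_cone (hF : IsComplex F) (hC : v ∉ C) : insert v C ∈ cone v F ↔ C ∈ F := by
  rw [mem_cone hF, Finset.erase_insert hC]

theorem subd_cone (hF : IsComplex F) (hne : A.Nonempty) (hvA : v ∉ A) (hva : v ≠ a) :
    subd A a (cone v F) = cone v (subd A a F) := by
  have hsub : ∀ C : Finset V, A ⊆ C.erase v ↔ A ⊆ C := fun C => by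
    rw [Finset.subset_erase]
    exact and_iff_left hvA
  ext C
  rw [mem_cone (isComplex_subd hF hne)]
  change ¬A ⊆ C ∧ (C ∈ cone v F ∨ (a ∈ C ∧ C.erase a ∪ A ∈ cone v F)) ↔
    ¬A ⊆ C.erase v ∧ (C.erase v ∈ F ∨ (a ∈ C.erase v ∧ (C.erase v).erase a ∪ A ∈ F))
  rw [hsub, mem_cone hF, mem_cone hF, Finset.erase_union_distrib, Finset.erase_eq_of_notMem hvA,
    Finset.erase_right_comm, Finset.mem_erase]
  simp only [ne_eq, hva.symm, not_false_eq_true, true_and]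

theorem link_cone (hF : IsComplex F) (hA : A ∈ F) (hvA : v ∉ A) :
    link A (cone v F) = cone v (link A F) := by
  ext C
  rw [mem_link (isComplex_cone hF), mem_cone hF, mem_cone (isComplex_link hF hA), mem_link hF,
    Finset.erase_union_distrib, Finset.erase_eq_of_notMem hvA]
  refine and_congr_left fun _ => ?_
  rw [← Finset.disjoint_erase_comm, Finset.erase_eq_of_notMem hvA]

end Cone

/-! ### Keeping a vertex out of an equivalence -/

section Avoid

variable {F K J : Set (Finset V)} {N : Set V} {a : V}

theorem Eqv.exists_finite_vertices (h : Eqv F N K J) :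
    ∃ U : Set V, U.Finite ∧
      Relation.ReflTransGen (fun X Y => Move F N X Y ∧ vertices X ⊆ U ∧ vertices Y ⊆ U) K J := by
  induction h with
  | refl => exact ⟨∅, Set.finite_empty, .refl⟩
  | @tail X Y _ hm ih =>
    obtain ⟨U, hU, h⟩ := ih
    refine ⟨U ∪ (vertices X ∪ vertices Y), hU.union ((finite_vertices hm.isComplex_left).union
      (finite_vertices hm.isComplex_right)), Relation.ReflTransGen.tail ?_
      ⟨hm, fun x hx => Or.inr (Or.inl hx), fun x hx => Or.inr (Or.inr hx)⟩⟩
    exact Relation.ReflTransGen.mono (fun _ _ h => ⟨h.1, h.2.1.trans Set.subset_union_left,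
      h.2.2.trans Set.subset_union_left⟩) _ _ h

/-- An equivalence can be rerouted so that the vertex `a` never occurs. -/
theorem Eqv.avoid [Infinite V] (hK : IsComplex K) (hF : (vertices F).Finite)
    (h : Eqv F (vertices F)ᶜ K J) (haF : a ∉ vertices F)
    (haK : a ∉ vertices K) (haJ : a ∉ vertices J) :
    Relation.ReflTransGen
      (fun X Y => Move F (vertices F)ᶜ X Y ∧ a ∉ vertices X ∧ a ∉ vertices Y) K J := by
  have hJ := h.isComplex hK
  obtain ⟨U, hU, h⟩ := h.exists_finite_vertices
  -- Choose `b` outside the chain and `F`. Transposing `a` and `b` throughout the chain preserves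
  -- both ends and `F`, and removes `a` from every stage.
  obtain ⟨b, hb⟩ := (((hU.union hF).union (finite_vertices hK)).union
    (finite_vertices hJ)).exists_notMem
  simp only [Set.mem_union, not_or] at hb
  obtain ⟨⟨⟨hbU, hbF⟩, hbK⟩, hbJ⟩ := hb
  have fix : ∀ {X : Set (Finset V)}, a ∉ vertices X → b ∉ vertices X →
      pmap (Equiv.swap a b) X = X := by
    intro X h1 h2
    refine pmap_eq_self fun x hx => Equiv.swap_apply_of_ne_of_ne ?_ ?_
    · rintro rfl; exact h1 hx
    · rintro rfl; exact h2 hx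
  have hnot : ∀ {X : Set (Finset V)}, b ∉ vertices X →
      a ∉ vertices (pmap (Equiv.swap a b) X) := by
    intro X hX
    rw [vertices_pmap]
    rintro ⟨x, hx, hxa⟩
    rw [Equiv.swap_apply_eq_iff, Equiv.swap_apply_left] at hxa
    exact hX (hxa ▸ hx)
  rw [← fix haK hbK, ← fix haJ hbJ]
  refine Relation.ReflTransGen.lift (pmap (Equiv.swap a b)) ?_ _ _ h
  rintro X Y ⟨⟨B, x, hB, hx, hs⟩, h1, h2⟩
  refine ⟨⟨B.map (Equiv.swap a b).toEmbedding, Equiv.swap a b x, ?_, ?_,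
    hs.imp IsSubdivision.map_perm IsSubdivision.map_perm⟩,
    hnot fun h' => hbU (h1 h'), hnot fun h' => hbU (h2 h')⟩
  · rw [← fix haF hbF, map_mem_pmap]
    exact hB
  · intro h'
    rw [← fix haF hbF, vertices_pmap, (Equiv.injective _).mem_set_image] at h'
    exact hx h'

end Avoid

/-! ### Starring -/

section Starred

variable [Infinite V] {F K L : Set (Finset V)} {A : Finset V} {a v : V} {d : ℕ}

/-- `K` can be changed to a cone on `F` by moves that do not affect `F`. -/
def Starred (F K : Set (Finset V)) : Prop :=
  ∃ v, v ∉ vertices F ∧ Eqv F (vertices F)ᶜ K (cone v F)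

/-- The apex `w` is not in `F`, so renaming it by a subdivision at `{w}` is admissible. -/
theorem Starred.eqv_cone (h : Starred F K) (hF : IsComplex F) (hv : v ∉ vertices F) :
    Eqv F (vertices F)ᶜ K (cone v F) := by
  obtain ⟨w, hw, h⟩ := h
  by_cases hwv : w = v
  · exact hwv ▸ h
  have hvc : v ∉ vertices (cone w F) := fun h' => by
    rcases vertices_cone_subset hF h' with h' | h'
    exacts [hwv h'.symm, hv h']
  have hs : subd {w} v (cone w F) = cone v F := by
    rw [subd_singleton hvc hwv, pmap_cone hF, Equiv.swap_apply_left]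
    congr 1
    refine pmap_eq_self fun x hx => Equiv.swap_apply_of_ne_of_ne ?_ ?_
    · rintro rfl; exact hw hx
    · rintro rfl; exact hv hx
  have h1 := (isComplex_cone (v := w) hF).eqv_subd (A := {w}) (F := F) (N := (vertices F)ᶜ)
    (by rw [mem_cone hF]; simpa using hF.empty_mem) (by simp) hvc (fun h' => hw ⟨_, h', by simp⟩) hv
  rw [hs] at h1
  exact h.trans h1

theorem starred_fullSimplex (hA : A.Nonempty) : Starred (simplexBoundary A) (fullSimplex A) := by
  obtain ⟨v, hv⟩ := A.finite_toSet.exists_notMem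
  have hvA : v ∉ A := hv
  have hvf : v ∉ vertices (fullSimplex A) := fun ⟨C, hC, h⟩ => hvA (hC h)
  have hvb : v ∉ vertices (simplexBoundary A) := fun ⟨C, hC, h⟩ => hvA (hC.1 h)
  have hF := isComplex_simplexBoundary hA
  have hs : subd A v (fullSimplex A) = cone v (simplexBoundary A) := by
    refine ext_insert v (fun C hC => ?_) (fun C hC => ?_)
    · rw [mem_subd_of_notMem hC, mem_cone_of_notMem hF hC]
      exact and_comm
    · rw [insert_mem_subd hC hvA hvf, insert_mem_cone hF hC]
      change ¬A ⊆ C ∧ C ∪ A ⊆ A ↔ C ⊆ A ∧ ¬A ⊆ C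
      rw [Finset.union_subset_iff, and_iff_left (Finset.Subset.refl A), and_comm]
  refine ⟨v, hvb, ?_⟩
  rw [← hs]
  exact (isComplex_fullSimplex A).eqv_subd (Finset.Subset.refl A) hA hvf
    (fun h => h.2 (Finset.Subset.refl A)) hvb

/-- The subdivision `(A, a)` is applied to all complexes in a starring of `K` that avoids `a`. It
turns the final cone into a cone on the subdivided `F`. -/
theorem Starred.subd (hK : IsComplex K) (hF : IsComplex F) (hFK : F ⊆ K) (hA : A ∈ F)
    (hne : A.Nonempty) (ha : a ∉ vertices K) (h : Starred F K) :
    Starred (subd A a F) (subd A a K) := by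
  have haF : a ∉ vertices F := fun ⟨C, hC, h⟩ => ha ⟨C, hFK hC, h⟩
  have haA := notMem_of_notMem_vertices haF hA
  obtain ⟨v, hv⟩ := ((finite_vertices hF).insert a).exists_notMem
  simp only [Set.mem_insert_iff, not_or] at hv
  obtain ⟨hva, hvF⟩ := hv
  have hvA := notMem_of_notMem_vertices hvF hA
  have hac : a ∉ vertices (cone v F) := fun h' => by
    rcases vertices_cone_subset hF h' with h' | h'
    exacts [hva h'.symm, haF h']
  have hch := (h.eqv_cone hF hvF).avoid hK (finite_vertices hF) haF ha hac
  refine ⟨v, notMem_vertices_subd hva hvF, ?_⟩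
  rw [← subd_cone hF hne hvA hva]
  set G := StellarTheory.subd A a F with hG
  have hNfin : (vertices G)ᶜᶜ.Finite := by
    rw [compl_compl]
    exact finite_vertices (isComplex_subd hF hne)
  -- Since `B ∉ F` is not a face of `A` and `b` is not a vertex of `A`, the move preserves the
  -- presence or absence of `A`. The simplexes used in carrying the move across `(A, a)` lie outside
  -- `G` because `B ∉ F` and `b ∉ vertices F`.
  have key : ∀ {X Y : Set (Finset V)} {B : Finset V} {b : V}, B ∉ F → b ∈ (vertices F)ᶜ →
      IsSubdivision B b X Y → a ∉ vertices X → a ∉ vertices Y →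
      (A ∈ X ↔ A ∈ Y) ∧ (A ∈ X → Eqv G (vertices G)ᶜ (StellarTheory.subd A a X)
        (StellarTheory.subd A a Y)) := by
    intro X Y B b hB hb hs haX haY
    obtain ⟨hX, hBX, hBne, hbX, rfl⟩ := isSubdivision_iff.1 hs
    have hbA : b ∉ A := notMem_of_notMem_vertices hb hA
    have hbB := notMem_of_notMem_vertices hbX hBX
    have haB := notMem_of_notMem_vertices haX hBX
    have hBA : ¬B ⊆ A := fun h' => hB (hF.down hA h')
    have hab : a ≠ b := by
      rintro rfl
      refine haY ⟨insert a ∅, ?_, by simp⟩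
      rw [insert_mem_subd (by simp) hbB hbX, Finset.empty_union, Finset.subset_empty]
      exact ⟨hBne.ne_empty, hBX⟩
    have hbG : b ∉ vertices G := notMem_vertices_subd hab.symm hb
    refine ⟨?_, fun hAX => ?_⟩
    · rw [mem_subd_of_notMem hbA]
      exact (and_iff_right hBA).symm
    · refine eqv_subd_subd_of_move hX hAX hBX hne hBne hBA hab haX hbX ?_ ?_ ?_ hbG hNfin
      · rw [hG, mem_subd_of_notMem haB]
        exact fun h' => hB h'.2
      · rw [hG, insert_mem_subd (by simp [haB]) haA haF]
        refine fun h' => hB (hF.down h'.2 ?_)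
        rw [Finset.sdiff_union_self_eq_union]
        exact Finset.subset_union_left
      · exact fun h' => hbG ⟨_, h', by simp⟩
  have hfinal : ∀ Y, Relation.ReflTransGen
      (fun X Y => Move F (vertices F)ᶜ X Y ∧ a ∉ vertices X ∧ a ∉ vertices Y) K Y →
      A ∈ Y ∧ Eqv G (vertices G)ᶜ (StellarTheory.subd A a K) (StellarTheory.subd A a Y) := by
    intro Y hY
    induction hY with
    | refl => exact ⟨hFK hA, Eqv.refl _⟩
    | tail _ hm ih =>
      obtain ⟨⟨B, b, hB, hb, hs | hs⟩, h1, h2⟩ := hm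
      · obtain ⟨k1, k2⟩ := key hB hb hs h1 h2
        exact ⟨k1.1 ih.1, ih.2.trans (k2 ih.1)⟩
      · obtain ⟨k1, k2⟩ := key hB hb hs h2 h1
        exact ⟨k1.2 ih.1, ih.2.trans (k2 (k1.2 ih.1)).symm⟩
  exact (hfinal _ hch).2

/-- The connecting chain runs through `(A, a)K ∪ X` and `w ⋆ G ∪ X`, where `X` is the block `aA ⋆
lk(A, F)`. The delicate point is that the starring of `(A, a)K` must never touch a simplex of `X`.
-/
theorem Starred.of_subd (hK : IsComplex K) (hF : IsComplex F) (hFK : F ⊆ K) (hA : A ∈ F)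
    (hne : A.Nonempty) (ha : a ∉ vertices K) (hL : Starred (link A F) (link A K))
    (h : Starred (StellarTheory.subd A a F) (StellarTheory.subd A a K)) : Starred F K := by
  have haF : a ∉ vertices F := fun ⟨C, hC, h⟩ => ha ⟨C, hFK hC, h⟩
  have haA := notMem_of_notMem_vertices haF hA
  have hD := isComplex_link hF hA
  set G := StellarTheory.subd A a F with hG
  set W := insert a (vertices F) with hWdef
  have hW : W.Finite := (finite_vertices hF).insert a
  have hAW : ∀ x ∈ A, x ∈ W := fun x hx => Or.inr ⟨A, hA, hx⟩
  have hDF : vertices (link A F) ⊆ vertices F := fun x ⟨C, hC, hx⟩ => ⟨C, hC.1, hx⟩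
  have hset : StarSetting F (link A F) W A a :=
    { isComplex_D := hD
      finite := hW
      vertices_F := Set.subset_insert _ _
      vertices_D := hDF.trans (Set.subset_insert _ _)
      within_A := hAW
      a_mem := Set.mem_insert _ _
      a_notMem := haF
      nonempty := hne
      mem_D := fun E h1 h2 => (mem_link hF).2 ⟨h1, h2⟩ }
  obtain ⟨v, hv, hLv⟩ := hL
  have e1 := hset.starrableLink (isComplex_link hK (hFK hA)) hv hLv K hK (hFK hA) ha rfl
  have hGc : IsComplex G := isComplex_subd hF hne
  obtain ⟨u, hu, hGu⟩ := h
  obtain ⟨w, hw, M, hM, hMw⟩ := exists_subdSteps_eqv_cone hW (isComplex_subd hK hne) hGc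
    hGu hu
  have hwF : w ∉ vertices F := fun h' => hw (Or.inr h')
  have hwa : w ≠ a := fun h' => hw (Or.inl h')
  have hwA : w ∉ A := fun h' => hw (hAW w h')
  set X := block A a (link A F) with hX
  have hXc : IsComplex X := isComplex_block hD
  have hXv : ∀ {e}, e ∉ W → e ∉ vertices X := fun he =>
    notMem_vertices_block (fun h' => he (Or.inr (hDF h'))) (fun h' => he (hAW _ h'))
      fun h' => he (Or.inl h')
  -- Hence a simplex outside `G` can belong to `X` only if it contains `A`.
  have hXG : ∀ {E}, ¬A ⊆ E → E ∈ X → E ∈ G := by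
    intro E hAE hE
    have h1 : A ∪ E \ insert a A ∈ F := ((mem_link hF).1 hE).2
    refine ⟨hAE, ?_⟩
    by_cases haE : a ∈ E
    · refine Or.inr ⟨haE, hF.down h1 fun x => ?_⟩
      simp only [Finset.mem_union, Finset.mem_erase, Finset.mem_sdiff, Finset.mem_insert]
      tauto
    · refine Or.inl (hF.down h1 fun x hx => ?_)
      have : x ≠ a := fun h' => haE (h' ▸ hx)
      simp only [Finset.mem_union, Finset.mem_sdiff, Finset.mem_insert]
      tauto
  -- Subdivisions never bring `A` back, so the simplexes being subdivided do not contain `A` and lie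
  -- outside `X`.
  have e2 : A ∉ M ∧ Eqv F (vertices F)ᶜ (StellarTheory.subd A a K ∪ X) (M ∪ X) := by
    clear hMw
    induction hM with
    | refl => exact ⟨fun h' => h'.1 (Finset.Subset.refl A), Eqv.refl _⟩
    | @tail Y Z hY hm ih =>
      obtain ⟨ih1, ih2⟩ := ih
      obtain ⟨E, hE, ⟨-, rfl⟩ | ⟨e, he, hs⟩⟩ := hm
      · exact ⟨ih1, ih2⟩
      · have hAY := ih1
        obtain ⟨hYc, hEY, hEne, heY, rfl⟩ := isSubdivision_iff.1 hs
        have hAE : ¬A ⊆ E := fun h' => hAY (hYc.down hEY h')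
        refine ⟨?_, ih2.trans ((hs.union hXc (fun h' => hE (hXG hAE h')) (hXv he)).eqv ?_ ?_)⟩
        · rw [mem_subd_of_notMem fun h' => he (hAW _ h')]
          exact fun h' => hAY h'.2
        · exact fun h' => hE ⟨hAE, Or.inl h'⟩
        · exact fun h' => he (Or.inr h')
  -- The remaining moves may be welds, but each is at a simplex with a vertex outside `W`, and the
  -- vertices of `X` all lie in `W`.
  have e3 : Eqv F (vertices F)ᶜ (M ∪ X) (cone w G ∪ X) := by
    refine Relation.ReflTransGen.lift (· ∪ X) ?_ _ _ hMw
    rintro Y Z ⟨B, b, hB, hb, hs⟩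
    have hBX : B ∉ X := fun h' => hB fun x hx => by
      by_contra hxW
      exact hXv hxW ⟨B, h', hx⟩
    exact ⟨B, b, fun h' => hB fun x hx => Or.inr ⟨B, h', hx⟩, fun h' => hb (Or.inr h'),
      hs.imp (fun h' => h'.union hXc hBX (hXv hb)) fun h' => h'.union hXc hBX (hXv hb)⟩
  have hac : a ∉ vertices (cone w F) := fun h' => by
    rcases vertices_cone_subset hF h' with h' | h'
    exacts [hwa h'.symm, haF h']
  -- The link of `A` in `w ⋆ F` is already a cone, so coning off its star is one subdivision. It
  -- yields `w ⋆ G ∪ X` and is used in reverse.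
  have e4 := hset.starrableLink_cone hw (cone w F) (isComplex_cone hF)
    ((mem_cone_of_notMem hF hwA).2 hA) hac (link_cone hF hA hwA)
  rw [subd_cone hF hne hwA hwa] at e4
  exact ⟨w, hwF, e1.trans (e2.2.trans (e3.trans e4.symm))⟩

theorem IsBall.boundary_link (hK : IsBall d K) (hA : A ∈ boundary K) :
    boundary (link A K) = link A (boundary K) := by
  obtain ⟨k, -, hL⟩ := hK.exists_isBall_link hA
  ext E
  rw [mem_link hK.isComplex_boundary]
  constructor
  · intro hE
    have hAE := ((mem_link hK.1).1 hE.1).1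
    exact ⟨hAE, (hK.mem_boundary_link hA.1 hL hAE).1 hE⟩
  · rintro ⟨hAE, h⟩
    exact (hK.mem_boundary_link hA.1 hL hAE).2 h

theorem IsBall.boundary_subd_of_notMem (hK : IsBall d K) (hA : A ∈ K) (hA' : A ∉ boundary K)
    (hne : A.Nonempty) (ha : a ∉ vertices K) : boundary (StellarTheory.subd A a K) = boundary K := by
  rw [hK.boundary_subd hA hne ha, subd_eq_self hK.isComplex_boundary hA']

/-- Every ball can be starred. -/
theorem IsBall.starred (hK : IsBall d K) : Starred (boundary K) K := by
  induction d using Nat.strong_induction_on generalizing K with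
  | _ d ih =>
    obtain ⟨-, A, hA, hd, h⟩ := hK
    induction h using Relation.ReflTransGen.head_induction_on with
    | refl =>
      have hne : A.Nonempty := Finset.card_pos.1 (by omega)
      rw [boundary_fullSimplex hne]
      exact starred_fullSimplex hne
    | @head X Y hm h ihY =>
      have hY : IsBall d Y := ⟨hm.isComplex_right, A, hA, hd, h⟩
      have hX : IsBall d X := hY.congr (Relation.ReflTransGen.single hm.symm)
      obtain ⟨B, b, -, -, hs | hs⟩ := hm
      · obtain ⟨-, hB, hne, hb, rfl⟩ := isSubdivision_iff.1 hs
        have hbd : b ∉ vertices (boundary X) := fun ⟨C, hC, h'⟩ => hb ⟨C, hC.1, h'⟩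
        by_cases hBb : B ∈ boundary X
        · rw [hX.boundary_subd hB hne hb] at ihY
          -- The remaining goal is to star the link of `B`. The outer induction provides this, since
          -- `B` is nonempty and so its link has smaller `d`.
          refine Starred.of_subd hX.1 hX.isComplex_boundary boundary_subset hBb hne hb ?_ ihY
          obtain ⟨k, hk, hL⟩ := hX.exists_isBall_link hBb
          rw [← hX.boundary_link hBb]
          exact ih k (by have := hne.card_pos; omega) hL
        · rw [hX.boundary_subd_of_notMem hB hBb hne hb] at ihY
          obtain ⟨v, hv, h'⟩ := ihY
          exact ⟨v, hv, (hs.eqv hBb hbd).trans h'⟩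
      · obtain ⟨-, hB, hne, hb, rfl⟩ := isSubdivision_iff.1 hs
        have hbd : b ∉ vertices (boundary Y) := fun ⟨C, hC, h'⟩ => hb ⟨C, hC.1, h'⟩
        by_cases hBb : B ∈ boundary Y
        · rw [hY.boundary_subd hB hne hb]
          exact ihY.subd hY.1 hY.isComplex_boundary boundary_subset hBb hne hb
        · rw [hY.boundary_subd_of_notMem hB hBb hne hb]
          obtain ⟨v, hv, h'⟩ := ihY
          exact ⟨v, hv, (hs.eqv hBb hbd).symm.trans h'⟩

/-- Being internal refers to the current complex, whereas the moves here avoid the boundary of the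
initial one. The two agree because such moves leave the boundary unchanged. -/
theorem IsBall.internalEquiv (hK : IsBall d K)
    (h : Eqv (boundary K) (vertices (boundary K))ᶜ K L) : InternalEquiv K L := by
  suffices H : IsBall d L ∧ boundary L = boundary K ∧ InternalEquiv K L from H.2.2
  induction h with
  | refl => exact ⟨hK, rfl, Relation.ReflTransGen.refl⟩
  | @tail X Y _ hm ih =>
    obtain ⟨hX, hXb, hE⟩ := ih
    have hY : IsBall d Y := hX.congr (Relation.ReflTransGen.single
      (hm.mono (Set.empty_subset _) (Set.subset_univ _)))
    obtain ⟨B, b, hB, hb, hs | hs⟩ := hm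
    · rw [← hXb] at hB
      refine ⟨hY, ?_, hE.tail (.subdivision B b hB hs)⟩
      obtain ⟨-, hBX, hne, hbX, rfl⟩ := isSubdivision_iff.1 hs
      rw [hX.boundary_subd_of_notMem hBX hB hne hbX, hXb]
    · obtain ⟨-, hBY, hne, hbY, rfl⟩ := isSubdivision_iff.1 hs
      have hbd : b ∉ vertices (boundary Y) := fun ⟨C, hC, h'⟩ => hbY ⟨C, hC.1, h'⟩
      -- Otherwise `b` would be a vertex of the boundary of `X`, which is that of `K`, contrary to
      -- `hb`.
      have hBb : B ∉ boundary Y := by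
        intro hBb
        refine hb ?_
        rw [← hXb, hY.boundary_subd hBY hne hbY]
        refine ⟨insert b ∅, ?_, by simp⟩
        rw [insert_mem_subd (by simp) (notMem_of_notMem_vertices hbY hBY) hbd,
          Finset.empty_union, Finset.subset_empty]
        exact ⟨hne.ne_empty, hBb⟩
      refine ⟨hY, ?_, hE.tail (.weld B b hBb hs)⟩
      rw [← hXb, hY.boundary_subd_of_notMem hBY hBb hne hbY]

end Starred

end StellarTheory

theorem theorem3p6 {V : Type*} [DecidableEq V] [Infinite V] (n : ℕ) (K : Set (Finset V))
    (hK : StellarTheory.IsStellarBall n K) (v : V)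
    (hv : v ∉ StellarTheory.vertices (StellarTheory.boundary K)) :
    StellarTheory.InternalEquiv K (StellarTheory.cone v (StellarTheory.boundary K)) := by
  have h := StellarTheory.isStellarBall_iff_isBall.1 hK
  exact h.internalEquiv (h.starred.eqv_cone h.isComplex_boundary hv)
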